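/- Let $B=(b_1,\dots,b_n)$ be an ordered family of linearly independent vectors in $\mathbb R^k$ with lattice $\Lambda(B)=\{\sum_i c_ib_i : c_i\in\mathbb Z\}$, let $b_1^*,\dots,b_n^*$ be its (unnormalized) Gram–Schmidt orthogonalization and $\mu_{i,j}=\langle b_i,b_j^*\rangle/\langle b_j^*,b_j^*\rangle$. For $\delta\in(1/4,1)$, $B$ is called $\delta$-LLL reduced if $|\mu_{i,j}|\le 1/2$ for all $j<i$ and $(\delta-\mu_{i+1,i}^2)\|b_i^*\|^2\le\|b_{i+1}^*\|^2$ for all $i<n$. The LLL algorithm with parameter $\delta$ starts from $B$ and $i=2$ and repeats the following until $i>n$, then outputs the current basis: (1) compute the Gram–Schmidt orthogonalization of the current basis; (2) for $j=i-1,\dots,1$ in this order replace $b_i$ by $b_i-\lfloor\mu_{i,j}\rceil b_j$, where $\mu_{i,j}$ is computed from the updated $b_i$ and $\lfloor x\rceil$ is the nearest integer to $x$ (of two equally near ones, the one of smaller absolute value); (3) if $(\delta-\mu_{i,i-1}^2)\|b_{i-1}^*\|^2\le\|b_i^*\|^2$, increase $i$ by $1$; otherwise swap $b_{i-1}$ and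 $b_i$ and replace $i$ by $\max(i-1,2)$. Bit operations are counted for the execution of this algorithm in which all numbers are fractions in lowest terms, written in binary, and all arithmetic (addition, subtraction, multiplication, division with remainder, Euclid's algorithm, comparison) is carried out bit by bit by the schoolbook procedures; loop counters and the bits moved in a swap are also charged. The ordering condition in (3) is tested in the equivalent form $\delta\le\|b_i^*\|^2/\|b_{i-1}^*\|^2+\mu_{i,i-1}^2$. A rational $\delta$ is written in binary, and the comparison is carried out bit by bit. An irrational $\delta$, which cannot be written down, is accessible only through the answers to questions "$\delta\le x$?" for fractions $x$, and a question costs one operation more than the number of bits of $x$. **Theorem 4.9.** There is an absolute constant $m$ such that for every $\delta\in(1/4,1)$ and every $c\in\mathbb N$ there is a constant $C$ with the following property. Let $B=(b_1,\dots,b_n)$ be a linearly independent family in $\mathbb Q^k$ such that the numerator and the denominator of each entry (in lowest terms) have at most $c$ bits. Then the LLL algorithm with parameter $\delta$ terminates on $B$; its output is a linearly independent family in $\mathbb Q^k$ that is $\delta$-LLL reduced and generates the same lattice $\Lambda(B)$; and its execution on bits produces this output with at most $C\,(k+1)^m$ bit operations. -/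

import Mathlib

/-! ### Lattices, reduced bases and the LLL algorithm in exact real arithmetic -/

namespace LLL

/-- The lattice `Λ(B)`: all integer linear combinations of the vectors of `B`. -/
def lattice {n k : ℕ} (b : Fin n → EuclideanSpace ℝ (Fin k)) :
    Submodule ℤ (EuclideanSpace ℝ (Fin k)) :=
  Submodule.span ℤ (Set.range b)

/-- The projection coefficient `⟨u, v⟩ / ⟨v, v⟩`. -/
noncomputable def projCoeff {k : ℕ} (u v : EuclideanSpace ℝ (Fin k)) : ℝ :=
  inner ℝ u v / inner ℝ v v

/-- The Gram-Schmidt orthogonalization (without normalization) of an ordered family. -/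
noncomputable def gso {n k : ℕ} (b : Fin n → EuclideanSpace ℝ (Fin k)) :
    Fin n → EuclideanSpace ℝ (Fin k) :=
  InnerProductSpace.gramSchmidt ℝ b

/-- `b` satisfies the two conditions of a `δ`-LLL reduced basis. -/
structure IsReduced {n k : ℕ} (δ : ℝ) (b : Fin n → EuclideanSpace ℝ (Fin k)) : Prop where
  /-- `|μ i j| ≤ 1/2` whenever `j < i`. -/
  projection : ∀ i j : Fin n, j < i → |projCoeff (b i) (gso b j)| ≤ 1 / 2
  /-- `(δ - μ (i+1) i ^ 2) ‖b* i‖ ^ 2 ≤ ‖b* (i+1)‖ ^ 2`. -/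
  ordering : ∀ i j : Fin n, (j : ℕ) = i + 1 →
    (δ - projCoeff (b j) (gso b i) ^ 2) * ‖gso b i‖ ^ 2 ≤ ‖gso b j‖ ^ 2

/-- The nearest integer; of two equally near integers, the one of smaller absolute value. -/
noncomputable def nearest (x : ℝ) : ℤ :=
  if 0 ≤ x then ⌈x - 1 / 2⌉ else ⌊x + 1 / 2⌋

/-- A state of the algorithm: the index (counted from `0`, so that it starts at `1`)
and the current basis, with vectors of type `V`. -/
structure State (n : ℕ) (V : Type) where
  idx : ℕ
  basis : Fin n → V

/-- The reduction step at index `i`: for `j = i - 1, …, 0` in this order replace `b i` by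
`b i - ⌊μ⌉ • b j`, where `μ` is the projection coefficient of the updated `b i` onto `star j`. -/
noncomputable def reduceStep {n k : ℕ} (star : Fin n → EuclideanSpace ℝ (Fin k)) (i : Fin n)
    (b : Fin n → EuclideanSpace ℝ (Fin k)) : Fin n → EuclideanSpace ℝ (Fin k) :=
  (List.finRange i).reverse.foldl
    (fun c j => Function.update c i
      (c i - nearest (projCoeff (c i) (star (Fin.castLE i.isLt.le j))) •
        c (Fin.castLE i.isLt.le j))) b

open Classical in
/-- One iteration of the loop of the LLL algorithm, at an index `i < n`:
orthogonalization, reduction step, swapping step. -/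
noncomputable def iteration {n k : ℕ} (δ : ℝ) (s : State n (EuclideanSpace ℝ (Fin k)))
    (h : s.idx < n) : State n (EuclideanSpace ℝ (Fin k)) :=
  let i : Fin n := ⟨s.idx, h⟩
  let p : Fin n := ⟨s.idx - 1, (Nat.sub_le _ _).trans_lt h⟩
  let star : Fin n → EuclideanSpace ℝ (Fin k) := gso s.basis
  let b : Fin n → EuclideanSpace ℝ (Fin k) := reduceStep star i s.basis
  if (δ - projCoeff (b i) (star p) ^ 2) * ‖star p‖ ^ 2 ≤ ‖star i‖ ^ 2 then
    ⟨s.idx + 1, b⟩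
  else
    ⟨max 1 (s.idx - 1), b ∘ Equiv.swap p i⟩

/-- `Run δ s out`: the loop, started in state `s`, stops after finitely many iterations
(when the index is no longer a valid position) with the basis `out`. -/
inductive Run {n k : ℕ} (δ : ℝ) :
    State n (EuclideanSpace ℝ (Fin k)) → (Fin n → EuclideanSpace ℝ (Fin k)) → Prop
  | halt (s : State n (EuclideanSpace ℝ (Fin k))) (h : n ≤ s.idx) : Run δ s s.basis
  | loop (s : State n (EuclideanSpace ℝ (Fin k))) (h : s.idx < n)
      (out : Fin n → EuclideanSpace ℝ (Fin k)) (hr : Run δ (iteration δ s h) out) : Run δ s out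

/-- The LLL algorithm with parameter `δ` terminates on the basis `b` with output `out`. -/
def Outputs {n k : ℕ} (δ : ℝ) (b out : Fin n → EuclideanSpace ℝ (Fin k)) : Prop :=
  Run δ ⟨1, b⟩ out

/-! ### Computations that count bit operations

`Timed α` is a result together with the number of bit operations spent on it.  Numbers are
strings of bits (`PosNum`, `Num`, `ZNum`).  All arithmetic below is done by the schoolbook
procedures, bit by bit: every function that inspects or produces a bit and every level of
its recursion over the bits spends an operation. -/

/-- A result and the number of bit operations spent on computing it. -/
structure Timed (α : Type) where
  val : α
  cost : ℕ

/-- Sequential composition adds the costs. -/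
instance : Monad Timed where
  pure a := ⟨a, 0⟩
  bind x f :=
    let y := f x.val
    ⟨y.val, x.cost + y.cost⟩

/-- Spend `t` bit operations. -/
def tick (t : ℕ) : Timed Unit := ⟨(), t⟩

/-- Successor of a positive integer. -/
def succT : PosNum → Timed PosNum
  | .one => do tick 1; pure (.bit0 .one)
  | .bit0 a => do tick 1; pure (.bit1 a)
  | .bit1 a => do
    tick 1
    let r ← succT a
    pure (.bit0 r)

/-- Predecessor of a positive integer. -/
def predT : PosNum → Timed Num
  | .one => do tick 1; pure .zero
  | .bit1 a => do tick 1; pure (.pos (.bit0 a))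
  | .bit0 a => do
    tick 1
    let r ← predT a
    match r with
    | .zero => pure (.pos .one)
    | .pos p => pure (.pos (.bit1 p))

/-- Sum of positive integers. -/
def posAddT : PosNum → PosNum → Timed PosNum
  | .one, b => do tick 1; succT b
  | a, .one => do tick 1; succT a
  | .bit0 a, .bit0 b => do
    tick 1
    let r ← posAddT a b
    pure (.bit0 r)
  | .bit0 a, .bit1 b => do
    tick 1
    let r ← posAddT a b
    pure (.bit1 r)
  | .bit1 a, .bit0 b => do
    tick 1
    let r ← posAddT a b
    pure (.bit1 r)
  | .bit1 a, .bit1 b => do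
    tick 1
    let r ← posAddT a b
    let s ← succT r
    pure (.bit0 s)

/-- `x ↦ 2 * x`. -/
def twiceT : ZNum → Timed ZNum
  | .zero => do tick 1; pure .zero
  | .pos a => do tick 1; pure (.pos (.bit0 a))
  | .neg a => do tick 1; pure (.neg (.bit0 a))

/-- `x ↦ 2 * x + 1`. -/
def twiceAddOneT : ZNum → Timed ZNum
  | .zero => do tick 1; pure (.pos .one)
  | .pos a => do tick 1; pure (.pos (.bit1 a))
  | .neg a => do
    tick 1
    let r ← predT a
    match r with
    | .zero => pure (.neg .one)
    | .pos p => pure (.neg (.bit1 p))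

/-- `x ↦ 2 * x - 1`. -/
def twiceSubOneT : ZNum → Timed ZNum
  | .zero => do tick 1; pure (.neg .one)
  | .neg a => do tick 1; pure (.neg (.bit1 a))
  | .pos a => do
    tick 1
    let r ← predT a
    match r with
    | .zero => pure (.pos .one)
    | .pos p => pure (.pos (.bit1 p))

/-- Difference of positive integers. -/
def posSubT : PosNum → PosNum → Timed ZNum
  | a, .one => do
    tick 1
    let r ← predT a
    pure r.toZNum
  | .one, b => do
    tick 1
    let r ← predT b
    pure r.toZNumNeg
  | .bit0 a, .bit0 b => do
    tick 1
    let r ← posSubT a b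
    twiceT r
  | .bit0 a, .bit1 b => do
    tick 1
    let r ← posSubT a b
    twiceSubOneT r
  | .bit1 a, .bit0 b => do
    tick 1
    let r ← posSubT a b
    twiceAddOneT r
  | .bit1 a, .bit1 b => do
    tick 1
    let r ← posSubT a b
    twiceT r

/-- Product of positive integers. -/
def posMulT (a : PosNum) : PosNum → Timed PosNum
  | .one => do tick 1; pure a
  | .bit0 b => do
    tick 1
    let r ← posMulT a b
    pure (.bit0 r)
  | .bit1 b => do
    tick 1
    let r ← posMulT a b
    posAddT (.bit0 r) a

/-- Sum of integers. -/
def addT : ZNum → ZNum → Timed ZNum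
  | .zero, b => do tick 1; pure b
  | a, .zero => do tick 1; pure a
  | .pos a, .pos b => do
    tick 1
    let r ← posAddT a b
    pure (.pos r)
  | .pos a, .neg b => do tick 1; posSubT a b
  | .neg a, .pos b => do tick 1; posSubT b a
  | .neg a, .neg b => do
    tick 1
    let r ← posAddT a b
    pure (.neg r)

/-- Negation of an integer. -/
def negT (a : ZNum) : Timed ZNum := do tick 1; pure (-a)

/-- Product of integers. -/
def mulT : ZNum → ZNum → Timed ZNum
  | .zero, _ => do tick 1; pure .zero
  | _, .zero => do tick 1; pure .zero
  | .pos a, .pos b => do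
    tick 1
    let r ← posMulT a b
    pure (.pos r)
  | .pos a, .neg b => do
    tick 1
    let r ← posMulT a b
    pure (.neg r)
  | .neg a, .pos b => do
    tick 1
    let r ← posMulT a b
    pure (.neg r)
  | .neg a, .neg b => do
    tick 1
    let r ← posMulT a b
    pure (.pos r)

/-- One step of long division: `q` is the quotient so far, `r` the remainder so far. -/
def divStepT (d : PosNum) (q r : Num) : Timed (Num × Num) :=
  match r with
  | .zero => do tick 1; pure (q.bit0, .zero)
  | .pos r => do
    tick 1
    let s ← posSubT r d
    match s with
    | .zero => pure (q.bit1, .zero)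
    | .pos p => pure (q.bit1, .pos p)
    | .neg _ => pure (q.bit0, .pos r)

/-- Long division: quotient and remainder of the second argument by `d`. -/
def divModT (d : PosNum) : PosNum → Timed (Num × Num)
  | .one => do tick 1; divStepT d .zero (.pos .one)
  | .bit0 a => do
    tick 1
    let r ← divModT d a
    divStepT d r.1 r.2.bit0
  | .bit1 a => do
    tick 1
    let r ← divModT d a
    divStepT d r.1 r.2.bit1

/-- Euclid's algorithm with at most the given number of divisions. -/
def gcdAuxT : ℕ → Num → PosNum → Timed PosNum
  | 0, _, b => do tick 1; pure b
  | _ + 1, .zero, b => do tick 1; pure b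
  | t + 1, .pos a, b => do
    tick 1
    let r ← divModT a b
    gcdAuxT t r.2 a

/-- Greatest common divisor; the number of divisions never exceeds the total bit length. -/
def gcdT (a : Num) (b : PosNum) : Timed PosNum := do
  tick (a.natSize + b.natSize)
  gcdAuxT (a.natSize + b.natSize + 1) a b

/-- A fraction written in bits. -/
structure Frac where
  num : ZNum
  den : PosNum

/-- The rational number that a fraction stands for. -/
def Frac.toRat (x : Frac) : ℚ := ((x.num : ℤ) : ℚ) / ((x.den : ℕ) : ℚ)

/-- The fraction in lowest terms of a rational number. -/
def Frac.ofRat (q : ℚ) : Frac := ⟨ZNum.ofInt' q.num, PosNum.ofNat q.den⟩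

/-- The number of bits of a fraction. -/
def Frac.size (x : Frac) : ℕ := x.num.abs.natSize + x.den.natSize

/-- The fraction `0 / 1`. -/
def Frac.zero : Frac := ⟨.zero, .one⟩

/-- The fraction `a / d`, put in lowest terms. -/
def reduceT (a : ZNum) (d : PosNum) : Timed Frac := do
  let g ← gcdT a.abs d
  let e ← divModT g d
  let den : PosNum := match e.1 with
    | .zero => .one
    | .pos p => p
  match a with
  | .zero => do tick 1; pure ⟨.zero, den⟩
  | .pos p => do
    tick 1
    let u ← divModT g p
    pure ⟨u.1.toZNum, den⟩
  | .neg p => do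
    tick 1
    let u ← divModT g p
    pure ⟨u.1.toZNumNeg, den⟩

/-- Sum of fractions. -/
def fracAddT (x y : Frac) : Timed Frac := do
  let a ← mulT x.num (.pos y.den)
  let b ← mulT y.num (.pos x.den)
  let c ← addT a b
  let d ← posMulT x.den y.den
  reduceT c d

/-- Product of fractions. -/
def fracMulT (x y : Frac) : Timed Frac := do
  let a ← mulT x.num y.num
  let d ← posMulT x.den y.den
  reduceT a d

/-- Difference of fractions. -/
def fracSubT (x y : Frac) : Timed Frac := do
  let a ← negT y.num
  fracAddT x ⟨a, y.den⟩

/-- Quotient of fractions (with value `0` if the divisor is `0`). -/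
def fracDivT (x y : Frac) : Timed Frac :=
  match y.num with
  | .zero => do tick 1; pure Frac.zero
  | .pos p => do tick 1; fracMulT x ⟨.pos y.den, p⟩
  | .neg p => do tick 1; fracMulT x ⟨.neg y.den, p⟩

/-- Decides `x ≤ y` for fractions. -/
def fracLeT (x y : Frac) : Timed Bool := do
  let a ← mulT x.num (.pos y.den)
  let b ← mulT y.num (.pos x.den)
  let c ← negT a
  let e ← addT b c
  tick 1
  match e with
  | .neg _ => pure false
  | _ => pure true

/-- The nearest integer to `p / d`; of two equally near ones, the smaller. -/
def posNearestT (p d : PosNum) : Timed Num := do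
  let u ← divModT d p
  match u.2 with
  | .zero => do tick 1; pure u.1
  | .pos r => do
    tick 1
    let s ← posSubT (.bit0 r) d
    match s with
    | .pos _ =>
      match u.1 with
      | .zero => do tick 1; pure (.pos .one)
      | .pos q => do
        tick 1
        let q' ← succT q
        pure (.pos q')
    | _ => do tick 1; pure u.1

/-- The nearest integer to a fraction; of two equally near ones, the one of smaller
absolute value. -/
def nearestT (x : Frac) : Timed ZNum :=
  match x.num with
  | .zero => do tick 1; pure .zero
  | .pos p => do
    tick 1
    let r ← posNearestT p x.den
    pure r.toZNum
  | .neg p => do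
    tick 1
    let r ← posNearestT p x.den
    pure r.toZNumNeg

/-- Run the body of a loop for `j = 0, …, m - 1` in this order; each turn also pays for the
bits of the loop counter. -/
def forUpT {σ : Type} (m : ℕ) (s : σ) (body : Fin m → σ → Timed σ) : Timed σ :=
  (List.finRange m).foldlM (fun s j => do tick (Nat.size m); body j s) s

/-- Run the body of a loop for `j = m - 1, …, 0` in this order; each turn also pays for the
bits of the loop counter. -/
def forDownT {σ : Type} (m : ℕ) (s : σ) (body : Fin m → σ → Timed σ) : Timed σ :=
  (List.finRange m).reverse.foldlM (fun s j => do tick (Nat.size m); body j s) s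

/-- A vector of fractions. -/
abbrev Vec (k : ℕ) : Type := Fin k → Frac

/-- The number of bits of a vector of fractions. -/
def vecSize {k : ℕ} (u : Vec k) : ℕ := ∑ l, (u l).size

/-- The inner product `⟨u, v⟩`. -/
def dotT {k : ℕ} (u v : Vec k) : Timed Frac :=
  forUpT k Frac.zero fun l acc => do
    let p ← fracMulT (u l) (v l)
    fracAddT acc p

/-- The vector `u - r v`, computed entry by entry. -/
def subMulT {k : ℕ} (u : Vec k) (r : Frac) (v : Vec k) : Timed (Vec k) :=
  forUpT k u fun l w => do
    let p ← fracMulT r (v l)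
    let x ← fracSubT (u l) p
    pure (Function.update w l x)

/-- The projection coefficient `⟨u, v⟩ / ⟨v, v⟩`. -/
def projCoeffT {k : ℕ} (u v : Vec k) : Timed Frac := do
  let a ← dotT u v
  let c ← dotT v v
  fracDivT a c

/-- The Gram-Schmidt orthogonalization: for `m = 0, …, n - 1`, subtract from the `m`-th vector
its projections onto the orthogonalized vectors already found. -/
def gsoT {n k : ℕ} (b : Fin n → Vec k) : Timed (Fin n → Vec k) :=
  forUpT n (fun _ _ => Frac.zero) fun m star => do
    let v ← forUpT m (b m) fun j acc => do
      let μ ← projCoeffT (b m) (star (Fin.castLE m.isLt.le j))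
      subMulT acc μ (star (Fin.castLE m.isLt.le j))
    pure (Function.update star m v)

/-- The reduction step at index `i`. -/
def reduceStepT {n k : ℕ} (star : Fin n → Vec k) (i : Fin n) (b : Fin n → Vec k) :
    Timed (Fin n → Vec k) :=
  forDownT i b fun j c => do
    let μ ← projCoeffT (c i) (star (Fin.castLE i.isLt.le j))
    let r ← nearestT μ
    let v ← subMulT (c i) ⟨r, .one⟩ (c (Fin.castLE i.isLt.le j))
    pure (Function.update c i v)

open Classical in
/-- Decides `δ ≤ x` for a fraction `x`.  If `δ` is rational, then `δ` is written in bits and the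
two fractions are compared bit by bit.  An irrational `δ` cannot be written down, so it is
available only through the answers to questions `δ ≤ x`, where a question costs one operation
for each bit of `x`. -/
noncomputable def thresholdT (δ : ℝ) (x : Frac) : Timed Bool :=
  if h : ∃ q : ℚ, (q : ℝ) = δ then fracLeT (Frac.ofRat h.choose) x
  else do tick (x.size + 1); pure (decide (δ ≤ (x.toRat : ℝ)))

/-- One iteration of the loop of the LLL algorithm on bits, with `le` deciding `δ ≤ x`.
As `‖star p‖ ^ 2` is positive, the ordering condition
`(δ - μ ^ 2) * ‖star p‖ ^ 2 ≤ ‖star i‖ ^ 2` is tested in the form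
`δ ≤ ‖star i‖ ^ 2 / ‖star p‖ ^ 2 + μ ^ 2`.  A swap pays for every bit that is moved. -/
def iterationT {n k : ℕ} (le : Frac → Timed Bool) (s : State n (Vec k)) (h : s.idx < n) :
    Timed (State n (Vec k)) := do
  let i : Fin n := ⟨s.idx, h⟩
  let p : Fin n := ⟨s.idx - 1, (Nat.sub_le _ _).trans_lt h⟩
  let star ← gsoT s.basis
  let b ← reduceStepT star i s.basis
  let μ ← projCoeffT (b i) (star p)
  let sq ← fracMulT μ μ
  let x ← dotT (star i) (star i)
  let y ← dotT (star p) (star p)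
  let ρ ← fracDivT x y
  let t ← fracAddT ρ sq
  let ok ← le t
  if ok then
    pure ⟨s.idx + 1, b⟩
  else do
    tick (vecSize (b p) + vecSize (b i))
    pure ⟨max 1 (s.idx - 1), b ∘ Equiv.swap p i⟩

/-- `RunT δ s out t`: the loop on bits, started in state `s`, stops after finitely many
iterations with the basis `out`, and altogether spends `t` bit operations.  Each test of the loop
condition pays for the bits of the index. -/
inductive RunT {n k : ℕ} (δ : ℝ) : State n (Vec k) → (Fin n → Vec k) → ℕ → Prop
  | halt (s : State n (Vec k)) (h : n ≤ s.idx) : RunT δ s s.basis (Nat.size n + 1)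
  | loop (s : State n (Vec k)) (h : s.idx < n) (out : Fin n → Vec k) (t : ℕ)
      (hr : RunT δ (iterationT (thresholdT δ) s h).val out t) :
      RunT δ s out (Nat.size n + 1 + (iterationT (thresholdT δ) s h).cost + t)

/-- The LLL algorithm on bits, with parameter `δ`, terminates on the rational basis `b` (whose
entries are given as fractions in lowest terms) with output `out` after `t` bit operations. -/
def OutputsT {n k : ℕ} (δ : ℝ) (b : Fin n → Fin k → ℚ) (out : Fin n → Vec k) (t : ℕ) : Prop :=
  RunT δ ⟨1, fun i j => Frac.ofRat (b i j)⟩ out t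

/-- A rational family, as vectors of Euclidean space. -/
noncomputable def realVec {n k : ℕ} (b : Fin n → Fin k → ℚ) :
    Fin n → EuclideanSpace ℝ (Fin k) :=
  fun i => WithLp.toLp 2 fun j => (b i j : ℝ)

end LLL

/-!
The argument has an analytic half, about the algorithm in exact arithmetic, and a bookkeeping
half, about the execution on bits.

*Termination.* `Shear` describes the effect of the reduction step: adding to `b i` an integer
combination of earlier vectors changes neither the lattice nor the Gram–Schmidt vectors.  A swap
changes only two Gram–Schmidt vectors; it keeps the product of their lengths and multiplies the
length of the first one by less than `√δ`.  Let `L` be a common denominator of the entries of the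
input, which can be chosen independently of `n` and `k` because the entries have at most `c` bits.
The Gram determinant `gdet L b j` of the first `j` vectors of `L • b` is a positive integer and
equals the product of the first `j` numbers `L ^ 2 * ‖gso b l‖ ^ 2`; hence the product of all these
determinants, the `potential`, is at least `1`, and every swap multiplies it by at most `δ`
(`iteration_spec`).  Its logarithm is polynomial in `k` at the start, and so is the
number of iterations (`exists_run`).

*Sizes.* By Cramer's rule, `L * gdet L b j` is a common denominator of all vectors that occur in the
orthogonalization (`exists_gdet_eq`), for suitable `j`.  The largest of the lengths `‖gso b i‖`
never grows; this bounds the determinants, and, as these are at least `1`, also bounds every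
`‖gso b i‖` from below.  While `b i` is being reduced it may become longer, but each of the fewer
than `n` subtractions multiplies the bound for its length by at most `growth n L A`, whose logarithm
is polynomial in `k` (`Bounded.norm_reduce_le`).  So the entries of all vectors have `s = O(k ^ 3)`
bits (`entryBound_lt`), where, as below, the constants depend on `δ` and `c`.

*Costs.* `Spec c P t` says that the result of the timed computation `c` satisfies `P` and that its
cost is at most `t`; sequential composition and loops respect it.  An operation on fractions with at
most `s` bits costs at most `opCost s = O(s ^ 4)`, and since all fractions are kept in lowest terms,
their number of bits depends only on their value.  With `O(k ^ 3)` operations per iteration and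
`O(k ^ 3)` iterations, the exponent `18` suffices.
-/

namespace LLL

/-! ### Results and costs of timed computations -/

@[simp] theorem val_pure {α : Type} (a : α) : (pure a : Timed α).val = a := rfl

@[simp] theorem cost_pure {α : Type} (a : α) : (pure a : Timed α).cost = 0 := rfl

@[simp] theorem val_bind {α β : Type} (x : Timed α) (f : α → Timed β) :
    (x >>= f).val = (f x.val).val := rfl

@[simp] theorem cost_bind {α β : Type} (x : Timed α) (f : α → Timed β) :
    (x >>= f).cost = x.cost + (f x.val).cost := rfl

@[simp] theorem cost_tick (t : ℕ) : (tick t).cost = t := rfl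

/-! ### Positive integers in binary -/

theorem natSize_le_iff {a : PosNum} {s : ℕ} : a.natSize ≤ s ↔ (a : ℕ) < 2 ^ s := by
  rw [PosNum.natSize_to_nat, Nat.size_le]

theorem num_natSize_le_iff {a : Num} {s : ℕ} : a.natSize ≤ s ↔ (a : ℕ) < 2 ^ s := by
  rw [Num.natSize_to_nat, Nat.size_le]

@[simp] theorem toNat_succT (a : PosNum) : ((succT a).val : ℕ) = a + 1 := by
  induction a with
  | one => simp [succT]
  | bit0 a ih => simp [succT]
  | bit1 a ih => simp [succT, ih]; omega

theorem cost_succT (a : PosNum) : (succT a).cost ≤ a.natSize := by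
  induction a with
  | one => simp [succT, PosNum.natSize]
  | bit0 a ih => simp [succT, PosNum.natSize]
  | bit1 a ih => simp [succT, PosNum.natSize]; omega

theorem toNat_predT (a : PosNum) : ((predT a).val : ℕ) + 1 = a := by
  induction a with
  | one => simp [predT]
  | bit1 a ih => simp [predT]
  | bit0 a ih =>
    simp only [predT, val_bind, PosNum.cast_bit0]
    cases h : (predT a).val with
    | zero => rw [h] at ih; simp at ih ⊢; omega
    | pos p => rw [h] at ih; simp at ih ⊢; omega

theorem cost_predT (a : PosNum) : (predT a).cost ≤ a.natSize := by
  induction a with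
  | one => simp [predT, PosNum.natSize]
  | bit1 a ih => simp [predT, PosNum.natSize]
  | bit0 a ih =>
    simp only [predT, cost_bind, PosNum.natSize, cost_tick]
    cases h : (predT a).val <;> simp <;> omega

@[simp] theorem toNat_posAddT (a b : PosNum) : ((posAddT a b).val : ℕ) = a + b := by
  fun_induction posAddT a b <;> simp_all <;> omega

/-- Carries are propagated by `succT` at every level of the recursion, so the bound is quadratic. -/
theorem cost_posAddT {a b : PosNum} {s : ℕ} (ha : a.natSize ≤ s) (hb : b.natSize ≤ s) :
    (posAddT a b).cost ≤ (s + 1) ^ 2 := by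
  induction s generalizing a b with
  | zero => have := a.natSize_pos; omega
  | succ s ih =>
    have h1 := cost_succT a
    have h2 := cost_succT b
    rcases a with _ | a | a <;> rcases b with _ | b | b <;>
      simp only [posAddT, cost_bind, cost_tick, cost_pure] <;>
      try nlinarith
    all_goals
      simp only [PosNum.natSize, Nat.succ_eq_add_one, add_le_add_iff_right] at ha hb
      have h3 := ih ha hb
      try nlinarith
    have h4 := cost_succT (posAddT a b).val
    have h5 : (posAddT a b).val.natSize ≤ s + 1 := by
      rw [natSize_le_iff] at ha hb ⊢
      rw [toNat_posAddT, pow_succ]; omega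
    nlinarith

theorem toInt_twiceT (a : ZNum) : ((twiceT a).val : ℤ) = 2 * a := by
  cases a <;> simp [twiceT] <;> ring

theorem predT_zero {a : PosNum} (h : (predT a).val = .zero) : (a : ℤ) = 1 := by
  have := toNat_predT a
  rw [h] at this
  rw [← PosNum.to_nat_to_int, ← this]; simp

theorem predT_pos {a p : PosNum} (h : (predT a).val = .pos p) : (a : ℤ) = p + 1 := by
  have := toNat_predT a
  rw [h] at this
  rw [← PosNum.to_nat_to_int, ← this]; simp

theorem toInt_predT (a : PosNum) : ((predT a).val : ℤ) = a - 1 := by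
  have := toNat_predT a
  rw [← PosNum.to_nat_to_int, ← this]; simp

theorem toInt_twiceAddOneT (a : ZNum) : ((twiceAddOneT a).val : ℤ) = 2 * a + 1 := by
  cases a with
  | zero => simp [twiceAddOneT]
  | pos a => simp [twiceAddOneT]; ring
  | neg a =>
    simp only [twiceAddOneT, val_bind]
    cases h : (predT a).val with
    | zero => simp [predT_zero h]
    | pos p => simp [predT_pos h]; ring

theorem toInt_twiceSubOneT (a : ZNum) : ((twiceSubOneT a).val : ℤ) = 2 * a - 1 := by
  cases a with
  | zero => simp [twiceSubOneT]
  | neg a => simp [twiceSubOneT]; ring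
  | pos a =>
    simp only [twiceSubOneT, val_bind]
    cases h : (predT a).val with
    | zero => simp [predT_zero h]
    | pos p => simp [predT_pos h]; ring

theorem cost_twiceT (a : ZNum) : (twiceT a).cost ≤ 1 := by
  cases a <;> simp [twiceT]

theorem cost_twiceAddOneT (a : ZNum) : (twiceAddOneT a).cost ≤ 1 + a.abs.natSize := by
  cases a with
  | zero => simp [twiceAddOneT]
  | pos a => simp [twiceAddOneT]
  | neg a =>
    have := cost_predT a
    simp only [twiceAddOneT, cost_bind, cost_tick, ZNum.abs, Num.natSize]
    cases h : (predT a).val <;> simp <;> omega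

theorem cost_twiceSubOneT (a : ZNum) : (twiceSubOneT a).cost ≤ 1 + a.abs.natSize := by
  cases a with
  | zero => simp [twiceSubOneT]
  | neg a => simp [twiceSubOneT]
  | pos a =>
    have := cost_predT a
    simp only [twiceSubOneT, cost_bind, cost_tick, ZNum.abs, Num.natSize]
    cases h : (predT a).val <;> simp <;> omega

@[simp] theorem toInt_posSubT (a b : PosNum) : ((posSubT a b).val : ℤ) = a - b := by
  fun_induction posSubT a b <;>
    simp_all [toInt_twiceT, toInt_twiceAddOneT, toInt_twiceSubOneT, toInt_predT] <;> ring

theorem znum_natSize_le_iff {a : ZNum} {s : ℕ} : a.abs.natSize ≤ s ↔ (a : ℤ).natAbs < 2 ^ s := by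
  rw [num_natSize_le_iff, ZNum.abs_to_nat]

theorem natSize_posSubT {a b : PosNum} {s : ℕ} (ha : a.natSize ≤ s) (hb : b.natSize ≤ s) :
    (posSubT a b).val.abs.natSize ≤ s := by
  rw [natSize_le_iff] at ha hb
  rw [znum_natSize_le_iff, toInt_posSubT, ← PosNum.to_nat_to_int, ← PosNum.to_nat_to_int]
  omega

theorem cost_posSubT {a b : PosNum} {s : ℕ} (ha : a.natSize ≤ s) (hb : b.natSize ≤ s) :
    (posSubT a b).cost ≤ (s + 1) ^ 2 := by
  induction s generalizing a b with
  | zero => have := a.natSize_pos; omega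
  | succ s ih =>
    have h1 := cost_predT a
    have h2 := cost_predT b
    rcases a with _ | a | a <;> rcases b with _ | b | b <;>
      simp only [posSubT, cost_bind, cost_tick, cost_pure] <;>
      try nlinarith
    all_goals
      simp only [PosNum.natSize, Nat.succ_eq_add_one, add_le_add_iff_right] at ha hb
      have h3 := ih ha hb
      have h4 := natSize_posSubT ha hb
      have h5 := cost_twiceT (posSubT a b).val
      have h6 := cost_twiceAddOneT (posSubT a b).val
      have h7 := cost_twiceSubOneT (posSubT a b).val
      nlinarith

@[simp] theorem toNat_posMulT (a b : PosNum) : ((posMulT a b).val : ℕ) = a * b := by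
  induction b with
  | one => simp [posMulT]
  | bit0 b ih => simp [posMulT, ih]; ring
  | bit1 b ih => simp [posMulT, ih]; ring

theorem cost_posMulT {a b : PosNum} {s : ℕ} (ha : a.natSize ≤ s) :
    (posMulT a b).cost ≤ (s + b.natSize + 1) ^ 3 := by
  induction b with
  | one => simp [posMulT]; exact Nat.one_le_pow _ _ (by omega)
  | bit0 b ih =>
    simp only [posMulT, cost_bind, cost_tick, cost_pure, PosNum.natSize]
    have : (s + b.natSize + 1) ^ 3 + 1 ≤ (s + (b.natSize + 1) + 1) ^ 3 :=
      Nat.pow_lt_pow_left (by omega) (by omega)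
    simp only [Nat.succ_eq_add_one]
    omega
  | bit1 b ih =>
    simp only [posMulT, cost_bind, cost_tick, PosNum.natSize]
    have h : (posAddT (posMulT a b).val.bit0 a).cost ≤ (s + b.natSize + 1 + 1) ^ 2 := by
      refine cost_posAddT ?_ (by omega)
      have h1 := natSize_le_iff.1 ha
      have h2 := natSize_le_iff.1 (le_refl b.natSize)
      rw [natSize_le_iff, PosNum.cast_bit0, toNat_posMulT, pow_succ, pow_add]
      have := Nat.mul_lt_mul'' h1 h2
      omega
    rw [show s + b.natSize.succ + 1 = s + b.natSize + 2 by omega]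
    generalize s + b.natSize = n at *
    nlinarith [Nat.zero_le (n^2), Nat.zero_le n]

/-! ### Integers in binary -/

@[simp] theorem toInt_posAddT (a b : PosNum) : ((posAddT a b).val : ℤ) = a + b := by
  rw [← PosNum.to_nat_to_int, toNat_posAddT]; simp

@[simp] theorem toInt_posMulT (a b : PosNum) : ((posMulT a b).val : ℤ) = a * b := by
  rw [← PosNum.to_nat_to_int, toNat_posMulT]; simp

@[simp] theorem toInt_addT (a b : ZNum) : ((addT a b).val : ℤ) = a + b := by
  rcases a with _ | a | a <;> rcases b with _ | b | b <;> simp [addT] <;> ring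

@[simp] theorem toInt_mulT (a b : ZNum) : ((mulT a b).val : ℤ) = a * b := by
  rcases a with _ | a | a <;> rcases b with _ | b | b <;> simp [mulT]

@[simp] theorem toInt_negT (a : ZNum) : ((negT a).val : ℤ) = -a := by
  simp [negT]

@[simp] theorem cost_negT (a : ZNum) : (negT a).cost = 1 := rfl

theorem cost_addT {a b : ZNum} {s : ℕ} (ha : a.abs.natSize ≤ s) (hb : b.abs.natSize ≤ s) :
    (addT a b).cost ≤ (s + 1) ^ 2 + 1 := by
  rcases a with _ | a | a <;> rcases b with _ | b | b <;>
    simp only [ZNum.abs, Num.natSize] at ha hb <;>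
    simp [addT]
  · rw [add_comm]; simpa using cost_posAddT ha hb
  · rw [add_comm]; simpa using cost_posSubT ha hb
  · rw [add_comm]; simpa using cost_posSubT hb ha
  · rw [add_comm]; simpa using cost_posAddT ha hb

theorem cost_mulT {a b : ZNum} {s : ℕ} (ha : a.abs.natSize ≤ s) (hb : b.abs.natSize ≤ s) :
    (mulT a b).cost ≤ (2 * s + 1) ^ 3 + 1 := by
  have key : ∀ p q : PosNum, p.natSize ≤ s → q.natSize ≤ s →
      (posMulT p q).cost ≤ (2 * s + 1) ^ 3 := fun p q hp hq =>
    (cost_posMulT hp).trans (Nat.pow_le_pow_left (by omega) 3)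
  rcases a with _ | a | a <;> rcases b with _ | b | b <;>
    simp only [ZNum.abs, Num.natSize] at ha hb <;>
    simp [mulT]
  all_goals rw [add_comm]; simpa using key _ _ ha hb

/-! ### Division with remainder and Euclid's algorithm -/

theorem divStepT_spec (d : PosNum) (q r : Num) (hr : (r : ℕ) < 2 * d) :
    ((divStepT d q r).val.1 : ℕ) * d + (divStepT d q r).val.2 = 2 * (q * d) + r ∧
      ((divStepT d q r).val.2 : ℕ) < d := by
  have hd := d.to_nat_pos
  cases r with
  | zero => simp [divStepT, hd]; ring
  | pos r =>
    have h := toInt_posSubT r d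
    simp only [divStepT, val_bind]
    rw [← PosNum.to_nat_to_int, ← PosNum.to_nat_to_int] at h
    simp only [Num.cast_pos] at hr ⊢
    cases hs : (posSubT r d).val with
    | zero =>
      rw [hs] at h
      simp only [ZNum.cast_zero'] at h
      simp only [val_pure, Num.cast_bit1, Num.cast_zero', add_zero]
      have : (r : ℕ) = d := by omega
      exact ⟨by rw [this]; ring, hd⟩
    | pos p =>
      rw [hs] at h
      simp only [ZNum.cast_pos] at h
      rw [← PosNum.to_nat_to_int] at h
      simp only [val_pure, Num.cast_bit1, Num.cast_pos]
      have : (r : ℕ) = d + p := by omega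
      exact ⟨by rw [this]; ring, by omega⟩
    | neg p =>
      rw [hs] at h
      simp only [ZNum.cast_neg] at h
      rw [← PosNum.to_nat_to_int] at h
      have := p.to_nat_pos
      simp only [val_pure, Num.cast_bit0, Num.cast_pos]
      exact ⟨by ring, by omega⟩

theorem cost_divStepT (d : PosNum) (q r : Num) {s : ℕ} (hd : d.natSize ≤ s)
    (hr : r.natSize ≤ s) : (divStepT d q r).cost ≤ (s + 1) ^ 2 + 1 := by
  cases r with
  | zero => simp [divStepT]
  | pos r =>
    have := cost_posSubT hr hd
    simp only [divStepT, cost_bind, cost_tick]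
    cases (posSubT r d).val <;> simp <;> omega

theorem divModT_spec (d a : PosNum) :
    ((divModT d a).val.1 : ℕ) * d + (divModT d a).val.2 = a ∧ ((divModT d a).val.2 : ℕ) < d := by
  have hd := d.to_nat_pos
  induction a with
  | one =>
    have := divStepT_spec d .zero (.pos .one) (by simp; omega)
    simpa [divModT] using this
  | bit0 a ih =>
    have := divStepT_spec d (divModT d a).val.1 (divModT d a).val.2.bit0 (by simp; omega)
    simp only [divModT, val_bind, PosNum.cast_bit0]
    refine ⟨this.1.trans ?_, this.2⟩
    rw [Num.cast_bit0, ← mul_add, ih.1]; ring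
  | bit1 a ih =>
    have := divStepT_spec d (divModT d a).val.1 (divModT d a).val.2.bit1 (by simp; omega)
    simp only [divModT, val_bind, PosNum.cast_bit1]
    refine ⟨this.1.trans ?_, this.2⟩
    rw [Num.cast_bit1, ← add_assoc, ← mul_add, ih.1]; ring

theorem toNat_divModT_fst (d a : PosNum) : ((divModT d a).val.1 : ℕ) = (a : ℕ) / d := by
  obtain ⟨h1, h2⟩ := divModT_spec d a
  rw [← h1, add_comm, Nat.add_mul_div_right _ _ d.to_nat_pos, Nat.div_eq_of_lt h2, zero_add]

theorem toNat_divModT_snd (d a : PosNum) : ((divModT d a).val.2 : ℕ) = (a : ℕ) % d := by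
  obtain ⟨h1, h2⟩ := divModT_spec d a
  rw [← h1, add_comm, Nat.add_mul_mod_self_right, Nat.mod_eq_of_lt h2]

theorem cost_divModT_aux {d : PosNum} {s : ℕ} (hd : d.natSize ≤ s) (a : PosNum) :
    (divModT d a).cost ≤ a.natSize * ((s + 2) ^ 2 + 2) := by
  have hd' := natSize_le_iff.1 hd
  induction a with
  | one =>
    have h1 := d.natSize_pos
    have := cost_divStepT d .zero (.pos .one) hd (by simp [Num.natSize, PosNum.natSize]; omega)
    simp only [divModT, cost_bind, cost_tick, PosNum.natSize, one_mul]
    nlinarith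
  | bit0 a ih =>
    have h := (divModT_spec d a).2
    have := cost_divStepT d (divModT d a).val.1 (divModT d a).val.2.bit0 (s := s + 1)
      (by omega) (by rw [num_natSize_le_iff, Num.cast_bit0, pow_succ]; omega)
    simp only [divModT, cost_bind, cost_tick, PosNum.natSize, Nat.succ_mul]
    rw [show s + 1 + 1 = s + 2 by omega] at this
    omega
  | bit1 a ih =>
    have h := (divModT_spec d a).2
    have := cost_divStepT d (divModT d a).val.1 (divModT d a).val.2.bit1 (s := s + 1)
      (by omega) (by rw [num_natSize_le_iff, Num.cast_bit1, pow_succ]; omega)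
    simp only [divModT, cost_bind, cost_tick, PosNum.natSize, Nat.succ_mul]
    rw [show s + 1 + 1 = s + 2 by omega] at this
    omega

theorem cost_divModT {d a : PosNum} {s : ℕ} (hd : d.natSize ≤ s) (ha : a.natSize ≤ s) :
    (divModT d a).cost ≤ (s + 2) ^ 3 := by
  refine (cost_divModT_aux hd a).trans ((Nat.mul_le_mul_right _ ha).trans ?_)
  nlinarith

/-- Once `a ≤ b`, every division shortens the total bit length, because `2 * (b % a) < b`. -/
theorem toNat_gcdAuxT (t : ℕ) (a : Num) (b : PosNum) (hab : (a : ℕ) ≤ b)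
    (ht : a.natSize + b.natSize ≤ t) : ((gcdAuxT t a b).val : ℕ) = Nat.gcd a b := by
  induction t generalizing a b with
  | zero => have := b.natSize_pos; omega
  | succ t ih =>
    cases a with
    | zero => simp [gcdAuxT]
    | pos a =>
      simp only [gcdAuxT, val_bind]
      have ha := a.to_nat_pos
      have hm := toNat_divModT_snd a b
      simp only [Num.cast_pos] at hab ⊢
      rw [ih _ _ (by rw [hm]; exact (Nat.mod_lt _ ha).le), hm, ← Nat.gcd_rec]
      have h1 : (divModT a b).val.2.natSize + 1 ≤ b.natSize := by
        have h2 := natSize_le_iff.1 (le_refl b.natSize)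
        have h3 : b.natSize = (b.natSize - 1) + 1 := by have := b.natSize_pos; omega
        rw [h3, add_le_add_iff_right, num_natSize_le_iff, hm]
        rw [h3, pow_succ] at h2
        have h4 := Nat.mod_add_div (b : ℕ) a
        have h5 := Nat.mod_lt (b : ℕ) ha
        have h6 : 1 ≤ (b : ℕ) / a := (Nat.one_le_div_iff ha).2 hab
        have h7 : (a : ℕ) ≤ a * ((b : ℕ) / a) := Nat.le_mul_of_pos_right _ h6
        omega
      rw [show (Num.pos a).natSize = a.natSize from rfl] at ht
      omega

theorem toNat_gcdT (a : Num) (b : PosNum) : ((gcdT a b).val : ℕ) = Nat.gcd a b := by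
  simp only [gcdT, val_bind]
  cases a with
  | zero => simp [gcdAuxT]
  | pos a =>
    simp only [gcdAuxT, val_bind]
    have ha := a.to_nat_pos
    have hm := toNat_divModT_snd a b
    rw [toNat_gcdAuxT, hm, Num.cast_pos, ← Nat.gcd_rec]
    · rw [hm]; exact (Nat.mod_lt _ ha).le
    · have : (divModT a b).val.2.natSize ≤ b.natSize := by
        rw [num_natSize_le_iff, hm]
        exact (Nat.mod_le _ _).trans_lt (natSize_le_iff.1 le_rfl)
      rw [show (Num.pos a).natSize = a.natSize from rfl]; omega

theorem cost_gcdAuxT {s : ℕ} (t : ℕ) (a : Num) (b : PosNum) (ha : a.natSize ≤ s)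
    (hb : b.natSize ≤ s) : (gcdAuxT t a b).cost ≤ (t + 1) * ((s + 2) ^ 3 + 1) := by
  induction t generalizing a b with
  | zero => simp [gcdAuxT]
  | succ t ih =>
    cases a with
    | zero => simpa [gcdAuxT] using Nat.one_le_iff_ne_zero.2 (by positivity)
    | pos a =>
      simp only [gcdAuxT, cost_bind, cost_tick]
      have h1 := cost_divModT ha hb
      have h2 := ih (divModT a b).val.2 a (by
        rw [num_natSize_le_iff, toNat_divModT_snd]
        exact (Nat.mod_le _ _).trans_lt (natSize_le_iff.1 hb)) ha
      rw [show (t + 1 + 1) * ((s + 2) ^ 3 + 1)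
        = (t + 1) * ((s + 2) ^ 3 + 1) + ((s + 2) ^ 3 + 1) by ring]
      omega

theorem cost_gcdT {s : ℕ} {a : Num} {b : PosNum} (ha : a.natSize ≤ s) (hb : b.natSize ≤ s) :
    (gcdT a b).cost ≤ 4 * (s + 2) ^ 4 := by
  simp only [gcdT, cost_bind, cost_tick]
  have h := cost_gcdAuxT (a.natSize + b.natSize + 1) a b ha hb
  have h2 : (a.natSize + b.natSize + 1 + 1) * ((s + 2) ^ 3 + 1)
      ≤ (2 * s + 2) * ((s + 2) ^ 3 + 1) := Nat.mul_le_mul_right _ (by omega)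
  have h3 : (2 * s + 2) * ((s + 2) ^ 3 + 1) + 2 * s ≤ 4 * (s + 2) ^ 4 := by
    have h4 : 2 ≤ (s + 2) ^ 3 := (by omega : 2 ≤ s + 2).trans (Nat.le_self_pow (by omega) _)
    have h5 : (s + 2) ^ 4 = (s + 2) * (s + 2) ^ 3 := by ring
    have h6 : s * 2 ≤ s * (s + 2) ^ 3 := Nat.mul_le_mul_left _ h4
    rw [h5]; nlinarith
  omega

/-! ### Fractions in lowest terms -/

@[simp] theorem toInt_ofInt' (z : ℤ) : ((ZNum.ofInt' z : ZNum) : ℤ) = z := by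
  rw [ZNum.ofInt'_eq, ZNum.to_of_int]

@[simp] theorem toNat_ofNat {n : ℕ} (h : 0 < n) : ((PosNum.ofNat n : PosNum) : ℕ) = n := by
  have key : ∀ m : ℕ, ((PosNum.ofNatSucc m : PosNum) : ℕ) = m + 1 := by
    intro m
    induction m with
    | zero => rfl
    | succ m ih => rw [PosNum.ofNatSucc, PosNum.succ_to_nat, ih]
  rw [PosNum.ofNat, key, Nat.pred_eq_sub_one]; omega

@[simp] theorem toRat_ofRat (q : ℚ) : (Frac.ofRat q).toRat = q := by
  simp only [Frac.toRat, Frac.ofRat, toInt_ofInt', toNat_ofNat q.den_pos]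
  exact Rat.num_div_den q

theorem eq_ofRat {x : Frac} {q : ℚ} (hn : (x.num : ℤ) = q.num) (hd : (x.den : ℕ) = q.den) :
    x = Frac.ofRat q := by
  obtain ⟨n, d⟩ := x
  simp only [Frac.ofRat, Frac.mk.injEq]
  constructor
  · rw [← ZNum.to_int_inj, hn, toInt_ofInt']
  · rw [← PosNum.to_nat_inj, hd, toNat_ofNat q.den_pos]

theorem zero_eq_ofRat : Frac.zero = Frac.ofRat 0 :=
  eq_ofRat (by simp [Frac.zero]) (by simp [Frac.zero])

theorem int_eq_ofRat (z : ZNum) : (⟨z, .one⟩ : Frac) = Frac.ofRat ((z : ℤ) : ℚ) :=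
  eq_ofRat (Rat.num_intCast _).symm (by rw [Rat.den_intCast]; rfl)

/-- Numerator and denominator have at most `s` bits. -/
def Frac.Fits (x : Frac) (s : ℕ) : Prop := x.num.abs.natSize ≤ s ∧ x.den.natSize ≤ s

theorem Frac.Fits.mono {x : Frac} {s t : ℕ} (h : x.Fits s) (hst : s ≤ t) : x.Fits t :=
  ⟨h.1.trans hst, h.2.trans hst⟩

theorem reduceT_val (a : ZNum) (d : PosNum) :
    (reduceT a d).val = Frac.ofRat (((a : ℤ) : ℚ) / ((d : ℕ) : ℚ)) := by
  have hd := d.to_nat_pos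
  have hg : ((gcdT a.abs d).val : ℕ) = (a : ℤ).natAbs.gcd d := by rw [toNat_gcdT, ZNum.abs_to_nat]
  have hnum : (((a : ℤ) : ℚ) / ((d : ℕ) : ℚ)).num = (a : ℤ) / ((a : ℤ).natAbs.gcd d : ℕ) := by
    rw [← Rat.mkRat_eq_div, ← Rat.normalize_eq_mkRat hd.ne', Rat.normalize_eq]
  have hden : (((a : ℤ) : ℚ) / ((d : ℕ) : ℚ)).den = (d : ℕ) / ((a : ℤ).natAbs.gcd d : ℕ) := by
    rw [← Rat.mkRat_eq_div, ← Rat.normalize_eq_mkRat hd.ne', Rat.normalize_eq]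
  have hq : ∀ e : Num, (e : ℕ) = (d : ℕ) / ((a : ℤ).natAbs.gcd d : ℕ) →
      (((match e with | .zero => .one | .pos p => p) : PosNum) : ℕ) =
        (d : ℕ) / ((a : ℤ).natAbs.gcd d : ℕ) := by
    intro e he
    have : 0 < (d : ℕ) / ((a : ℤ).natAbs.gcd d : ℕ) :=
      Nat.div_pos (Nat.gcd_le_right _ hd) (Nat.gcd_pos_of_pos_right _ hd)
    cases e with
    | zero => simp at he; omega
    | pos p => simpa using he
  have hden' := hq (divModT (gcdT a.abs d).val d).val.1 (by rw [toNat_divModT_fst, hg])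
  apply eq_ofRat
  · rw [hnum]
    cases a with
    | zero => simp [reduceT]
    | pos p =>
      have h1 : (((gcdT (.pos p) d).val : ℕ) : ℤ) =
          (((ZNum.pos p : ZNum) : ℤ).natAbs.gcd d : ℕ) := by
        rw [← hg]; rfl
      rw [← h1]
      simp only [reduceT, val_bind, val_pure, ZNum.abs, Num.cast_toZNum, ZNum.cast_pos]
      rw [← Num.to_nat_to_int, toNat_divModT_fst, ← PosNum.to_nat_to_int]; simp
    | neg p =>
      have h1 : (((gcdT (.pos p) d).val : ℕ) : ℤ) =
          (((ZNum.neg p : ZNum) : ℤ).natAbs.gcd d : ℕ) := by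
        rw [← hg]; rfl
      have h2 : ((gcdT (.pos p) d).val : ℕ) ∣ p := by
        rw [toNat_gcdT]; exact Nat.gcd_dvd_left _ _
      rw [← h1]
      simp only [reduceT, val_bind, val_pure, ZNum.abs, Num.cast_toZNumNeg, ZNum.cast_neg]
      rw [← Num.to_nat_to_int, toNat_divModT_fst, ← PosNum.to_nat_to_int,
        Int.neg_ediv_of_dvd (by exact_mod_cast h2)]; simp
  · rw [hden, ← hden']
    cases a <;> rfl

theorem reduceT_cost {a : ZNum} {d : PosNum} {s : ℕ} (ha : a.abs.natSize ≤ s) (hd : d.natSize ≤ s) :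
    (reduceT a d).cost ≤ 7 * (s + 2) ^ 4 := by
  have h1 := cost_gcdT ha hd
  have hg : (gcdT a.abs d).val.natSize ≤ s := by
    rw [natSize_le_iff, toNat_gcdT]
    exact (Nat.gcd_le_right _ d.to_nat_pos).trans_lt (natSize_le_iff.1 hd)
  have h2 := cost_divModT hg hd
  have h3 : 2 * (s + 2) ^ 3 + 1 ≤ 3 * (s + 2) ^ 4 := by
    have h4 : 1 ≤ (s + 2) ^ 3 := Nat.one_le_pow _ _ (by omega)
    have h5 : (s + 2) ^ 4 = (s + 2) * (s + 2) ^ 3 := by ring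
    rw [h5]; nlinarith [Nat.zero_le (s * (s + 2) ^ 3)]
  cases a with
  | zero =>
    simp only [ZNum.abs] at h1 h2
    simp only [reduceT, cost_bind, cost_tick, cost_pure, ZNum.abs]; omega
  | pos p =>
    have h4 := cost_divModT hg ha
    simp only [ZNum.abs] at h1 h2 h4
    simp only [reduceT, cost_bind, cost_tick, cost_pure, ZNum.abs]; omega
  | neg p =>
    have h4 := cost_divModT hg ha
    simp only [ZNum.abs] at h1 h2 h4
    simp only [reduceT, cost_bind, cost_tick, cost_pure, ZNum.abs]; omega

theorem fracAddT_val (x y : Frac) : (fracAddT x y).val = Frac.ofRat (x.toRat + y.toRat) := by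
  have hx : ((x.den : ℕ) : ℚ) ≠ 0 := Nat.cast_ne_zero.2 x.den.to_nat_pos.ne'
  have hy : ((y.den : ℕ) : ℚ) ≠ 0 := Nat.cast_ne_zero.2 y.den.to_nat_pos.ne'
  simp only [fracAddT, val_bind, reduceT_val, toInt_addT, toInt_mulT, toNat_posMulT, Frac.toRat]
  congr 1
  rw [div_add_div _ _ hx hy]
  congr 1
  · simp only [ZNum.cast_pos, ← PosNum.to_nat_to_int]; push_cast; ring
  · push_cast; ring

theorem fracMulT_val (x y : Frac) : (fracMulT x y).val = Frac.ofRat (x.toRat * y.toRat) := by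
  simp only [fracMulT, val_bind, reduceT_val, toInt_mulT, toNat_posMulT, Frac.toRat]
  congr 1
  rw [div_mul_div_comm]
  push_cast; ring

theorem fracSubT_val (x y : Frac) : (fracSubT x y).val = Frac.ofRat (x.toRat - y.toRat) := by
  simp only [fracSubT, val_bind, fracAddT_val]
  congr 1
  simp only [Frac.toRat, toInt_negT]; push_cast; ring

theorem fracDivT_val (x y : Frac) : (fracDivT x y).val = Frac.ofRat (x.toRat / y.toRat) := by
  obtain ⟨n, d⟩ := y
  cases n with
  | zero => simp [fracDivT, zero_eq_ofRat, Frac.toRat]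
  | pos p =>
    simp only [fracDivT, val_bind, fracMulT_val]
    congr 1
    simp only [Frac.toRat, ZNum.cast_pos, ← PosNum.to_nat_to_int, div_eq_mul_inv, mul_inv, inv_inv]
    push_cast; ring
  | neg p =>
    simp only [fracDivT, val_bind, fracMulT_val]
    congr 1
    simp only [Frac.toRat, ZNum.cast_neg, ← PosNum.to_nat_to_int, div_eq_mul_inv, mul_inv, inv_inv]
    push_cast; rw [inv_neg]; ring

theorem fracLeT_val (x y : Frac) : (fracLeT x y).val = decide (x.toRat ≤ y.toRat) := by
  have hx : (0 : ℚ) < ((x.den : ℕ) : ℚ) := Nat.cast_pos.2 x.den.to_nat_pos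
  have hy : (0 : ℚ) < ((y.den : ℕ) : ℚ) := Nat.cast_pos.2 y.den.to_nat_pos
  have key : x.toRat ≤ y.toRat ↔ (x.num : ℤ) * (y.den : ℤ) ≤ (y.num : ℤ) * (x.den : ℤ) := by
    rw [Frac.toRat, Frac.toRat, div_le_div_iff₀ hx hy]
    simp only [← PosNum.to_nat_to_int]
    exact_mod_cast Iff.rfl
  simp only [fracLeT, val_bind]
  have h := toInt_addT (mulT y.num (.pos x.den)).val (negT (mulT x.num (.pos y.den)).val).val
  simp only [toInt_mulT, toInt_negT, ZNum.cast_pos] at h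
  generalize
    (addT (mulT y.num (.pos x.den)).val (negT (mulT x.num (.pos y.den)).val).val).val = e at h
  symm
  cases e with
  | zero => simp only [val_pure, decide_eq_true_eq, key]; simp at h; linarith
  | pos p =>
    have := PosNum.cast_pos (α := ℤ) p
    simp only [val_pure, decide_eq_true_eq, key]; simp at h; linarith
  | neg p =>
    have := PosNum.cast_pos (α := ℤ) p
    simp only [val_pure, decide_eq_false_iff_not, key]; simp at h; linarith

/-- A bound for the cost of one operation on fractions whose numerators and denominators have
at most `s` bits. -/
def opCost (s : ℕ) : ℕ := 30 * (2 * s + 3) ^ 4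

theorem opCost_mono {s t : ℕ} (h : s ≤ t) : opCost s ≤ opCost t :=
  Nat.mul_le_mul_left _ (Nat.pow_le_pow_left (by omega) 4)

theorem natSize_mulT {a b : ZNum} {s : ℕ} (ha : a.abs.natSize ≤ s) (hb : b.abs.natSize ≤ s) :
    (mulT a b).val.abs.natSize ≤ 2 * s := by
  rw [znum_natSize_le_iff] at *
  rw [toInt_mulT, Int.natAbs_mul, two_mul, pow_add]
  exact Nat.mul_lt_mul'' ha hb

theorem natSize_posMulT {a b : PosNum} {s : ℕ} (ha : a.natSize ≤ s) (hb : b.natSize ≤ s) :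
    (posMulT a b).val.natSize ≤ 2 * s := by
  rw [natSize_le_iff] at *
  rw [toNat_posMulT, two_mul, pow_add]
  exact Nat.mul_lt_mul'' ha hb

theorem natSize_addT {a b : ZNum} {s : ℕ} (ha : a.abs.natSize ≤ s) (hb : b.abs.natSize ≤ s) :
    (addT a b).val.abs.natSize ≤ s + 1 := by
  rw [znum_natSize_le_iff] at *
  rw [toInt_addT, pow_succ]
  omega

theorem natSize_negT {a : ZNum} {s : ℕ} (ha : a.abs.natSize ≤ s) :
    (negT a).val.abs.natSize ≤ s := by
  rw [znum_natSize_le_iff] at *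
  rwa [toInt_negT, Int.natAbs_neg]

theorem pow_bounds (s : ℕ) : (2 * s + 1) ^ 3 ≤ (2 * s + 3) ^ 4 ∧ (2 * s + 1) ^ 2 ≤ (2 * s + 3) ^ 4 ∧
    81 ≤ (2 * s + 3) ^ 4 ∧ (2 * s + 2) ^ 2 ≤ (2 * s + 3) ^ 4 :=
  ⟨(Nat.pow_le_pow_left (by omega) 3).trans (Nat.pow_le_pow_right (by omega) (by omega)),
    (Nat.pow_le_pow_left (by omega) 2).trans (Nat.pow_le_pow_right (by omega) (by omega)),
    Nat.pow_le_pow_left (by omega : 3 ≤ 2 * s + 3) 4,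
    (Nat.pow_le_pow_left (by omega) 2).trans (Nat.pow_le_pow_right (by omega) (by omega))⟩

theorem fracAddT_cost_aux {x y : Frac} {s : ℕ} (hx : x.Fits s) (hy : y.Fits s) :
    (fracAddT x y).cost + 1 ≤ opCost s := by
  have h1 := cost_mulT (a := x.num) (b := .pos y.den) hx.1 hy.2
  have h2 := cost_mulT (a := y.num) (b := .pos x.den) hy.1 hx.2
  have h3 := natSize_mulT (a := x.num) (b := .pos y.den) hx.1 hy.2
  have h4 := natSize_mulT (a := y.num) (b := .pos x.den) hy.1 hx.2
  have h5 := cost_addT h3 h4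
  have h6 := natSize_addT h3 h4
  have h7 : (posMulT x.den y.den).cost ≤ (2 * s + 1) ^ 3 :=
    (cost_posMulT hx.2).trans (Nat.pow_le_pow_left (by have := hy.2; omega) 3)
  have h8 := reduceT_cost h6 ((natSize_posMulT hx.2 hy.2).trans (Nat.le_succ _))
  have h9 := pow_bounds s
  simp only [fracAddT, cost_bind, opCost]
  rw [show 2 * s + 1 + 2 = 2 * s + 3 by omega] at h8
  omega

theorem fracMulT_cost_aux {x y : Frac} {s : ℕ} (hx : x.Fits s) (hy : y.Fits s) :
    (fracMulT x y).cost + 1 ≤ opCost s := by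
  have h1 := cost_mulT hx.1 hy.1
  have h3 := natSize_mulT hx.1 hy.1
  have h7 : (posMulT x.den y.den).cost ≤ (2 * s + 1) ^ 3 :=
    (cost_posMulT hx.2).trans (Nat.pow_le_pow_left (by have := hy.2; omega) 3)
  have h8 := reduceT_cost h3 (natSize_posMulT hx.2 hy.2)
  have h9 := pow_bounds s
  have h10 : (2 * s + 2) ^ 4 ≤ (2 * s + 3) ^ 4 := Nat.pow_le_pow_left (by omega) 4
  simp only [fracMulT, cost_bind, opCost]
  omega

theorem fracAddT_cost {x y : Frac} {s : ℕ} (hx : x.Fits s) (hy : y.Fits s) :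
    (fracAddT x y).cost ≤ opCost s := (Nat.le_succ _).trans (fracAddT_cost_aux hx hy)

theorem fracMulT_cost {x y : Frac} {s : ℕ} (hx : x.Fits s) (hy : y.Fits s) :
    (fracMulT x y).cost ≤ opCost s := (Nat.le_succ _).trans (fracMulT_cost_aux hx hy)

theorem fracSubT_cost {x y : Frac} {s : ℕ} (hx : x.Fits s) (hy : y.Fits s) :
    (fracSubT x y).cost ≤ opCost s := by
  have := fracAddT_cost_aux (x := x) (y := ⟨(negT y.num).val, y.den⟩) hx ⟨natSize_negT hy.1, hy.2⟩
  simp only [fracSubT, cost_bind, cost_negT]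
  omega

theorem fracDivT_cost {x y : Frac} {s : ℕ} (hx : x.Fits s) (hy : y.Fits s) :
    (fracDivT x y).cost ≤ opCost s := by
  obtain ⟨n, d⟩ := y
  cases n with
  | zero =>
    have := pow_bounds s
    simp only [fracDivT, cost_bind, cost_tick, cost_pure, opCost]; omega
  | pos p =>
    have := fracMulT_cost_aux (x := x) (y := ⟨.pos d, p⟩) hx ⟨hy.2, hy.1⟩
    simp only [fracDivT, cost_bind, cost_tick]; omega
  | neg p =>
    have := fracMulT_cost_aux (x := x) (y := ⟨.neg d, p⟩) hx ⟨hy.2, hy.1⟩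
    simp only [fracDivT, cost_bind, cost_tick]; omega

theorem fracLeT_cost {x y : Frac} {s : ℕ} (hx : x.Fits s) (hy : y.Fits s) :
    (fracLeT x y).cost ≤ opCost s := by
  have h1 := cost_mulT (a := x.num) (b := .pos y.den) hx.1 hy.2
  have h2 := cost_mulT (a := y.num) (b := .pos x.den) hy.1 hx.2
  have h3 := natSize_mulT (a := x.num) (b := .pos y.den) hx.1 hy.2
  have h4 := natSize_mulT (a := y.num) (b := .pos x.den) hy.1 hx.2
  have h5 := cost_addT h4 (natSize_negT h3)
  have h9 := pow_bounds s
  simp only [fracLeT, cost_bind, cost_tick, cost_negT, opCost]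
  split <;> simp only [cost_pure] <;> omega

/-! ### Rounding -/

theorem nearest_neg (x : ℝ) : nearest (-x) = -nearest x := by
  rcases lt_trichotomy x 0 with h | h | h
  · rw [nearest, nearest, if_pos (by linarith), if_neg (by linarith), ← Int.ceil_neg]
    congr 1; ring
  · subst h
    have : nearest 0 = 0 := by
      rw [nearest, if_pos le_rfl, Int.ceil_eq_iff]; norm_num
    simp [this]
  · rw [nearest, nearest, if_neg (by linarith), if_pos h.le, ← Int.floor_neg]
    congr 1; ring

theorem posNearestT_val (p d : PosNum) :
    (((posNearestT p d).val : ℕ) : ℤ) = nearest (((p : ℕ) : ℝ) / ((d : ℕ) : ℝ)) := by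
  obtain ⟨h1, h2⟩ := divModT_spec d p
  have hd : (0 : ℝ) < ((d : ℕ) : ℝ) := Nat.cast_pos.2 d.to_nat_pos
  rw [nearest, if_pos (by positivity), eq_comm]
  have h3 : ((p : ℕ) : ℝ) / ((d : ℕ) : ℝ) =
      ((divModT d p).val.1 : ℕ) + ((divModT d p).val.2 : ℕ) / ((d : ℕ) : ℝ) := by
    rw [← h1, Nat.cast_add, Nat.cast_mul, add_div, mul_div_cancel_right₀ _ hd.ne']
  rw [h3, Int.ceil_eq_iff]
  simp only [posNearestT, val_bind]
  cases hr : (divModT d p).val.2 with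
  | zero => norm_num
  | pos r =>
    rw [hr] at h2
    simp only [Num.cast_pos] at h2 ⊢
    have h := toInt_posSubT r.bit0 d
    rw [PosNum.cast_bit0, ← PosNum.to_nat_to_int, ← PosNum.to_nat_to_int] at h
    have h4 : (((r : ℕ) : ℝ) / ((d : ℕ) : ℝ)) < 1 := by
      rw [div_lt_one hd]; exact_mod_cast h2
    have h5 : 0 ≤ (((r : ℕ) : ℝ) / ((d : ℕ) : ℝ)) := by positivity
    have down : 2 * (r : ℕ) ≤ (d : ℕ) → (((r : ℕ) : ℝ) / ((d : ℕ) : ℝ)) ≤ 1 / 2 := by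
      intro h
      rw [div_le_iff₀ hd]
      have : (2 : ℝ) * (r : ℕ) ≤ (d : ℕ) := by exact_mod_cast h
      linarith
    have up : (d : ℕ) < 2 * (r : ℕ) → 1 / 2 < (((r : ℕ) : ℝ) / ((d : ℕ) : ℝ)) := by
      intro h
      rw [lt_div_iff₀ hd]
      have : ((d : ℕ) : ℝ) < (2 : ℝ) * (r : ℕ) := by exact_mod_cast h
      linarith
    simp only [val_bind]
    cases hs : (posSubT r.bit0 d).val with
    | zero =>
      rw [hs] at h
      simp only [ZNum.cast_zero'] at h
      have := down (by omega)
      simp only [val_bind, val_pure, Int.cast_natCast]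
      constructor <;> linarith
    | neg t =>
      rw [hs] at h
      have ht := PosNum.cast_pos (α := ℤ) t
      simp only [ZNum.cast_neg] at h
      have := down (by omega)
      simp only [val_bind, val_pure, Int.cast_natCast]
      constructor <;> linarith
    | pos t =>
      rw [hs] at h
      have ht := PosNum.cast_pos (α := ℤ) t
      simp only [ZNum.cast_pos] at h
      have := up (by omega)
      cases hq : (divModT d p).val.1 with
      | zero =>
        simp only [val_bind, val_pure, Num.cast_pos, Num.cast_zero', PosNum.cast_one',
          Nat.cast_one, Int.cast_one, Nat.cast_zero]
        constructor <;> linarith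
      | pos q =>
        simp only [val_bind, val_pure, Num.cast_pos, toNat_succT, Nat.cast_add, Nat.cast_one,
          Int.cast_add, Int.cast_one, Int.cast_natCast]
        constructor <;> linarith

theorem nearestT_val (x : Frac) : ((nearestT x).val : ℤ) = nearest ((x.toRat : ℚ) : ℝ) := by
  obtain ⟨n, d⟩ := x
  cases n with
  | zero => simp [nearestT, Frac.toRat, nearest]; norm_num
  | pos p =>
    simp only [nearestT, val_bind, val_pure, Num.cast_toZNum, Frac.toRat, ZNum.cast_pos]
    rw [← Num.to_nat_to_int, posNearestT_val, ← PosNum.to_nat_to_int]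
    rw [Rat.cast_div, Int.cast_natCast, Rat.cast_natCast, Rat.cast_natCast]
  | neg p =>
    simp only [nearestT, val_bind, val_pure, Num.cast_toZNumNeg, Frac.toRat, ZNum.cast_neg]
    rw [← Num.to_nat_to_int, posNearestT_val, ← PosNum.to_nat_to_int, ← nearest_neg]
    rw [Int.cast_neg, neg_div, Rat.cast_neg, Rat.cast_div, Int.cast_natCast,
      Rat.cast_natCast, Rat.cast_natCast]

theorem posNearestT_cost {p d : PosNum} {s : ℕ} (hp : p.natSize ≤ s) (hd : d.natSize ≤ s) :
    (posNearestT p d).cost ≤ (s + 2) ^ 3 + (s + 2) ^ 2 + s + 2 := by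
  have h1 := cost_divModT hd hp
  have h2 : (divModT d p).val.2.natSize ≤ s := by
    rw [num_natSize_le_iff]
    exact (divModT_spec d p).2.trans (natSize_le_iff.1 hd)
  have h3 : (divModT d p).val.1.natSize ≤ s := by
    rw [num_natSize_le_iff, toNat_divModT_fst]
    exact (Nat.div_le_self _ _).trans_lt (natSize_le_iff.1 hp)
  simp only [posNearestT, cost_bind]
  cases hr : (divModT d p).val.2 with
  | zero => simp only [cost_bind, cost_tick, cost_pure]; omega
  | pos r =>
    rw [hr] at h2
    have h4 := cost_posSubT (a := r.bit0) (b := d) (s := s + 1)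
      (show (r.natSize).succ ≤ s + 1 from Nat.succ_le_succ h2) (by omega)
    rw [show s + 1 + 1 = s + 2 by omega] at h4
    simp only [cost_bind, cost_tick]
    cases (posSubT r.bit0 d).val with
    | zero => simp only [cost_bind, cost_tick, cost_pure]; omega
    | neg t => simp only [cost_bind, cost_tick, cost_pure]; omega
    | pos t =>
      cases hq : (divModT d p).val.1 with
      | zero => simp only [cost_bind, cost_tick, cost_pure]; omega
      | pos q =>
        rw [hq] at h3
        have h5 : (succT q).cost ≤ s := (cost_succT q).trans h3
        simp only [cost_bind, cost_tick, cost_pure]; omega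

theorem nearestT_cost {x : Frac} {s : ℕ} (hx : x.Fits s) : (nearestT x).cost ≤ opCost s := by
  have h9 := pow_bounds s
  have h10 : (s + 2) ^ 3 ≤ (2 * s + 3) ^ 4 :=
    (Nat.pow_le_pow_left (by omega) 3).trans (Nat.pow_le_pow_right (by omega) (by omega))
  have h11 : (s + 2) ^ 2 ≤ (2 * s + 3) ^ 4 :=
    (Nat.pow_le_pow_left (by omega) 2).trans (Nat.pow_le_pow_right (by omega) (by omega))
  have h12 : s ≤ (2 * s + 3) ^ 4 := (by omega : s ≤ 2 * s + 3).trans (Nat.le_self_pow (by omega) _)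
  obtain ⟨n, d⟩ := x
  cases n with
  | zero => simp only [nearestT, cost_bind, cost_tick, cost_pure, opCost]; omega
  | pos p =>
    have := posNearestT_cost (p := p) (d := d) hx.1 hx.2
    simp only [nearestT, cost_bind, cost_tick, cost_pure, opCost]; omega
  | neg p =>
    have := posNearestT_cost (p := p) (d := d) hx.1 hx.2
    simp only [nearestT, cost_bind, cost_tick, cost_pure, opCost]; omega

/-! ### Comparison with the parameter -/

theorem thresholdT_val (δ : ℝ) (x : Frac) :
    (thresholdT δ x).val = true ↔ δ ≤ ((x.toRat : ℚ) : ℝ) := by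
  unfold thresholdT
  split
  · next h =>
    rw [fracLeT_val, toRat_ofRat, decide_eq_true_iff]
    conv_rhs => rw [← h.choose_spec]
    exact_mod_cast Iff.rfl
  · simp

/-- The bits of a rational `δ` enter the cost of a comparison with `δ` as a constant. -/
theorem thresholdT_cost (δ : ℝ) : ∃ e : ℕ, ∀ (s : ℕ) (x : Frac), x.Fits s →
    (thresholdT δ x).cost ≤ opCost (s + e) := by
  by_cases h : ∃ q : ℚ, (q : ℝ) = δ
  · refine ⟨max (Frac.ofRat h.choose).num.abs.natSize (Frac.ofRat h.choose).den.natSize,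
      fun s x hx => ?_⟩
    rw [thresholdT, dif_pos h]
    apply fracLeT_cost _ (hx.mono (by omega))
    constructor <;> omega
  · refine ⟨0, fun s x hx => ?_⟩
    rw [thresholdT, dif_neg h]
    have h1 : x.size ≤ 2 * s := by have := hx.1; have := hx.2; simp only [Frac.size]; omega
    have h12 : 2 * s + 3 ≤ (2 * s + 3) ^ 4 := Nat.le_self_pow (by omega) _
    simp only [cost_bind, cost_tick, cost_pure, opCost, add_zero]; omega

/-! ### Gram–Schmidt orthogonalization -/

section Real

open Submodule

variable {n k : ℕ}

/-- The span of the vectors of `b` with index smaller than `i`. -/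
noncomputable def prefixSpan (b : Fin n → EuclideanSpace ℝ (Fin k)) (i : Fin n) :
    Submodule ℝ (EuclideanSpace ℝ (Fin k)) :=
  span ℝ (b '' Set.Iio i)

theorem mem_prefixSpan (b : Fin n → EuclideanSpace ℝ (Fin k)) {i j : Fin n} (h : j < i) :
    b j ∈ prefixSpan b i := subset_span ⟨j, h, rfl⟩

theorem prefixSpan_mono (b : Fin n → EuclideanSpace ℝ (Fin k)) {i j : Fin n} (h : j ≤ i) :
    prefixSpan b j ≤ prefixSpan b i :=
  span_mono (Set.image_mono (Set.Iio_subset_Iio h))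

theorem prefixSpan_gso (b : Fin n → EuclideanSpace ℝ (Fin k)) (i : Fin n) :
    prefixSpan (gso b) i = prefixSpan b i :=
  InnerProductSpace.span_gramSchmidt_Iio ℝ b i

theorem gso_mem_prefixSpan (b : Fin n → EuclideanSpace ℝ (Fin k)) {i j : Fin n} (h : j < i) :
    gso b j ∈ prefixSpan b i := prefixSpan_gso b i ▸ mem_prefixSpan (gso b) h

theorem inner_gso_of_ne (b : Fin n → EuclideanSpace ℝ (Fin k)) {i j : Fin n} (h : i ≠ j) :
    inner ℝ (gso b i) (gso b j) = 0 := InnerProductSpace.gramSchmidt_orthogonal ℝ b h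

theorem eq_gso_add_sum (b : Fin n → EuclideanSpace ℝ (Fin k)) (i : Fin n) :
    b i = gso b i + ∑ j ∈ Finset.Iio i, projCoeff (b i) (gso b j) • gso b j := by
  have h := InnerProductSpace.gramSchmidt_def'' ℝ b i
  refine h.trans ?_
  congr 1
  refine Finset.sum_congr rfl fun j _ => ?_
  rw [projCoeff, real_inner_self_eq_norm_sq, real_inner_comm]
  rfl

theorem sub_gso_mem (b : Fin n → EuclideanSpace ℝ (Fin k)) (i : Fin n) :
    b i - gso b i ∈ prefixSpan b i := by
  have h := eq_gso_add_sum b i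
  rw [sub_eq_iff_eq_add'.2 h]
  exact sum_mem fun j hj => smul_mem _ _ (gso_mem_prefixSpan b (Finset.mem_Iio.1 hj))

theorem inner_gso_eq_zero (b : Fin n → EuclideanSpace ℝ (Fin k)) (i : Fin n)
    {w : EuclideanSpace ℝ (Fin k)} (hw : w ∈ prefixSpan b i) : inner ℝ w (gso b i) = 0 := by
  rw [← prefixSpan_gso] at hw
  induction hw using span_induction with
  | mem x hx =>
    obtain ⟨j, hj, rfl⟩ := hx
    exact inner_gso_of_ne b (ne_of_lt hj)
  | zero => simp
  | add x y _ _ hx hy => rw [inner_add_left, hx, hy, add_zero]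
  | smul a x _ hx => rw [inner_smul_left, hx, mul_zero]

/-- `gso b i` is the only vector that differs from `b i` by an element of the span of the earlier
vectors and is orthogonal to these. -/
theorem eq_gso {b : Fin n → EuclideanSpace ℝ (Fin k)} {i : Fin n} {v : EuclideanSpace ℝ (Fin k)}
    (h1 : b i - v ∈ prefixSpan b i) (h2 : ∀ j < i, inner ℝ (b j) v = 0) : v = gso b i := by
  have h3 : v - gso b i ∈ prefixSpan b i := by
    have := sub_mem (sub_gso_mem b i) h1
    rwa [sub_sub_sub_cancel_left] at this
  have h4 : ∀ w ∈ prefixSpan b i, inner ℝ w v = 0 := by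
    intro w hw
    induction hw using span_induction with
    | mem x hx =>
      obtain ⟨j, hj, rfl⟩ := hx
      exact h2 j hj
    | zero => simp
    | add x y _ _ hx hy => rw [inner_add_left, hx, hy, add_zero]
    | smul a x _ hx => rw [inner_smul_left, hx, mul_zero]
  have h5 : inner ℝ (v - gso b i) (v - gso b i) = 0 := by
    rw [inner_sub_right, h4 _ h3, inner_gso_eq_zero b i h3, sub_zero]
  exact sub_eq_zero.1 (inner_self_eq_zero.1 h5)

theorem gso_congr {b c : Fin n → EuclideanSpace ℝ (Fin k)} {i : Fin n}
    (hW : prefixSpan c i = prefixSpan b i) (h : c i - b i ∈ prefixSpan b i) :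
    gso c i = gso b i := by
  refine (eq_gso ?_ fun j hj => ?_).symm
  · rw [hW, ← sub_add_sub_cancel]
    exact add_mem h (sub_gso_mem b i)
  · exact inner_gso_eq_zero b i (hW ▸ mem_prefixSpan c hj)

theorem gso_ne_zero {b : Fin n → EuclideanSpace ℝ (Fin k)} (h : LinearIndependent ℝ b)
    (i : Fin n) : gso b i ≠ 0 := InnerProductSpace.gramSchmidt_ne_zero i h

theorem projCoeff_self {v : EuclideanSpace ℝ (Fin k)} (h : v ≠ 0) : projCoeff v v = 1 :=
  div_self (inner_self_ne_zero.2 h)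

theorem projCoeff_sub (u v w : EuclideanSpace ℝ (Fin k)) :
    projCoeff (u - v) w = projCoeff u w - projCoeff v w := by
  rw [projCoeff, inner_sub_left, sub_div]; rfl

theorem projCoeff_zsmul (a : ℤ) (v w : EuclideanSpace ℝ (Fin k)) :
    projCoeff (a • v) w = a * projCoeff v w := by
  rw [projCoeff, ← Int.cast_smul_eq_zsmul ℝ, inner_smul_left, mul_div_assoc]; rfl

theorem inner_gso_self (b : Fin n → EuclideanSpace ℝ (Fin k)) (i : Fin n) :
    inner ℝ (b i) (gso b i) = inner ℝ (gso b i) (gso b i) := by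
  have := inner_gso_eq_zero b i (sub_gso_mem b i)
  rw [inner_sub_left] at this
  linarith

theorem projCoeff_gso_self {b : Fin n → EuclideanSpace ℝ (Fin k)} (h : LinearIndependent ℝ b)
    (i : Fin n) : projCoeff (b i) (gso b i) = 1 := by
  rw [projCoeff, inner_gso_self]; exact projCoeff_self (gso_ne_zero h i)

theorem projCoeff_gso_of_lt (b : Fin n → EuclideanSpace ℝ (Fin k)) {i j : Fin n} (h : j < i) :
    projCoeff (b j) (gso b i) = 0 := by
  rw [projCoeff, inner_gso_eq_zero b i (mem_prefixSpan b h), zero_div]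

theorem norm_sq_eq_sum (b : Fin n → EuclideanSpace ℝ (Fin k)) (i : Fin n) :
    ‖b i‖ ^ 2 = ‖gso b i‖ ^ 2 +
      ∑ j ∈ Finset.Iio i, projCoeff (b i) (gso b j) ^ 2 * ‖gso b j‖ ^ 2 := by
  have h : ∀ j, inner ℝ (b i) (gso b j) = projCoeff (b i) (gso b j) * ‖gso b j‖ ^ 2 := by
    intro j
    rw [projCoeff, real_inner_self_eq_norm_sq]
    by_cases h0 : gso b j = 0
    · simp [h0]
    · rw [div_mul_cancel₀]; simpa using h0
  rw [← real_inner_self_eq_norm_sq (b i)]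
  conv_lhs => rw [eq_gso_add_sum b i, inner_add_left, ← eq_gso_add_sum b i, real_inner_comm,
    inner_gso_self, real_inner_self_eq_norm_sq, sum_inner]
  congr 1
  refine Finset.sum_congr rfl fun j _ => ?_
  rw [inner_smul_left, real_inner_comm, h]
  simp only [conj_trivial]; ring

theorem norm_gso_le (b : Fin n → EuclideanSpace ℝ (Fin k)) (i : Fin n) : ‖gso b i‖ ≤ ‖b i‖ := by
  refine (sq_le_sq₀ (norm_nonneg _) (norm_nonneg _)).1 ?_
  rw [norm_sq_eq_sum b i]
  exact le_add_of_nonneg_right (Finset.sum_nonneg fun j _ => by positivity)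

/-! ### Lattices and linear independence -/

theorem linearIndependent_of_lattice_eq {b c : Fin n → EuclideanSpace ℝ (Fin k)}
    (h : lattice c = lattice b) (hb : LinearIndependent ℝ b) : LinearIndependent ℝ c := by
  have key : ∀ u v : Fin n → EuclideanSpace ℝ (Fin k), lattice u ≤ lattice v →
      span ℝ (Set.range u) ≤ span ℝ (Set.range v) := by
    intro u v huv
    rw [span_le]
    intro x hx
    exact span_subset_span ℤ ℝ _ (huv (subset_span hx))
  rw [linearIndependent_iff_card_eq_finrank_span] at hb ⊢
  rw [hb, Set.finrank, Set.finrank, le_antisymm (key _ _ h.le) (key _ _ h.ge)]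

/-- `c` arises from `b` by adding to the `i`-th vector an integer combination of earlier ones. -/
structure Shear (b c : Fin n → EuclideanSpace ℝ (Fin k)) (i : Fin n) : Prop where
  of_ne : ∀ l, l ≠ i → c l = b l
  sub_mem : c i - b i ∈ span ℤ (b '' Set.Iio i)

theorem Shear.refl (b : Fin n → EuclideanSpace ℝ (Fin k)) (i : Fin n) : Shear b b i :=
  ⟨fun _ _ => rfl, by simp⟩

theorem Shear.image_eq {b c : Fin n → EuclideanSpace ℝ (Fin k)} {i : Fin n} (h : Shear b c i) :
    c '' Set.Iio i = b '' Set.Iio i :=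
  Set.image_congr fun l hl => h.of_ne l (ne_of_lt hl)

theorem Shear.lattice_eq {b c : Fin n → EuclideanSpace ℝ (Fin k)} {i : Fin n} (h : Shear b c i) :
    lattice c = lattice b := by
  have key : ∀ u v : Fin n → EuclideanSpace ℝ (Fin k), (∀ l, l ≠ i → u l = v l) →
      u i - v i ∈ span ℤ (v '' Set.Iio i) → lattice u ≤ lattice v := by
    intro u v h1 h2
    rw [lattice, span_le]
    rintro _ ⟨l, rfl⟩
    by_cases hl : l = i
    · subst hl
      rw [← sub_add_cancel (u l) (v l)]
      exact add_mem (span_mono (Set.image_subset_range _ _) h2) (subset_span ⟨l, rfl⟩)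
    · rw [h1 l hl]; exact subset_span ⟨l, rfl⟩
  refine le_antisymm (key _ _ h.of_ne h.sub_mem) (key _ _ (fun l hl => (h.of_ne l hl).symm) ?_)
  rw [h.image_eq, ← neg_sub]
  exact neg_mem h.sub_mem

theorem Shear.gso_eq {b c : Fin n → EuclideanSpace ℝ (Fin k)} {i : Fin n} (h : Shear b c i) :
    gso c = gso b := by
  have h1 : c i - b i ∈ prefixSpan b i := span_subset_span ℤ ℝ _ h.sub_mem
  have key : ∀ u v : Fin n → EuclideanSpace ℝ (Fin k), (∀ l, l ≠ i → u l = v l) →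
      u i - v i ∈ prefixSpan v i → ∀ l, prefixSpan u l ≤ prefixSpan v l := by
    intro u v h1 h2 l
    rw [prefixSpan, span_le]
    rintro _ ⟨j, hj, rfl⟩
    by_cases hji : j = i
    · subst hji
      rw [← sub_add_cancel (u j) (v j)]
      exact add_mem (prefixSpan_mono v (le_of_lt hj) h2) (mem_prefixSpan v hj)
    · rw [h1 j hji]; exact mem_prefixSpan v hj
  funext l
  apply gso_congr
  · refine le_antisymm (key _ _ h.of_ne h1 l) (key _ _ (fun l hl => (h.of_ne l hl).symm) ?_ l)
    rw [prefixSpan, h.image_eq, ← neg_sub]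
    exact neg_mem h1
  · by_cases hl : l = i
    · subst hl; exact h1
    · rw [h.of_ne l hl, sub_self]; exact zero_mem _

/-! ### Exchanging two adjacent vectors -/

theorem prefixSpan_comp_swap (b : Fin n → EuclideanSpace ℝ (Fin k)) {p i l : Fin n}
    (h : (p < l ∧ i < l) ∨ (l ≤ p ∧ l ≤ i)) :
    prefixSpan (b ∘ Equiv.swap p i) l = prefixSpan b l := by
  rw [prefixSpan, prefixSpan, Set.image_comp]
  congr 2
  ext j
  simp only [Set.mem_image, Set.mem_Iio]
  have key : ∀ j, j < l → Equiv.swap p i j < l := by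
    intro j hj
    rcases h with h | h
    · by_cases h1 : j = p
      · rw [h1, Equiv.swap_apply_left]; exact h.2
      · by_cases h2 : j = i
        · rw [h2, Equiv.swap_apply_right]; exact h.1
        · rwa [Equiv.swap_apply_of_ne_of_ne h1 h2]
    · rwa [Equiv.swap_apply_of_ne_of_ne (hj.trans_le h.1).ne (hj.trans_le h.2).ne]
  constructor
  · rintro ⟨x, hx, rfl⟩; exact key x hx
  · intro hj; exact ⟨_, key j hj, Equiv.swap_apply_self p i j⟩

theorem gso_comp_swap_of_ne (b : Fin n → EuclideanSpace ℝ (Fin k)) {p i l : Fin n}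
    (hpi : (p : ℕ) + 1 = i) (hp : l ≠ p) (hi : l ≠ i) :
    gso (b ∘ Equiv.swap p i) l = gso b l := by
  apply gso_congr
  · apply prefixSpan_comp_swap
    simp only [Fin.lt_def, Fin.le_def, ne_eq, Fin.ext_iff] at *
    omega
  · rw [Function.comp_apply, Equiv.swap_apply_of_ne_of_ne hp hi, sub_self]; exact zero_mem _

theorem gso_comp_swap_left (b : Fin n → EuclideanSpace ℝ (Fin k)) {p i : Fin n}
    (hpi : (p : ℕ) + 1 = i) :
    gso (b ∘ Equiv.swap p i) p = gso b i + projCoeff (b i) (gso b p) • gso b p := by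
  have hlt : p < i := by rw [Fin.lt_def]; omega
  have hW := prefixSpan_comp_swap b (p := p) (i := i) (l := p) (Or.inr ⟨le_rfl, hlt.le⟩)
  refine (eq_gso ?_ fun j hj => ?_).symm
  · rw [hW, Function.comp_apply, Equiv.swap_apply_left]
    have h1 := eq_gso_add_sum b i
    have h2 : Finset.Iio i = insert p (Finset.Iio p) := by
      ext j; simp only [Finset.mem_Iio, Finset.mem_insert, Fin.lt_def, Fin.ext_iff]; omega
    rw [h2, Finset.sum_insert (by simp), ← add_assoc] at h1
    rw [sub_eq_iff_eq_add'.2 h1]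
    exact sum_mem fun j hj => smul_mem _ _ (gso_mem_prefixSpan b (Finset.mem_Iio.1 hj))
  · have h1 := mem_prefixSpan (b ∘ Equiv.swap p i) hj
    rw [hW] at h1
    rw [inner_add_right, inner_smul_right, inner_gso_eq_zero b p h1,
      inner_gso_eq_zero b i (prefixSpan_mono b hlt.le h1)]
    simp

theorem norm_sq_gso_comp_swap_left (b : Fin n → EuclideanSpace ℝ (Fin k)) {p i : Fin n}
    (hpi : (p : ℕ) + 1 = i) :
    ‖gso (b ∘ Equiv.swap p i) p‖ ^ 2 =
      ‖gso b i‖ ^ 2 + projCoeff (b i) (gso b p) ^ 2 * ‖gso b p‖ ^ 2 := by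
  have hne : i ≠ p := by rw [ne_eq, Fin.ext_iff]; omega
  rw [gso_comp_swap_left b hpi, norm_add_sq_real, inner_smul_right, inner_gso_of_ne b hne,
    norm_smul, mul_pow, Real.norm_eq_abs, sq_abs]
  ring

theorem gso_comp_swap_right (b : Fin n → EuclideanSpace ℝ (Fin k)) {p i : Fin n}
    (hpi : (p : ℕ) + 1 = i) (hne : gso (b ∘ Equiv.swap p i) p ≠ 0) :
    gso (b ∘ Equiv.swap p i) i = gso b p -
      projCoeff (gso b p) (gso (b ∘ Equiv.swap p i) p) • gso (b ∘ Equiv.swap p i) p := by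
  have hlt : p < i := by rw [Fin.lt_def]; omega
  set c := b ∘ Equiv.swap p i with hc
  have hW : prefixSpan c p = prefixSpan b p := prefixSpan_comp_swap b (Or.inr ⟨le_rfl, hlt.le⟩)
  have hci : c i = b p := by rw [hc, Function.comp_apply, Equiv.swap_apply_right]
  have horth : ∀ w ∈ prefixSpan c p, inner ℝ w
      (gso b p - projCoeff (gso b p) (gso c p) • gso c p) = 0 := by
    intro w hw
    rw [inner_sub_right, inner_smul_right, inner_gso_eq_zero c p hw,
      inner_gso_eq_zero b p (hW ▸ hw)]
    simp
  refine (eq_gso ?_ fun j hj => ?_).symm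
  · rw [hci, ← sub_add]
    exact add_mem (prefixSpan_mono c hlt.le (hW ▸ sub_gso_mem b p))
      (smul_mem _ _ (gso_mem_prefixSpan c hlt))
  · rcases (show j < p ∨ j = p by simp only [Fin.lt_def, Fin.ext_iff] at *; omega) with h | rfl
    · exact horth _ (mem_prefixSpan c h)
    · rw [← sub_add_cancel (c j) (gso c j), inner_add_left, horth _ (sub_gso_mem c j), zero_add,
        inner_sub_right, inner_smul_right, projCoeff,
        div_mul_cancel₀ _ (inner_self_ne_zero.2 hne), real_inner_comm, sub_self]

theorem norm_sq_gso_comp_swap_right (b : Fin n → EuclideanSpace ℝ (Fin k)) {p i : Fin n}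
    (hpi : (p : ℕ) + 1 = i) (hne : gso (b ∘ Equiv.swap p i) p ≠ 0) :
    ‖gso (b ∘ Equiv.swap p i) p‖ ^ 2 * ‖gso (b ∘ Equiv.swap p i) i‖ ^ 2 =
      ‖gso b p‖ ^ 2 * ‖gso b i‖ ^ 2 ∧
    ‖gso (b ∘ Equiv.swap p i) i‖ ≤ ‖gso b p‖ := by
  have hip : i ≠ p := by rw [ne_eq, Fin.ext_iff]; omega
  have h0 : ‖gso (b ∘ Equiv.swap p i) p‖ ^ 2 ≠ 0 := by simpa using hne
  have h1 : ‖gso (b ∘ Equiv.swap p i) i‖ ^ 2 = ‖gso b p‖ ^ 2 -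
      (inner ℝ (gso b p) (gso (b ∘ Equiv.swap p i) p)) ^ 2 /
        ‖gso (b ∘ Equiv.swap p i) p‖ ^ 2 := by
    rw [gso_comp_swap_right b hpi hne, norm_sub_sq_real, inner_smul_right, norm_smul, mul_pow,
      Real.norm_eq_abs, sq_abs, projCoeff, real_inner_self_eq_norm_sq]
    field_simp
    ring
  have h2 : inner ℝ (gso b p) (gso (b ∘ Equiv.swap p i) p) =
      projCoeff (b i) (gso b p) * ‖gso b p‖ ^ 2 := by
    rw [gso_comp_swap_left b hpi, inner_add_right, inner_smul_right, real_inner_self_eq_norm_sq,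
      inner_gso_of_ne b hip.symm, zero_add]
  constructor
  · rw [h1, mul_sub, mul_div_cancel₀ _ h0, h2, norm_sq_gso_comp_swap_left b hpi]
    ring
  · refine (sq_le_sq₀ (norm_nonneg _) (norm_nonneg _)).1 ?_
    rw [h1]
    exact sub_le_self _ (by positivity)

theorem lattice_comp_swap (b : Fin n → EuclideanSpace ℝ (Fin k)) (p i : Fin n) :
    lattice (b ∘ Equiv.swap p i) = lattice b := by
  rw [lattice, lattice, EquivLike.range_comp]

/-! ### The reduction step -/

theorem foldl_finRange_reverse_induction {σ : Type*} {m : ℕ} (Q : ℕ → σ → Prop)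
    (f : σ → Fin m → σ) (h : ∀ (j : Fin m) (s : σ), Q (j + 1) s → Q j (f s j)) (s : σ)
    (hs : Q m s) : Q 0 ((List.finRange m).reverse.foldl f s) := by
  induction m generalizing s with
  | zero => simpa using hs
  | succ m ih =>
    rw [List.finRange_succ_last, List.reverse_append, List.reverse_singleton,
      List.singleton_append, List.foldl_cons, ← List.map_reverse, List.foldl_map]
    exact ih (fun s j => f s j.castSucc) (fun j s hs => h j.castSucc s hs) _ (h (Fin.last m) s hs)

theorem abs_sub_nearest (x : ℝ) : |x - nearest x| ≤ 1 / 2 := by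
  rw [abs_le, nearest]
  split
  · have h1 := Int.le_ceil (x - 1 / 2)
    have h2 := Int.ceil_lt_add_one (x - 1 / 2)
    constructor <;> linarith
  · have h1 := Int.floor_le (x + 1 / 2)
    have h2 := Int.lt_floor_add_one (x + 1 / 2)
    constructor <;> linarith

theorem Shear.update {b c : Fin n → EuclideanSpace ℝ (Fin k)} {i j : Fin n} (h : Shear b c i)
    (hj : j < i) (a : ℤ) : Shear b (Function.update c i (c i - a • c j)) i := by
  constructor
  · intro l hl
    rw [Function.update_of_ne hl, h.of_ne l hl]
  · rw [Function.update_self, sub_right_comm]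
    refine Submodule.sub_mem _ h.sub_mem (smul_mem _ _ (subset_span ⟨j, hj, ?_⟩))
    rw [h.of_ne j hj.ne]

theorem reduceStep_spec {b : Fin n → EuclideanSpace ℝ (Fin k)} (hb : LinearIndependent ℝ b)
    (i : Fin n) : Shear b (reduceStep (gso b) i b) i ∧
      ∀ j < i, |projCoeff (reduceStep (gso b) i b i) (gso b j)| ≤ 1 / 2 := by
  have := foldl_finRange_reverse_induction
    (fun m (c : Fin n → EuclideanSpace ℝ (Fin k)) => Shear b c i ∧
      ∀ j : Fin n, m ≤ j → j < i → |projCoeff (c i) (gso b j)| ≤ 1 / 2)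
    (fun c j => Function.update c i
      (c i - nearest (projCoeff (c i) (gso b (Fin.castLE i.isLt.le j))) •
        c (Fin.castLE i.isLt.le j))) ?_ b ⟨Shear.refl b i, fun j h1 h2 => ?_⟩
  · exact ⟨this.1, fun j hj => this.2 j (Nat.zero_le _) hj⟩
  · rintro j c ⟨h1, h2⟩
    have hj : Fin.castLE i.isLt.le j < i := by rw [Fin.lt_def]; exact j.isLt
    refine ⟨h1.update hj _, fun l hl hli => ?_⟩
    rw [Function.update_self, projCoeff_sub, projCoeff_zsmul, h1.of_ne _ hj.ne]
    rcases hl.eq_or_lt with h | h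
    · have : l = Fin.castLE i.isLt.le j := Fin.ext h.symm
      rw [this, projCoeff_gso_self hb, mul_one]
      exact abs_sub_nearest _
    · rw [projCoeff_gso_of_lt b (show Fin.castLE i.isLt.le j < l from h), mul_zero, sub_zero]
      exact h2 l h hli
  · exact absurd h2 (by rw [Fin.lt_def]; omega)

end Real

section Integrality

open Submodule Matrix

variable {n k : ℕ}

/-! ### Gram determinants and denominators -/

/-- The vector `t • x` has integer entries. -/
def Integral (t : ℝ) (x : EuclideanSpace ℝ (Fin k)) : Prop := ∀ l, ∃ a : ℤ, t * x l = a

theorem Integral.of_mem_span {t : ℝ} {S : Set (EuclideanSpace ℝ (Fin k))}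
    (hS : ∀ x ∈ S, Integral t x) {x : EuclideanSpace ℝ (Fin k)} (hx : x ∈ span ℤ S) :
    Integral t x := by
  induction hx using span_induction with
  | mem x h => exact hS x h
  | zero => exact fun l => ⟨0, by simp⟩
  | add x y _ _ hx hy =>
    intro l
    obtain ⟨a, ha⟩ := hx l
    obtain ⟨c, hc⟩ := hy l
    exact ⟨a + c, by rw [PiLp.add_apply, mul_add, ha, hc]; push_cast; ring⟩
  | smul z x _ hx =>
    intro l
    obtain ⟨a, ha⟩ := hx l
    refine ⟨z * a, ?_⟩
    rw [← Int.cast_smul_eq_zsmul ℝ, PiLp.smul_apply, smul_eq_mul, mul_left_comm, ha]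
    push_cast; ring

theorem Integral.inner {L : ℝ} {x y : EuclideanSpace ℝ (Fin k)} (hx : Integral L x)
    (hy : Integral L y) : ∃ a : ℤ, L ^ 2 * inner ℝ x y = a := by
  choose f hf using hx
  choose g hg using hy
  refine ⟨∑ l, f l * g l, ?_⟩
  rw [PiLp.inner_apply, Finset.mul_sum]
  push_cast
  refine Finset.sum_congr rfl fun l _ => ?_
  rw [← hf, ← hg]
  simp only [RCLike.inner_apply, conj_trivial]
  ring

/-- The Gram matrix is `U D Uᵀ` with `U` unitriangular and `D` diagonal. -/
theorem det_gram (f : Fin n → EuclideanSpace ℝ (Fin k)) :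
    (Matrix.of fun l m => inner ℝ (f l) (f m)).det = ∏ l, ‖gso f l‖ ^ 2 := by
  let U : Matrix (Fin n) (Fin n) ℝ := Matrix.of fun l m =>
    if m < l then projCoeff (f l) (gso f m) else if m = l then 1 else 0
  have hU : U.det = 1 := by
    have : U.IsLowerTriangular := by
      intro l m hlm
      have h : l < m := hlm
      simp only [U, Matrix.of_apply, if_neg h.not_gt, if_neg h.ne']
    rw [Matrix.det_of_isLowerTriangular U this]
    exact Finset.prod_eq_one fun l _ => by simp [U]
  have hf : ∀ l, f l = ∑ m, U l m • gso f m := by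
    intro l
    conv_lhs => rw [eq_gso_add_sum f l]
    rw [← Finset.add_sum_erase _ _ (Finset.mem_univ l)]
    congr 1
    · simp [U]
    · refine Eq.trans ?_ (Finset.sum_subset (s₁ := Finset.Iio l) ?_ ?_)
      · refine Finset.sum_congr rfl fun m hm => ?_
        simp only [U, Matrix.of_apply, if_pos (Finset.mem_Iio.1 hm)]
      · intro m hm
        exact Finset.mem_erase.2 ⟨(Finset.mem_Iio.1 hm).ne, Finset.mem_univ _⟩
      · intro m hm hm'
        simp only [U, Matrix.of_apply, if_neg (fun h => hm' (Finset.mem_Iio.2 h)),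
          if_neg (Finset.mem_erase.1 hm).1, zero_smul]
  have hG : (Matrix.of fun l m => inner ℝ (f l) (f m)) =
      U * Matrix.diagonal (fun l => ‖gso f l‖ ^ 2) * Uᵀ := by
    ext l m
    rw [Matrix.of_apply, Matrix.mul_apply]
    conv_lhs => rw [hf l, hf m]
    rw [sum_inner]
    refine Finset.sum_congr rfl fun x _ => ?_
    rw [inner_sum, Finset.sum_eq_single x]
    · rw [inner_smul_left, inner_smul_right, real_inner_self_eq_norm_sq, Matrix.mul_diagonal,
        Matrix.transpose_apply]
      simp only [conj_trivial]; ring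
    · intro y _ hy
      rw [inner_smul_left, inner_smul_right, inner_gso_of_ne f hy.symm]; simp
    · simp
  rw [hG, Matrix.det_mul, Matrix.det_mul, Matrix.det_transpose, hU, Matrix.det_diagonal]
  ring

theorem filter_val_lt_succ (j : Fin k) : Finset.univ.filter (fun l : Fin k => l.val < j.val + 1) =
    insert j (Finset.univ.filter (fun l : Fin k => l.val < j.val)) := by
  ext l
  simp only [Finset.mem_filter, Finset.mem_univ, true_and, Finset.mem_insert, Fin.ext_iff]
  omega

/-- `v` minus its projections onto the first `j` vectors of `gso b`. -/
noncomputable def residual (b : Fin n → EuclideanSpace ℝ (Fin k)) (v : EuclideanSpace ℝ (Fin k))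
    (j : ℕ) : EuclideanSpace ℝ (Fin k) :=
  v - ∑ l with l.val < j, projCoeff v (gso b l) • gso b l

theorem residual_zero (b : Fin n → EuclideanSpace ℝ (Fin k)) (v : EuclideanSpace ℝ (Fin k)) :
    residual b v 0 = v := by simp [residual]

theorem residual_succ (b : Fin n → EuclideanSpace ℝ (Fin k)) (v : EuclideanSpace ℝ (Fin k))
    (j : Fin n) :
    residual b v (j + 1) = residual b v j - projCoeff v (gso b j) • gso b j := by
  rw [residual, residual, filter_val_lt_succ, Finset.sum_insert (by simp)]
  abel

theorem residual_self (b : Fin n → EuclideanSpace ℝ (Fin k)) (i : Fin n) :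
    residual b (b i) i = gso b i := by
  have : Finset.univ.filter (fun l : Fin n => l.val < i.val) = Finset.Iio i := by
    ext l; simp only [Finset.mem_filter, Finset.mem_univ, true_and, Finset.mem_Iio, Fin.lt_def]
  rw [residual, this, sub_eq_iff_eq_add]
  exact eq_gso_add_sum b i

theorem inner_residual_gso (b : Fin n → EuclideanSpace ℝ (Fin k)) (v : EuclideanSpace ℝ (Fin k))
    {j : ℕ} {l : Fin n} (hl : l.val < j) : inner ℝ (gso b l) (residual b v j) = 0 := by
  rw [residual, inner_sub_right, inner_sum, Finset.sum_eq_single l]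
  · rw [inner_smul_right, projCoeff, real_inner_comm]
    by_cases h : gso b l = 0
    · simp [h]
    · rw [div_mul_cancel₀ _ (inner_self_ne_zero.2 h), sub_self]
  · intro m _ hm
    rw [inner_smul_right, inner_gso_of_ne b hm.symm, mul_zero]
  · intro h; simp at h; omega

theorem norm_residual_le (b : Fin n → EuclideanSpace ℝ (Fin k)) (v : EuclideanSpace ℝ (Fin k))
    (j : ℕ) : ‖residual b v j‖ ≤ ‖v‖ := by
  have h : inner ℝ (v - residual b v j) (residual b v j) = 0 := by
    conv_lhs => rw [residual, sub_sub_cancel]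
    rw [sum_inner]
    refine Finset.sum_eq_zero fun l hl => ?_
    rw [inner_smul_left, ← residual, inner_residual_gso b v (by simpa using hl), mul_zero]
  rw [inner_sub_left, sub_eq_zero, real_inner_self_eq_norm_sq] at h
  have h2 := real_inner_le_norm v (residual b v j)
  rw [h, sq] at h2
  by_cases h0 : ‖residual b v j‖ = 0
  · rw [h0]; exact norm_nonneg _
  · exact le_of_mul_le_mul_right h2 (lt_of_le_of_ne (norm_nonneg _) (Ne.symm h0))

theorem gso_comp_castLE (b : Fin n → EuclideanSpace ℝ (Fin k)) {j : ℕ} (h : j ≤ n) (l : Fin j) :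
    gso (b ∘ Fin.castLE h) l = gso b (Fin.castLE h l) := by
  have hW : prefixSpan (b ∘ Fin.castLE h) l = prefixSpan b (Fin.castLE h l) := by
    rw [prefixSpan, prefixSpan, Set.image_comp]
    congr 2
    ext m
    simp only [Set.mem_image, Set.mem_Iio]
    constructor
    · rintro ⟨x, hx, rfl⟩; exact hx
    · intro hm
      have : m.val < l.val := hm
      exact ⟨⟨m, by omega⟩, this, rfl⟩
  refine (eq_gso ?_ fun m hm => ?_).symm
  · rw [hW]; exact sub_gso_mem b _
  · exact inner_gso_eq_zero b _ (mem_prefixSpan b hm)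

theorem filter_val_lt {j : ℕ} (h : j ≤ n) : Finset.univ.filter (fun l : Fin n => l.val < j) =
    Finset.univ.map (Fin.castLEEmb h) := by
  ext l
  simp only [Finset.mem_filter, Finset.mem_univ, true_and, Finset.mem_map]
  constructor
  · intro hl; exact ⟨⟨l, hl⟩, rfl⟩
  · rintro ⟨x, rfl⟩; exact x.isLt

/-- The Gram determinant of the first `j` vectors of `L • b`, written as the product of the squared
lengths of their orthogonalization; see `gdet_eq_det`. -/
noncomputable def gdet (L : ℕ) (b : Fin n → EuclideanSpace ℝ (Fin k)) (j : ℕ) : ℝ :=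
  ∏ l : Fin n with l.val < j, (L : ℝ) ^ 2 * ‖gso b l‖ ^ 2

theorem gdet_eq_det (L : ℕ) (b : Fin n → EuclideanSpace ℝ (Fin k)) {j : ℕ} (h : j ≤ n) :
    gdet L b j = ((L : ℝ) ^ 2 • Matrix.of fun l m : Fin j =>
      inner ℝ ((b ∘ Fin.castLE h) l) ((b ∘ Fin.castLE h) m)).det := by
  rw [Matrix.det_smul, det_gram, gdet, filter_val_lt h, Finset.prod_map, Finset.prod_mul_distrib]
  simp [gso_comp_castLE]

/-- By Cramer's rule the coefficients of a projection have the Gram determinant as a common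
denominator. -/
theorem exists_gdet_eq {L : ℕ} {b : Fin n → EuclideanSpace ℝ (Fin k)}
    (hb : ∀ i, Integral L (b i)) {j : ℕ} (h : j ≤ n) : ∃ d : ℤ, gdet L b j = d ∧
      ∀ v, Integral L v → Integral (L * gdet L b j) (residual b v j) := by
  set f := b ∘ Fin.castLE h with hf
  have hG : ∀ l m, ∃ a : ℤ, (L : ℝ) ^ 2 * inner ℝ (f l) (f m) = a :=
    fun l m => (hb _).inner (hb _)
  choose Z hZ using hG
  have hZG : (L : ℝ) ^ 2 • (Matrix.of fun l m : Fin j => inner ℝ (f l) (f m)) =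
      (Matrix.of Z).map (Int.castRingHom ℝ) := by
    ext l m
    simp [hZ]
  have hdet : gdet L b j = ((Matrix.of Z).det : ℤ) := by
    rw [gdet_eq_det L b h, hZG, ← RingHom.mapMatrix_apply, ← RingHom.map_det]
    rfl
  refine ⟨_, hdet, fun v hv => ?_⟩
  -- the projection of `v` is an integer combination of the vectors `f l` with denominator `gdet`
  have hspan : v - residual b v j ∈ span ℝ (Set.range f) := by
    rw [residual, sub_sub_cancel]
    refine sum_mem fun l hl => smul_mem _ _ ?_
    have hl' : l.val < j := by simpa using hl
    have h1 : gso b l = gso f ⟨l, hl'⟩ := (gso_comp_castLE b h ⟨l, hl'⟩).symm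
    rw [h1, ← InnerProductSpace.span_gramSchmidt ℝ f]
    exact subset_span ⟨_, rfl⟩
  obtain ⟨x, hx⟩ := (mem_span_range_iff_exists_fun ℝ).1 hspan
  have horth : ∀ l, inner ℝ (f l) (residual b v j) = 0 := by
    intro l
    rw [eq_gso_add_sum f l, inner_add_left, sum_inner, hf, gso_comp_castLE,
      inner_residual_gso b v l.isLt, zero_add]
    refine Finset.sum_eq_zero fun m _ => ?_
    rw [inner_smul_left, gso_comp_castLE, inner_residual_gso b v m.isLt, mul_zero]
  have hy : ∀ l, ∃ a : ℤ, (L : ℝ) ^ 2 * inner ℝ (f l) v = a := fun l => (hb _).inner hv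
  choose y hy using hy
  have hsys : (Matrix.of Z).map (Int.castRingHom ℝ) *ᵥ x = fun l => (y l : ℝ) := by
    ext l
    rw [← hZG, ← hy, ← sub_add_cancel v (residual b v j), inner_add_right, horth, add_zero, ← hx,
      inner_sum, Finset.mul_sum, Matrix.mulVec, dotProduct]
    refine Finset.sum_congr rfl fun m _ => ?_
    rw [inner_smul_right]
    simp only [Matrix.smul_apply, Matrix.of_apply, smul_eq_mul]
    ring
  have hcr : ∀ l, gdet L b j * x l = (((Matrix.of Z).adjugate *ᵥ y) l : ℤ) := by
    intro l
    have h1 : (((Matrix.of Z).map (Int.castRingHom ℝ)).adjugate *ᵥ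
        ((Matrix.of Z).map (Int.castRingHom ℝ) *ᵥ x)) l = gdet L b j * x l := by
      rw [Matrix.mulVec_mulVec, Matrix.adjugate_mul, Matrix.smul_mulVec, Matrix.one_mulVec,
        Pi.smul_apply, smul_eq_mul, gdet_eq_det L b h, hZG]
    rw [← h1, hsys, ← RingHom.mapMatrix_apply, ← RingHom.map_adjugate]
    simp [Matrix.mulVec, dotProduct]
  intro c
  choose g hg using fun l => hb (Fin.castLE h l) c
  obtain ⟨a, ha⟩ := hv c
  refine ⟨(Matrix.of Z).det * a - ∑ l, ((Matrix.of Z).adjugate *ᵥ y) l * g l, ?_⟩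
  have h1 : residual b v j = v - ∑ l, x l • f l := by rw [hx, sub_sub_cancel]
  rw [h1, PiLp.sub_apply, mul_sub, Int.cast_sub, Int.cast_mul, Int.cast_sum]
  congr 1
  · rw [mul_right_comm, ha, hdet]; ring
  · rw [WithLp.ofLp_sum, Finset.sum_apply, Finset.mul_sum]
    refine Finset.sum_congr rfl fun l _ => ?_
    rw [Int.cast_mul, ← hcr, ← hg, PiLp.smul_apply, smul_eq_mul, hf, Function.comp_apply]
    ring

end Integrality

section Invariants

open Submodule

variable {n k : ℕ}

/-! ### Bounds that every basis met by the algorithm obeys -/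

/-- The vectors have the common denominator `L`, and their lengths and those of their
orthogonalization are bounded in terms of `A`. -/
structure Bounded (L A : ℕ) (b : Fin n → EuclideanSpace ℝ (Fin k)) : Prop where
  integral : ∀ i, Integral L (b i)
  indep : LinearIndependent ℝ b
  gso_le : ∀ i, ‖gso b i‖ ^ 2 ≤ A
  norm_le : ∀ i, ‖b i‖ ^ 2 ≤ n * A

theorem gdet_pos {L : ℕ} (hL : 0 < L) {b : Fin n → EuclideanSpace ℝ (Fin k)}
    (hb : LinearIndependent ℝ b) (j : ℕ) : 0 < gdet L b j := by
  refine Finset.prod_pos fun l _ => ?_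
  have := norm_pos_iff.2 (gso_ne_zero hb l)
  positivity

theorem gdet_succ (L : ℕ) (b : Fin n → EuclideanSpace ℝ (Fin k)) (j : Fin n) :
    gdet L b (j + 1) = (L : ℝ) ^ 2 * ‖gso b j‖ ^ 2 * gdet L b j := by
  rw [gdet, gdet, filter_val_lt_succ, Finset.prod_insert (by simp)]

theorem one_le_gdet {L : ℕ} (hL : 0 < L) {b : Fin n → EuclideanSpace ℝ (Fin k)}
    (hb : LinearIndependent ℝ b) (hi : ∀ i, Integral L (b i)) {j : ℕ} (hj : j ≤ n) :
    1 ≤ gdet L b j := by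
  obtain ⟨d, hd, -⟩ := exists_gdet_eq hi hj
  have := gdet_pos hL hb j
  rw [hd] at this ⊢
  exact_mod_cast Int.cast_pos.1 this

theorem Bounded.gdet_le {L A : ℕ} (hL : 0 < L) (hA : 0 < A)
    {b : Fin n → EuclideanSpace ℝ (Fin k)} (hb : Bounded L A b) (j : ℕ) :
    gdet L b j ≤ ((L ^ 2 * A : ℕ) : ℝ) ^ n := by
  have hQ : (1 : ℝ) ≤ ((L ^ 2 * A : ℕ) : ℝ) := by
    exact_mod_cast Nat.one_le_iff_ne_zero.2 (by positivity)
  calc gdet L b j ≤ ∏ l : Fin n with l.val < j, ((L ^ 2 * A : ℕ) : ℝ) := by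
        refine Finset.prod_le_prod (fun l _ => by positivity) fun l _ => ?_
        push_cast
        exact mul_le_mul_of_nonneg_left (hb.gso_le l) (by positivity)
    _ = ((L ^ 2 * A : ℕ) : ℝ) ^ (Finset.univ.filter (fun l : Fin n => l.val < j)).card := by
        rw [Finset.prod_const]
    _ ≤ _ := by
        refine pow_le_pow_right₀ hQ ?_
        simpa using Finset.card_le_univ (Finset.univ.filter (fun l : Fin n => l.val < j))

theorem Bounded.le_norm_gso {L A : ℕ} (hL : 0 < L) (hA : 0 < A)
    {b : Fin n → EuclideanSpace ℝ (Fin k)} (hb : Bounded L A b) (i : Fin n) :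
    1 ≤ ‖gso b i‖ ^ 2 * ((L ^ 2 * A : ℕ) : ℝ) ^ (n + 1) := by
  have h1 := one_le_gdet hL hb.indep hb.integral (j := i + 1) (by omega)
  rw [gdet_succ] at h1
  have h2 := hb.gdet_le hL hA i
  have h3 : (L : ℝ) ^ 2 ≤ ((L ^ 2 * A : ℕ) : ℝ) := by
    exact_mod_cast Nat.le_mul_of_pos_right _ hA
  calc (1 : ℝ) ≤ _ := h1
    _ = ‖gso b i‖ ^ 2 * ((L : ℝ) ^ 2 * gdet L b i) := by ring
    _ ≤ ‖gso b i‖ ^ 2 * (((L ^ 2 * A : ℕ) : ℝ) * ((L ^ 2 * A : ℕ) : ℝ) ^ n) := by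
        refine mul_le_mul_of_nonneg_left ?_ (by positivity)
        exact mul_le_mul h3 h2 (gdet_pos hL hb.indep _).le (by positivity)
    _ = _ := by rw [pow_succ' _ n]

/-! ### The potential -/

/-- The product of the Gram determinants of all initial segments of `L • b`. -/
noncomputable def potential (L : ℕ) (b : Fin n → EuclideanSpace ℝ (Fin k)) : ℝ :=
  ∏ j ∈ Finset.range (n + 1), gdet L b j

theorem one_le_potential {L : ℕ} (hL : 0 < L) {b : Fin n → EuclideanSpace ℝ (Fin k)}
    (hb : LinearIndependent ℝ b) (hi : ∀ i, Integral L (b i)) : 1 ≤ potential L b := by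
  rw [← Finset.prod_const_one (s := Finset.range (n + 1))]
  refine Finset.prod_le_prod (fun _ _ => zero_le_one) fun j hj => one_le_gdet hL hb hi ?_
  rw [Finset.mem_range] at hj; omega

theorem Bounded.potential_le {L A : ℕ} (hL : 0 < L) (hA : 0 < A)
    {b : Fin n → EuclideanSpace ℝ (Fin k)} (hb : Bounded L A b) :
    potential L b ≤ ((L ^ 2 * A : ℕ) : ℝ) ^ (n * (n + 1)) := by
  calc potential L b ≤ ∏ j ∈ Finset.range (n + 1), ((L ^ 2 * A : ℕ) : ℝ) ^ n :=
        Finset.prod_le_prod (fun j _ => (gdet_pos hL hb.indep j).le) fun j _ => hb.gdet_le hL hA j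
    _ = _ := by rw [Finset.prod_const, Finset.card_range, ← pow_mul]

theorem potential_congr {L : ℕ} {b c : Fin n → EuclideanSpace ℝ (Fin k)} (h : gso c = gso b) :
    potential L c = potential L b := by
  simp only [potential, gdet, h]

/-- Only the Gram determinant of the vectors before the `i`-th one changes in a swap. -/
theorem gdet_comp_swap (L : ℕ) (b : Fin n → EuclideanSpace ℝ (Fin k)) {p i : Fin n}
    (hpi : (p : ℕ) + 1 = i) (hne : gso (b ∘ Equiv.swap p i) p ≠ 0) {j : ℕ} (hj : j ≠ i) :
    gdet L (b ∘ Equiv.swap p i) j = gdet L b j := by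
  have hip : i ≠ p := by rw [ne_eq, Fin.ext_iff]; omega
  rw [gdet, gdet]
  by_cases h : i.val < j
  · have hi : i ∈ Finset.univ.filter (fun l : Fin n => l.val < j) := by simpa using h
    have hp : p ∈ (Finset.univ.filter (fun l : Fin n => l.val < j)).erase i := by
      refine Finset.mem_erase.2 ⟨hip.symm, ?_⟩
      simp; omega
    have key : ∀ F : Fin n → ℝ, ∏ l : Fin n with l.val < j, F l = F i * F p *
        ∏ l ∈ ((Finset.univ.filter (fun l : Fin n => l.val < j)).erase i).erase p, F l := by
      intro F
      rw [mul_assoc, Finset.mul_prod_erase _ _ hp, Finset.mul_prod_erase _ _ hi]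
    rw [key, key]
    congr 1
    · have := (norm_sq_gso_comp_swap_right b hpi hne).1
      linear_combination (L : ℝ) ^ 4 * this
    · refine Finset.prod_congr rfl fun l hl => ?_
      rw [gso_comp_swap_of_ne b hpi (Finset.mem_erase.1 hl).1
        (Finset.mem_erase.1 (Finset.mem_erase.1 hl).2).1]
  · refine Finset.prod_congr rfl fun l hl => ?_
    have hl' : l.val < j := by simpa using hl
    rw [gso_comp_swap_of_ne b hpi] <;> rw [ne_eq, Fin.ext_iff] <;> omega

theorem potential_comp_swap_le {L : ℕ} (hL : 0 < L) {b : Fin n → EuclideanSpace ℝ (Fin k)}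
    (hb : LinearIndependent ℝ b) {p i : Fin n} (hpi : (p : ℕ) + 1 = i) {δ : ℝ}
    (h : ‖gso b i‖ ^ 2 < (δ - projCoeff (b i) (gso b p) ^ 2) * ‖gso b p‖ ^ 2) :
    potential L (b ∘ Equiv.swap p i) ≤ δ * potential L b := by
  have hc : LinearIndependent ℝ (b ∘ Equiv.swap p i) :=
    hb.comp _ (Equiv.swap p i).injective
  have hi : (i : ℕ) ∈ Finset.range (n + 1) := Finset.mem_range.2 (by omega)
  rw [potential, potential, ← Finset.mul_prod_erase _ _ hi, ← Finset.mul_prod_erase _ _ hi,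
    ← mul_assoc]
  have h1 : ∏ j ∈ (Finset.range (n + 1)).erase i, gdet L (b ∘ Equiv.swap p i) j =
      ∏ j ∈ (Finset.range (n + 1)).erase i, gdet L b j :=
    Finset.prod_congr rfl fun j hj =>
      gdet_comp_swap L b hpi (gso_ne_zero hc p) (Finset.mem_erase.1 hj).1
  rw [h1]
  refine mul_le_mul_of_nonneg_right ?_ (Finset.prod_nonneg fun j _ => (gdet_pos hL hb j).le)
  rw [← hpi, gdet_succ, gdet_succ, gdet_comp_swap L b hpi (gso_ne_zero hc p) (by omega),
    norm_sq_gso_comp_swap_left b hpi, ← mul_assoc]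
  refine mul_le_mul_of_nonneg_right ?_ (gdet_pos hL hb _).le
  rw [mul_left_comm]
  exact mul_le_mul_of_nonneg_left (by linarith) (by positivity)

/-! ### One iteration -/

theorem Bounded.shear {L A : ℕ} {b c : Fin n → EuclideanSpace ℝ (Fin k)} (hb : Bounded L A b)
    {i : Fin n} (h : Shear b c i) (hμ : ∀ j < i, |projCoeff (c i) (gso b j)| ≤ 1 / 2) :
    Bounded L A c := by
  refine ⟨fun l => ?_, linearIndependent_of_lattice_eq h.lattice_eq hb.indep,
    fun l => h.gso_eq ▸ hb.gso_le l, fun l => ?_⟩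
  · refine Integral.of_mem_span (S := Set.range b) ?_ (h.lattice_eq.le (subset_span ⟨l, rfl⟩))
    rintro _ ⟨i, rfl⟩
    exact hb.integral i
  · by_cases hl : l = i
    · subst hl
      rw [norm_sq_eq_sum, h.gso_eq]
      have h1 : ∑ j ∈ Finset.Iio l, projCoeff (c l) (gso b j) ^ 2 * ‖gso b j‖ ^ 2 ≤
          ∑ j ∈ Finset.Iio l, (A : ℝ) := by
        refine Finset.sum_le_sum fun j hj => ?_
        have h2 : projCoeff (c l) (gso b j) ^ 2 ≤ 1 := by
          rw [sq_le_one_iff_abs_le_one]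
          linarith [hμ j (Finset.mem_Iio.1 hj)]
        calc _ ≤ 1 * ‖gso b j‖ ^ 2 := mul_le_mul_of_nonneg_right h2 (by positivity)
          _ ≤ A := by rw [one_mul]; exact hb.gso_le j
      rw [Finset.sum_const, Fin.card_Iio, nsmul_eq_mul] at h1
      have h3 : ((l.val : ℝ) + 1) ≤ n := by exact_mod_cast l.isLt
      have h4 : ((l.val : ℝ) + 1) * A ≤ n * A := mul_le_mul_of_nonneg_right h3 (by positivity)
      linarith [hb.gso_le l]
    · rw [h.of_ne l hl]; exact hb.norm_le l

theorem Bounded.comp_swap {L A : ℕ} {b : Fin n → EuclideanSpace ℝ (Fin k)} (hb : Bounded L A b)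
    {p i : Fin n} (hpi : (p : ℕ) + 1 = i) {δ : ℝ} (hδ : δ < 1)
    (h : ‖gso b i‖ ^ 2 < (δ - projCoeff (b i) (gso b p) ^ 2) * ‖gso b p‖ ^ 2) :
    Bounded L A (b ∘ Equiv.swap p i) := by
  have hc : LinearIndependent ℝ (b ∘ Equiv.swap p i) :=
    hb.indep.comp _ (Equiv.swap p i).injective
  refine ⟨fun l => hb.integral _, hc, fun l => ?_, fun l => hb.norm_le _⟩
  by_cases hp : l = p
  · subst hp
    rw [norm_sq_gso_comp_swap_left b hpi]
    have h1 : δ * ‖gso b l‖ ^ 2 ≤ 1 * ‖gso b l‖ ^ 2 :=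
      mul_le_mul_of_nonneg_right hδ.le (by positivity)
    linarith [hb.gso_le l]
  · by_cases hi : l = i
    · subst hi
      exact (pow_le_pow_left₀ (norm_nonneg _)
        (norm_sq_gso_comp_swap_right b hpi (gso_ne_zero hc p)).2 2).trans (hb.gso_le p)
    · rw [gso_comp_swap_of_ne b hpi hp hi]; exact hb.gso_le l

/-- The vectors with index smaller than `m` satisfy the conditions of a reduced basis. -/
structure ReducedBelow (δ : ℝ) (m : ℕ) (b : Fin n → EuclideanSpace ℝ (Fin k)) : Prop where
  projection : ∀ i j : Fin n, i.val < m → j < i → |projCoeff (b i) (gso b j)| ≤ 1 / 2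
  ordering : ∀ i j : Fin n, j.val < m → (j : ℕ) = i + 1 →
    (δ - projCoeff (b j) (gso b i) ^ 2) * ‖gso b i‖ ^ 2 ≤ ‖gso b j‖ ^ 2

theorem ReducedBelow.isReduced {δ : ℝ} {m : ℕ} {b : Fin n → EuclideanSpace ℝ (Fin k)}
    (h : ReducedBelow δ m b) (hm : n ≤ m) : IsReduced δ b :=
  ⟨fun i j hj => h.projection i j (by omega) hj, fun i j hj => h.ordering i j (by omega) hj⟩

theorem reducedBelow_one (δ : ℝ) (b : Fin n → EuclideanSpace ℝ (Fin k)) : ReducedBelow δ 1 b :=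
  ⟨fun i j h1 h2 => by rw [Fin.lt_def] at h2; omega, fun i j h1 h2 => by omega⟩

/-- The invariant of the loop. -/
structure Invariant (δ : ℝ) (L A : ℕ) (s : State n (EuclideanSpace ℝ (Fin k))) : Prop where
  idx_pos : 1 ≤ s.idx
  bounded : Bounded L A s.basis
  reduced : ReducedBelow δ s.idx s.basis

/-- An iteration preserves the invariant and the lattice; it increases the index or shrinks the
potential. -/
theorem iteration_spec {δ : ℝ} (hδ : δ < 1) {L A : ℕ} (hL : 0 < L)
    {s : State n (EuclideanSpace ℝ (Fin k))} (hs : Invariant δ L A s) (h : s.idx < n) :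
    Invariant δ L A (iteration δ s h) ∧ lattice (iteration δ s h).basis = lattice s.basis ∧
      (((iteration δ s h).idx = s.idx + 1 ∧
          potential L (iteration δ s h).basis = potential L s.basis) ∨
        (s.idx ≤ (iteration δ s h).idx + 1 ∧
          potential L (iteration δ s h).basis ≤ δ * potential L s.basis)) := by
  obtain ⟨m, b⟩ := s
  obtain ⟨h1, hb, hr⟩ := hs
  simp only at h h1 hb hr
  obtain ⟨hsh, hμ⟩ := reduceStep_spec hb.indep ⟨m, h⟩
  have hbc := hb.shear hsh hμ
  have hpm : m - 1 + 1 = m := by omega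
  simp only [iteration]
  generalize reduceStep (gso b) ⟨m, h⟩ b = c at *
  have hg := hsh.gso_eq
  rw [← hg] at hμ
  rw [← hg]
  have hcl : ∀ l : Fin n, l.val < m → c l = b l := fun l hl =>
    hsh.of_ne l (by rw [ne_eq, Fin.ext_iff]; exact hl.ne)
  split
  · next ho =>
    refine ⟨⟨Nat.le_succ_of_le h1, hbc, fun i j hi hj => ?_, fun i j hj hij => ?_⟩,
      hsh.lattice_eq, Or.inl ⟨rfl, potential_congr hg⟩⟩
    · change |projCoeff (c i) (gso c j)| ≤ 1 / 2
      rcases Nat.lt_succ_iff_lt_or_eq.1 hi with hi | hi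
      · rw [hcl i hi, hg]; exact hr.projection i j hi hj
      · obtain rfl : i = ⟨m, h⟩ := Fin.ext hi
        exact hμ j hj
    · change (δ - projCoeff (c j) (gso c i) ^ 2) * ‖gso c i‖ ^ 2 ≤ ‖gso c j‖ ^ 2
      rcases Nat.lt_succ_iff_lt_or_eq.1 hj with hj | hj
      · rw [hcl j hj, hg]; exact hr.ordering i j hj hij
      · obtain rfl : j = ⟨m, h⟩ := Fin.ext hj
        obtain rfl : i = ⟨m - 1, (Nat.sub_le _ _).trans_lt h⟩ :=
          Fin.ext (by simp only at hij ⊢; omega)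
        exact ho
  · next ho =>
    have ho' := not_le.1 ho
    have hpot := potential_comp_swap_le hL hbc.indep (p := ⟨m - 1, (Nat.sub_le _ _).trans_lt h⟩)
      (i := ⟨m, h⟩) hpm ho'
    have hbs := hbc.comp_swap (p := ⟨m - 1, (Nat.sub_le _ _).trans_lt h⟩)
      (i := ⟨m, h⟩) hpm hδ ho'
    rw [potential_congr hg] at hpot
    refine ⟨⟨le_max_left _ _, hbs, fun i j hi hj => ?_, fun i j hj hij => ?_⟩,
      (lattice_comp_swap _ _ _).trans hsh.lattice_eq, Or.inr ⟨by simp only; omega, hpot⟩⟩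
    · rw [Fin.lt_def] at hj
      simp only at hi
      change |projCoeff ((c ∘ Equiv.swap _ _) i) (gso (c ∘ Equiv.swap _ _) j)| ≤ 1 / 2
      have hi1 : i.val < m - 1 := by omega
      rw [gso_comp_swap_of_ne c hpm (by rw [ne_eq, Fin.ext_iff]; simp only; omega)
        (by rw [ne_eq, Fin.ext_iff]; simp only; omega), Function.comp_apply,
        Equiv.swap_apply_of_ne_of_ne (by rw [ne_eq, Fin.ext_iff]; simp only; omega)
        (by rw [ne_eq, Fin.ext_iff]; simp only; omega), hcl i (by omega), hg]
      exact hr.projection i j (by omega) hj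
    · simp only at hj
      change (δ - projCoeff ((c ∘ Equiv.swap _ _) j) (gso (c ∘ Equiv.swap _ _) i) ^ 2) *
        ‖gso (c ∘ Equiv.swap _ _) i‖ ^ 2 ≤ ‖gso (c ∘ Equiv.swap _ _) j‖ ^ 2
      have hj1 : j.val < m - 1 := by omega
      rw [gso_comp_swap_of_ne c hpm (l := i) (by rw [ne_eq, Fin.ext_iff]; simp only; omega)
        (by rw [ne_eq, Fin.ext_iff]; simp only; omega),
        gso_comp_swap_of_ne c hpm (l := j) (by rw [ne_eq, Fin.ext_iff]; simp only; omega)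
        (by rw [ne_eq, Fin.ext_iff]; simp only; omega), Function.comp_apply,
        Equiv.swap_apply_of_ne_of_ne (by rw [ne_eq, Fin.ext_iff]; simp only; omega)
        (by rw [ne_eq, Fin.ext_iff]; simp only; omega), hcl j (by omega), hg]
      exact hr.ordering i j (by omega) hij

end Invariants

/-! ### Specifications of timed computations -/

/-- The result of `c` satisfies `P`, and its cost is at most `t`. -/
def Spec {α : Type} (c : Timed α) (P : α → Prop) (t : ℕ) : Prop := P c.val ∧ c.cost ≤ t

theorem Spec.pure {α : Type} {P : α → Prop} {a : α} (h : P a) : Spec (pure a : Timed α) P 0 :=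
  ⟨h, le_rfl⟩

theorem Spec.bind {α β : Type} {c : Timed α} {f : α → Timed β} {P : α → Prop} {Q : β → Prop}
    {t u : ℕ} (h : Spec c P t) (h' : ∀ a, P a → Spec (f a) Q u) : Spec (c >>= f) Q (t + u) :=
  ⟨(h' _ h.1).1, Nat.add_le_add h.2 (h' _ h.1).2⟩

theorem Spec.tick (t : ℕ) : Spec (tick t) (fun _ => True) t := ⟨trivial, le_rfl⟩

theorem Spec.mono {α : Type} {c : Timed α} {P Q : α → Prop} {t u : ℕ} (h : Spec c P t)
    (hPQ : ∀ a, P a → Q a) (htu : t ≤ u) : Spec c Q u := ⟨hPQ _ h.1, h.2.trans htu⟩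

theorem Spec.foldlM {α β σ : Type} {R : ℕ → σ → β → Prop} {f : σ → α → Timed σ} {g : β → α → β}
    {t : ℕ} (l : List α) (h : ∀ (i : ℕ) (hi : i < l.length) (s : σ) (r : β), R i s r →
      Spec (f s l[i]) (fun s' => R (i + 1) s' (g r l[i])) t) {s : σ} {r : β} (hs : R 0 s r) :
    Spec (l.foldlM f s) (fun s' => R l.length s' (l.foldl g r)) (l.length * t) := by
  induction l generalizing R s r with
  | nil => simpa using Spec.pure (P := fun s' => R 0 s' r) hs
  | cons a l ih =>
    rw [List.foldlM_cons, List.length_cons, add_mul, one_mul, add_comm (l.length * t)]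
    refine Spec.bind (h 0 (by simp) s r hs) fun s' hs' => ?_
    exact ih (R := fun i => R (i + 1)) (fun i hi s r hr => h (i + 1) (by simpa using hi) s r hr) hs'

theorem forUpT_spec {σ : Type} {m : ℕ} (Q : ℕ → σ → Prop) {body : Fin m → σ → Timed σ} {t : ℕ}
    {s : σ} (hs : Q 0 s) (h : ∀ (j : Fin m) (s : σ), Q j s → Spec (body j s) (Q (j + 1)) t) :
    Spec (forUpT m s body) (Q m) (m * (m + t)) := by
  have := Spec.foldlM (R := fun i s (_ : Unit) => Q i s) (g := fun r _ => r) (r := ())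
    (f := fun s j => do LLL.tick (Nat.size m); body j s) (t := m + t) (List.finRange m)
    (fun i hi s _ hs => by
      have him : i < m := by simpa using hi
      have h1 := (Spec.tick (Nat.size m)).bind fun _ _ => h ⟨i, him⟩ s hs
      rw [List.getElem_finRange]
      exact h1.mono (fun _ h => h) (Nat.add_le_add_right (Nat.size_le.2 m.lt_two_pow_self) _)) hs
  rw [List.length_finRange] at this
  exact this

/-- The loop on bits proceeds in parallel with a fold. -/
theorem forDownT_spec {σ β : Type} {m : ℕ} (R : ℕ → σ → β → Prop) {body : Fin m → σ → Timed σ}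
    {g : β → Fin m → β} {t : ℕ} {s : σ} {r : β} (hs : R m s r)
    (h : ∀ (j : Fin m) (s : σ) (r : β), R (j + 1) s r →
      Spec (body j s) (fun s' => R j s' (g r j)) t) :
    Spec (forDownT m s body) (fun s' => R 0 s' ((List.finRange m).reverse.foldl g r))
      (m * (m + t)) := by
  have := Spec.foldlM (R := fun i s r => R (m - i) s r) (g := g) (r := r)
    (f := fun s j => do LLL.tick (Nat.size m); body j s) (t := m + t) (List.finRange m).reverse
    (fun i hi s r hs => by
      have him : i < m := by simpa using hi
      have hlt : m - 1 - i < m := by omega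
      have hs' : R ((⟨m - 1 - i, hlt⟩ : Fin m) + 1 : ℕ) s r := by
        rwa [show m - 1 - i + 1 = m - i by omega]
      have h1 := (Spec.tick (Nat.size m)).bind fun _ _ => h ⟨m - 1 - i, hlt⟩ s r hs'
      have h2 : (List.finRange m).reverse[i] = ⟨m - 1 - i, hlt⟩ := by
        simp [List.getElem_reverse]
      rw [h2, show m - (i + 1) = m - 1 - i by omega]
      exact h1.mono (fun _ h => h) (Nat.add_le_add_right (Nat.size_le.2 m.lt_two_pow_self) _))
    (s := s) (by simpa using hs)
  rw [List.length_reverse, List.length_finRange, Nat.sub_self] at this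
  exact this

/-! ### Fractions representing real numbers of bounded size -/

/-- The fraction `x`, in lowest terms, stands for the real number `r`. -/
def Rep (x : Frac) (r : ℝ) : Prop := ∃ q : ℚ, x = Frac.ofRat q ∧ (q : ℝ) = r

/-- `r` is a fraction whose numerator and denominator have at most `s` bits. -/
def Small (s : ℕ) (r : ℝ) : Prop :=
  ∃ (a : ℤ) (N : ℕ), 0 < N ∧ N < 2 ^ s ∧ a.natAbs < 2 ^ s ∧ r = a / N

theorem Rep.toRat {x : Frac} {r : ℝ} (h : Rep x r) : ((x.toRat : ℚ) : ℝ) = r := by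
  obtain ⟨q, rfl, rfl⟩ := h
  rw [toRat_ofRat]

theorem Rep.fits {x : Frac} {r : ℝ} {s : ℕ} (h : Rep x r) (hs : Small s r) : x.Fits s := by
  obtain ⟨q, rfl, rfl⟩ := h
  obtain ⟨a, N, hN, hNs, has, hq⟩ := hs
  have hq' : q = (a : ℚ) / (N : ℚ) := by exact_mod_cast hq
  rw [← Rat.mkRat_eq_div, ← Rat.normalize_eq_mkRat hN.ne', Rat.normalize_eq] at hq'
  constructor
  · rw [znum_natSize_le_iff, Frac.ofRat, toInt_ofInt', hq']
    exact (Int.natAbs_ediv_le_natAbs _ _).trans_lt has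
  · rw [natSize_le_iff, Frac.ofRat, toNat_ofNat q.den_pos, hq']
    exact (Nat.div_le_self _ _).trans_lt hNs

theorem Small.mono {s t : ℕ} {r : ℝ} (h : Small s r) (hst : s ≤ t) : Small t r := by
  obtain ⟨a, N, h1, h2, h3, h4⟩ := h
  have := Nat.pow_le_pow_right (n := 2) (by omega) hst
  exact ⟨a, N, h1, by omega, by omega, h4⟩

theorem Small.mul {s t : ℕ} {p q : ℝ} (hp : Small s p) (hq : Small t q) :
    Small (s + t) (p * q) := by
  obtain ⟨a, N, h1, h2, h3, rfl⟩ := hp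
  obtain ⟨c, M, h5, h6, h7, rfl⟩ := hq
  refine ⟨a * c, N * M, Nat.mul_pos h1 h5, ?_, ?_, ?_⟩
  · rw [pow_add]; exact Nat.mul_lt_mul'' h2 h6
  · rw [pow_add, Int.natAbs_mul]; exact Nat.mul_lt_mul'' h3 h7
  · push_cast; rw [div_mul_div_comm]

theorem Small.add {s t : ℕ} {p q : ℝ} (hp : Small s p) (hq : Small t q) :
    Small (s + t + 1) (p + q) := by
  obtain ⟨a, N, h1, h2, h3, rfl⟩ := hp
  obtain ⟨c, M, h5, h6, h7, rfl⟩ := hq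
  have h8 := Nat.mul_lt_mul'' h2 h6
  refine ⟨a * M + c * N, N * M, Nat.mul_pos h1 h5, ?_, ?_, ?_⟩
  · rw [pow_succ, pow_add]; omega
  · have h9 := Nat.mul_lt_mul'' h3 h6
    have h10 := Nat.mul_lt_mul'' h2 h7
    have h11 := Int.natAbs_add_le (a * M) (c * N)
    rw [Int.natAbs_mul, Int.natAbs_mul, Int.natAbs_natCast, Int.natAbs_natCast,
      mul_comm c.natAbs] at h11
    rw [pow_succ, pow_add]; omega
  · have : (N : ℝ) ≠ 0 := Nat.cast_ne_zero.2 h1.ne'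
    have : (M : ℝ) ≠ 0 := Nat.cast_ne_zero.2 h5.ne'
    push_cast; field_simp

theorem Small.inv {s : ℕ} {p : ℝ} (hp : Small s p) : Small s p⁻¹ := by
  obtain ⟨a, N, h1, h2, h3, rfl⟩ := hp
  rcases lt_trichotomy a 0 with h | rfl | h
  · refine ⟨-N, a.natAbs, by omega, h3, by simpa using h2, ?_⟩
    have h4 : ((a.natAbs : ℕ) : ℝ) = -a := by
      rw [← Int.cast_natCast, Int.ofNat_natAbs_of_nonpos h.le]; push_cast; rfl
    rw [h4]; push_cast; rw [inv_div, neg_div_neg_eq]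
  · exact ⟨0, N, h1, h2, h3, by simp⟩
  · refine ⟨N, a.natAbs, by omega, h3, by simpa using h2, ?_⟩
    have h4 : ((a.natAbs : ℕ) : ℝ) = a := by
      rw [← Int.cast_natCast, Int.natAbs_of_nonneg h.le]
    rw [h4]; push_cast; rw [inv_div]

theorem Small.div {s t : ℕ} {p q : ℝ} (hp : Small s p) (hq : Small t q) :
    Small (s + t) (p / q) := by
  rw [div_eq_mul_inv]; exact hp.mul hq.inv

theorem Small.nearest {s : ℕ} {p : ℝ} (hp : Small s p) : Small (s + 1) (nearest p : ℝ) := by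
  obtain ⟨a, N, h1, h2, h3, h4⟩ := hp
  have hs : 1 < 2 ^ (s + 1) := Nat.one_lt_two_pow (by omega)
  refine ⟨LLL.nearest p, 1, one_pos, hs, ?_, by simp⟩
  have h5 : |p| ≤ a.natAbs := by
    rw [h4, abs_div, Nat.abs_cast, Nat.cast_natAbs, Int.cast_abs]
    exact div_le_self (abs_nonneg _) (by exact_mod_cast h1)
  have h6 := abs_sub_nearest p
  have h7 : |(LLL.nearest p : ℝ)| ≤ a.natAbs + 1 := by
    have := abs_sub_abs_le_abs_sub (LLL.nearest p : ℝ) p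
    rw [abs_sub_comm] at this
    linarith
  have h8 : |LLL.nearest p| ≤ (a.natAbs : ℤ) + 1 := by
    rw [← Int.cast_le (R := ℝ), Int.cast_add, Int.cast_one, Int.cast_natCast, Int.cast_abs]
    exact h7
  rw [Int.abs_eq_natAbs] at h8
  rw [pow_succ]; omega

theorem fracAddT_spec {x y : Frac} {p q : ℝ} {s o : ℕ} (hx : Rep x p) (hy : Rep y q)
    (hp : Small s p) (hq : Small s q) (ho : opCost s ≤ o) :
    Spec (fracAddT x y) (Rep · (p + q)) o :=
  ⟨⟨_, fracAddT_val x y, by rw [Rat.cast_add, hx.toRat, hy.toRat]⟩,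
    (fracAddT_cost (hx.fits hp) (hy.fits hq)).trans ho⟩

theorem fracSubT_spec {x y : Frac} {p q : ℝ} {s o : ℕ} (hx : Rep x p) (hy : Rep y q)
    (hp : Small s p) (hq : Small s q) (ho : opCost s ≤ o) :
    Spec (fracSubT x y) (Rep · (p - q)) o :=
  ⟨⟨_, fracSubT_val x y, by rw [Rat.cast_sub, hx.toRat, hy.toRat]⟩,
    (fracSubT_cost (hx.fits hp) (hy.fits hq)).trans ho⟩

theorem fracMulT_spec {x y : Frac} {p q : ℝ} {s o : ℕ} (hx : Rep x p) (hy : Rep y q)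
    (hp : Small s p) (hq : Small s q) (ho : opCost s ≤ o) :
    Spec (fracMulT x y) (Rep · (p * q)) o :=
  ⟨⟨_, fracMulT_val x y, by rw [Rat.cast_mul, hx.toRat, hy.toRat]⟩,
    (fracMulT_cost (hx.fits hp) (hy.fits hq)).trans ho⟩

theorem fracDivT_spec {x y : Frac} {p q : ℝ} {s o : ℕ} (hx : Rep x p) (hy : Rep y q)
    (hp : Small s p) (hq : Small s q) (ho : opCost s ≤ o) :
    Spec (fracDivT x y) (Rep · (p / q)) o :=
  ⟨⟨_, fracDivT_val x y, by rw [Rat.cast_div, hx.toRat, hy.toRat]⟩,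
    (fracDivT_cost (hx.fits hp) (hy.fits hq)).trans ho⟩

theorem nearestT_spec {x : Frac} {p : ℝ} {s o : ℕ} (hx : Rep x p) (hp : Small s p)
    (ho : opCost s ≤ o) :
    Spec (nearestT x) (fun r => Rep ⟨r, .one⟩ (nearest p : ℝ)) o :=
  ⟨⟨_, int_eq_ofRat _, by rw [nearestT_val, hx.toRat]; simp⟩, (nearestT_cost (hx.fits hp)).trans ho⟩

/-! ### Vectors of fractions -/

section Vectors

variable {n k : ℕ}

/-- The vector `u` of fractions in lowest terms stands for the real vector `x`. -/
def VRep (u : Vec k) (x : EuclideanSpace ℝ (Fin k)) : Prop := ∀ l, Rep (u l) (x l)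

/-- The entries of `x` have a common denominator and numerators of at most `s` bits. -/
def VSmall (s : ℕ) (x : EuclideanSpace ℝ (Fin k)) : Prop :=
  ∃ N : ℕ, 0 < N ∧ N < 2 ^ s ∧ ∀ l, ∃ a : ℤ, a.natAbs < 2 ^ s ∧ x l = a / N

theorem VSmall.small {s : ℕ} {x : EuclideanSpace ℝ (Fin k)} (h : VSmall s x) (l : Fin k) :
    Small s (x l) := by
  obtain ⟨N, h1, h2, h3⟩ := h
  obtain ⟨a, h4, h5⟩ := h3 l
  exact ⟨a, N, h1, h2, h4, h5⟩

theorem Integral.vSmall {s N : ℕ} {x : EuclideanSpace ℝ (Fin k)} (h : Integral N x) (hN : 0 < N)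
    (hNs : N < 2 ^ s) (hx : N * ‖x‖ < 2 ^ s) : VSmall s x := by
  have hN' : (0 : ℝ) < N := Nat.cast_pos.2 hN
  refine ⟨N, hN, hNs, fun l => ?_⟩
  obtain ⟨a, ha⟩ := h l
  refine ⟨a, ?_, by rw [← ha, mul_div_cancel_left₀ _ hN'.ne']⟩
  have h1 : |(a : ℝ)| ≤ N * ‖x‖ := by
    rw [← ha, abs_mul, Nat.abs_cast]
    exact mul_le_mul_of_nonneg_left (PiLp.norm_apply_le x l) hN'.le
  rw [← Int.cast_abs, Int.abs_eq_natAbs] at h1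
  exact_mod_cast h1.trans_lt hx

/-- Thanks to common denominators, partial sums of an inner product need few more bits than the
two vectors. -/
theorem VSmall.small_sum {s : ℕ} {x y : EuclideanSpace ℝ (Fin k)} (hx : VSmall s x)
    (hy : VSmall s y) (S : Finset (Fin k)) : Small (2 * s + k) (∑ l ∈ S, x l * y l) := by
  obtain ⟨N, h1, h2, h3⟩ := hx
  obtain ⟨M, h4, h5, h6⟩ := hy
  choose a ha ha' using h3
  choose c hc hc' using h6
  have hk := k.lt_two_pow_self
  refine ⟨∑ l ∈ S, a l * c l, N * M, Nat.mul_pos h1 h4, ?_, ?_, ?_⟩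
  · have := Nat.mul_lt_mul'' h2 h5
    rw [pow_add, two_mul, pow_add]
    exact this.trans_le (Nat.le_mul_of_pos_right _ (by positivity))
  · have h7 : (∑ l ∈ S, a l * c l).natAbs ≤ ∑ l ∈ S, 2 ^ (2 * s) := by
      refine (Int.natAbs_sum_le _ _).trans (Finset.sum_le_sum fun l _ => ?_)
      rw [Int.natAbs_mul, two_mul, pow_add]
      exact (Nat.mul_lt_mul'' (ha l) (hc l)).le
    rw [Finset.sum_const, smul_eq_mul] at h7
    have h8 : S.card ≤ k := by simpa using Finset.card_le_univ S
    rw [pow_add]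
    calc _ ≤ _ := h7
      _ ≤ k * 2 ^ (2 * s) := Nat.mul_le_mul_right _ h8
      _ < 2 ^ k * 2 ^ (2 * s) := Nat.mul_lt_mul_of_pos_right hk (by positivity)
      _ = _ := mul_comm _ _
  · push_cast
    rw [Finset.sum_div]
    exact Finset.sum_congr rfl fun l _ => by rw [ha', hc', div_mul_div_comm]

theorem inner_eq_sum (x y : EuclideanSpace ℝ (Fin k)) : inner ℝ x y = ∑ l, x l * y l := by
  rw [PiLp.inner_apply]
  exact Finset.sum_congr rfl fun l _ => by simp [mul_comm]

theorem dotT_spec {u v : Vec k} {x y : EuclideanSpace ℝ (Fin k)} {s o : ℕ} (hu : VRep u x)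
    (hv : VRep v y) (hx : VSmall s x) (hy : VSmall s y) (ho : opCost (2 * s + k) ≤ o) :
    Spec (dotT u v) (Rep · (inner ℝ x y)) (2 * (k + 1) * (k + 1 + o)) := by
  have h := forUpT_spec (m := k) (s := Frac.zero)
    (fun j acc => Rep acc (∑ l : Fin k with l.val < j, x l * y l))
    (body := fun l acc => do
      let p ← fracMulT (u l) (v l)
      fracAddT acc p) (t := o + o) ⟨0, zero_eq_ofRat, by simp⟩ ?_
  · refine h.mono (fun r hr => ?_) ?_
    · rw [inner_eq_sum]
      simpa using hr
    · nlinarith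
  · intro j acc hacc
    refine Spec.bind (fracMulT_spec (hu j) (hv j) (hx.small j) (hy.small j)
      ((opCost_mono (by omega)).trans ho)) fun p hp => ?_
    refine (fracAddT_spec hacc hp (hx.small_sum hy _)
      (((hx.small j).mul (hy.small j)).mono (by omega)) ho).mono (fun r hr => ?_) le_rfl
    rwa [filter_val_lt_succ, Finset.sum_insert (by simp), add_comm]

theorem small_inner {s : ℕ} {x y : EuclideanSpace ℝ (Fin k)} (hx : VSmall s x)
    (hy : VSmall s y) : Small (2 * s + k) (inner ℝ x y) := by
  rw [inner_eq_sum]; exact hx.small_sum hy _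

theorem small_projCoeff {s : ℕ} {x y : EuclideanSpace ℝ (Fin k)} (hx : VSmall s x)
    (hy : VSmall s y) : Small (2 * (2 * s + k)) (projCoeff x y) := by
  rw [two_mul]; exact (small_inner hx hy).div (small_inner hy hy)

theorem projCoeffT_spec {u v : Vec k} {x y : EuclideanSpace ℝ (Fin k)} {s o : ℕ} (hu : VRep u x)
    (hv : VRep v y) (hx : VSmall s x) (hy : VSmall s y) (ho : opCost (2 * s + k) ≤ o) :
    Spec (projCoeffT u v) (Rep · (projCoeff x y)) (5 * (k + 1) * (k + 1 + o)) := by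
  refine Spec.mono ((dotT_spec hu hv hx hy ho).bind fun a ha =>
    (dotT_spec hv hv hy hy ho).bind fun c hc => fracDivT_spec ha hc (small_inner hx hy)
      (small_inner hy hy) ho) (fun r hr => hr) ?_
  nlinarith

theorem subMulT_spec {u v : Vec k} {r : Frac} {x y : EuclideanSpace ℝ (Fin k)} {q : ℝ} {s o : ℕ}
    (hu : VRep u x) (hr : Rep r q) (hv : VRep v y) (hx : VSmall s x) (hq : Small s q)
    (hy : VSmall s y) (ho : opCost (2 * s) ≤ o) :
    Spec (subMulT u r v) (VRep · (x - q • y)) (2 * (k + 1) * (k + 1 + o)) := by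
  have h := forUpT_spec (m := k) (s := u)
    (fun j w => ∀ l : Fin k, Rep (w l) (if l.val < j then x l - q * y l else x l))
    (body := fun l w => do
      let p ← fracMulT r (v l)
      let x ← fracSubT (u l) p
      pure (Function.update w l x)) (t := o + (o + 0)) (fun l => by simpa using hu l) ?_
  · refine h.mono (fun w hw l => ?_) (by nlinarith)
    simpa using hw l
  · intro j w hw
    refine Spec.bind (fracMulT_spec hr (hv j) hq (hy.small j)
      ((opCost_mono (by omega)).trans ho)) fun p hp => ?_
    refine Spec.bind (fracSubT_spec (hu j) hp ((hx.small j).mono (by omega))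
      ((hq.mul (hy.small j)).mono (by omega)) ho) fun z hz => Spec.pure fun l => ?_
    by_cases hl : l = j
    · subst hl
      rw [Function.update_self, if_pos (Nat.lt_succ_self _)]
      exact hz
    · have : l.val ≠ j.val := fun h => hl (Fin.ext h)
      rw [Function.update_of_ne hl]
      have h1 : l.val < j.val + 1 ↔ l.val < j.val := by omega
      simp only [h1]
      exact hw l

end Vectors

section Iteration

open Submodule

variable {n k : ℕ}

/-! ### Sizes of the intermediate results -/

theorem VSmall.mono {s t : ℕ} {x : EuclideanSpace ℝ (Fin k)} (h : VSmall s x) (hst : s ≤ t) :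
    VSmall t x := by
  obtain ⟨N, h1, h2, h3⟩ := h
  have := Nat.pow_le_pow_right (n := 2) (by omega) hst
  refine ⟨N, h1, by omega, fun l => ?_⟩
  obtain ⟨a, h4, h5⟩ := h3 l
  exact ⟨a, by omega, h5⟩

/-- A bound for the factor by which a vector grows when an integer multiple of an earlier vector
is subtracted in the reduction step. -/
def growth (n L A : ℕ) : ℕ := 3 * (n * A) ^ 2 * (L ^ 2 * A) ^ (n + 1)

/-- A bound for the common denominators, and for the numerators, of the vectors that occur in an
iteration. -/
def entryBound (n L A : ℕ) : ℕ := L * (L ^ 2 * A) ^ n * (n * A * growth n L A ^ n)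

variable {L A : ℕ} {b c : Fin n → EuclideanSpace ℝ (Fin k)} {i j : Fin n} {s : ℕ}

theorem growth_pos (hL : 0 < L) (hA : 0 < A) (hn : 0 < n) : 0 < growth n L A := by
  unfold growth; positivity

theorem Bounded.norm_le' (hb : Bounded L A b) (hA : 0 < A) (i : Fin n) :
    ‖b i‖ ≤ (n * A : ℕ) := by
  have h1 : 0 < n * A := Nat.mul_pos i.pos hA
  have h2 : (1 : ℝ) ≤ (n * A : ℕ) := by exact_mod_cast h1
  refine (sq_le_sq₀ (norm_nonneg _) (by positivity)).1 ?_
  have h3 := hb.norm_le i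
  push_cast at h2 ⊢
  nlinarith

theorem Bounded.norm_reduce_le (hb : Bounded L A b) (hL : 0 < L) (hA : 0 < A)
    (h : Shear b c i) (hj : j < i) {T : ℝ} (hT : 1 ≤ T) (hc : ‖c i‖ ≤ T) :
    ‖c i - nearest (projCoeff (c i) (gso b j)) • c j‖ ≤ T * growth n L A := by
  have hn : 0 < n := i.pos
  have hM : (1 : ℝ) ≤ (n * A : ℕ) := by exact_mod_cast Nat.mul_pos hn hA
  have hQ : (1 : ℝ) ≤ ((L ^ 2 * A : ℕ) : ℝ) ^ (n + 1) :=
    one_le_pow₀ (by exact_mod_cast Nat.one_le_iff_ne_zero.2 (by positivity))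
  have hbj := hb.norm_le' hA j
  have hg := hb.le_norm_gso hL hA j
  have hgb := norm_gso_le b j
  rw [h.of_ne j hj.ne, growth]
  push_cast at hM hQ hbj hg ⊢
  generalize ((L : ℝ) ^ 2 * A) ^ (n + 1) = Q at *
  generalize (n : ℝ) * A = M at *
  have hpos : 0 < ‖gso b j‖ ^ 2 := by
    have := norm_pos_iff.2 (gso_ne_zero hb.indep j)
    positivity
  have hμ : |projCoeff (c i) (gso b j)| ≤ T * M * Q := by
    rw [projCoeff, abs_div, real_inner_self_eq_norm_sq, abs_of_pos hpos, div_le_iff₀ hpos]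
    calc |inner ℝ (c i) (gso b j)| ≤ ‖c i‖ * ‖gso b j‖ := abs_real_inner_le_norm _ _
      _ ≤ T * M := mul_le_mul hc (hgb.trans hbj) (norm_nonneg _) (by linarith)
      _ ≤ T * M * (‖gso b j‖ ^ 2 * Q) := le_mul_of_one_le_right (by positivity) hg
      _ = _ := by ring
  have hr : |(nearest (projCoeff (c i) (gso b j)) : ℝ)| ≤ T * M * Q + 1 := by
    have h1 := abs_sub_nearest (projCoeff (c i) (gso b j))
    have h2 := abs_sub_abs_le_abs_sub (nearest (projCoeff (c i) (gso b j)) : ℝ)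
      (projCoeff (c i) (gso b j))
    rw [abs_sub_comm] at h2
    linarith
  have hMQ : 1 ≤ M * Q := one_le_mul_of_one_le_of_one_le hM hQ
  calc _ ≤ ‖c i‖ + ‖nearest (projCoeff (c i) (gso b j)) • b j‖ := norm_sub_le _ _
    _ ≤ T + (T * M * Q + 1) * M := by
        refine add_le_add hc ?_
        rw [← Int.cast_smul_eq_zsmul ℝ, norm_smul, Real.norm_eq_abs]
        exact mul_le_mul hr hbj (norm_nonneg _) (by positivity)
    _ ≤ T * (3 * M ^ 2 * Q) := by
        have h1 : 1 ≤ M * (M * Q) := one_le_mul_of_one_le_of_one_le hM hMQ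
        have h2 : M ≤ M * (M * Q) := le_mul_of_one_le_right (by linarith) hMQ
        nlinarith

theorem Bounded.vSmall_shear (hb : Bounded L A b) (hL : 0 < L) (hA : 0 < A)
    (hs : entryBound n L A < 2 ^ s) (h : Shear b c i)
    (hc : ‖c i‖ ≤ (n * A : ℕ) * (growth n L A : ℝ) ^ n) : VSmall s (c i) := by
  have hn : 0 < n := i.pos
  have hg := growth_pos hL hA hn
  have h1 : 0 < (L ^ 2 * A) ^ n := by positivity
  have h2 : 0 < n * A * growth n L A ^ n := by positivity
  have hint : Integral L (c i) := by
    refine Integral.of_mem_span (S := Set.range b) ?_ (h.lattice_eq.le (subset_span ⟨i, rfl⟩))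
    rintro _ ⟨i, rfl⟩
    exact hb.integral i
  have h3 : L * (n * A * growth n L A ^ n) ≤ entryBound n L A :=
    Nat.mul_le_mul (Nat.le_mul_of_pos_right _ h1) le_rfl
  refine hint.vSmall hL (((Nat.le_mul_of_pos_right _ h2).trans h3).trans_lt hs) ?_
  calc (L : ℝ) * ‖c i‖ ≤ L * ((n * A : ℕ) * (growth n L A : ℝ) ^ n) :=
        mul_le_mul_of_nonneg_left hc (Nat.cast_nonneg _)
    _ = ((L * (n * A * growth n L A ^ n) : ℕ) : ℝ) := by push_cast; ring
    _ < 2 ^ s := by exact_mod_cast h3.trans_lt hs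

theorem Bounded.vSmall_residual (hb : Bounded L A b) (hL : 0 < L) (hA : 0 < A)
    (hs : entryBound n L A < 2 ^ s) (i : Fin n) {m : ℕ} (hm : m ≤ n) :
    VSmall s (residual b (b i) m) := by
  have hn : 0 < n := i.pos
  have hg := growth_pos hL hA hn
  obtain ⟨d, hd, hv⟩ := exists_gdet_eq hb.integral hm
  have hd0 : 0 < d := by
    have := gdet_pos hL hb.indep m
    rw [hd] at this
    exact_mod_cast this
  lift d to ℕ using hd0.le
  have hd1 : d ≤ (L ^ 2 * A) ^ n := by
    have := hb.gdet_le hL hA m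
    rw [hd] at this
    exact_mod_cast this
  have hint : Integral (L * d : ℕ) (residual b (b i) m) := by
    have := hv (b i) (hb.integral i)
    rw [hd] at this
    exact_mod_cast this
  have h2 : 0 < n * A * growth n L A ^ n := by positivity
  have h3 : L * d * (n * A) ≤ entryBound n L A :=
    Nat.mul_le_mul (Nat.mul_le_mul_left _ hd1) (Nat.le_mul_of_pos_right _ (by positivity))
  refine hint.vSmall (Nat.mul_pos hL (by omega))
    (((Nat.le_mul_of_pos_right _ (by positivity)).trans h3).trans_lt hs) ?_
  calc ((L * d : ℕ) : ℝ) * ‖residual b (b i) m‖ ≤ (L * d : ℕ) * (n * A : ℕ) :=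
        mul_le_mul_of_nonneg_left ((norm_residual_le _ _ _).trans (hb.norm_le' hA i))
          (Nat.cast_nonneg _)
    _ = ((L * d * (n * A) : ℕ) : ℝ) := by push_cast; ring
    _ < 2 ^ s := by exact_mod_cast h3.trans_lt hs

theorem Bounded.vSmall_gso (hb : Bounded L A b) (hL : 0 < L) (hA : 0 < A)
    (hs : entryBound n L A < 2 ^ s) (i : Fin n) : VSmall s (gso b i) :=
  residual_self b i ▸ hb.vSmall_residual hL hA hs i i.isLt.le

theorem Bounded.vSmall (hb : Bounded L A b) (hL : 0 < L) (hA : 0 < A)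
    (hs : entryBound n L A < 2 ^ s) (i : Fin n) : VSmall s (b i) := by
  have := hb.vSmall_residual hL hA hs i (Nat.zero_le n)
  rwa [residual_zero] at this

/-! ### The steps of an iteration on bits -/

theorem gsoT_spec {B : Fin n → Vec k} (hB : ∀ i, VRep (B i) (b i)) (hnk : n ≤ k)
    (hs : ∀ i m, m ≤ n → VSmall s (residual b (b i) m)) {o : ℕ}
    (ho : opCost (4 * (2 * s + k)) ≤ o) :
    Spec (gsoT B) (fun star : Fin n → Vec k => ∀ i, VRep (star i) (gso b i))
      (9 * (k + 1) ^ 3 * (k + 1 + o)) := by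
  have hg : ∀ i, VSmall s (gso b i) := fun i => residual_self b i ▸ hs i i i.isLt.le
  have hb : ∀ i, VSmall s (b i) := fun i => by
    have := hs i 0 (Nat.zero_le n)
    rwa [residual_zero] at this
  have h := forUpT_spec (m := n) (s := (fun _ _ => Frac.zero : Fin n → Vec k))
    (fun m (star : Fin n → Vec k) => ∀ i : Fin n, i.val < m → VRep (star i) (gso b i))
    (body := fun m star => do
      let v ← forUpT m (B m) fun j acc => do
        let μ ← projCoeffT (B m) (star (Fin.castLE m.isLt.le j))
        subMulT acc μ (star (Fin.castLE m.isLt.le j))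
      pure (Function.update star m v)) (t := 8 * (k + 1) ^ 2 * (k + 1 + o) + 0)
    (fun i hi => absurd hi (Nat.not_lt_zero _)) ?_
  · refine h.mono (fun star hstar i => hstar i i.isLt) ?_
    calc n * (n + (8 * (k + 1) ^ 2 * (k + 1 + o) + 0))
        ≤ (k + 1) * ((k + 1) ^ 2 * (k + 1 + o) + 8 * (k + 1) ^ 2 * (k + 1 + o)) := by
          refine Nat.mul_le_mul (by omega) (Nat.add_le_add ?_ le_rfl)
          calc n ≤ 1 * (k + 1 + o) := by omega
            _ ≤ _ := Nat.mul_le_mul_right _ (Nat.one_le_pow _ _ (by omega))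
      _ = _ := by ring
  · intro m star hstar
    have hin := forUpT_spec (m := m) (s := B m)
      (fun j acc => VRep acc (residual b (b m) j))
      (body := fun j acc => do
        let μ ← projCoeffT (B m) (star (Fin.castLE m.isLt.le j))
        subMulT acc μ (star (Fin.castLE m.isLt.le j)))
      (t := 5 * (k + 1) * (k + 1 + o) + 2 * (k + 1) * (k + 1 + o))
      (by rw [residual_zero]; exact hB m) ?_
    · refine Spec.mono (hin.bind fun v hv => Spec.pure
        (P := fun star : Fin n → Vec k => ∀ i : Fin n, i.val < m.val + 1 → VRep (star i) (gso b i))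
        fun i hi => ?_) (fun _ h => h) ?_
      · by_cases him : i = m
        · subst him
          rw [Function.update_self, ← residual_self]
          exact hv
        · have : i.val ≠ m.val := fun h => him (Fin.ext h)
          rw [Function.update_of_ne him]
          exact hstar i (by omega)
      · have hmk : m.val ≤ k + 1 := by omega
        refine Nat.add_le_add ?_ le_rfl
        calc m.val * (m.val + (5 * (k + 1) * (k + 1 + o) + 2 * (k + 1) * (k + 1 + o)))
            ≤ (k + 1) * ((k + 1) * (k + 1 + o) +
              (5 * (k + 1) * (k + 1 + o) + 2 * (k + 1) * (k + 1 + o))) := by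
              refine Nat.mul_le_mul hmk (Nat.add_le_add ?_ le_rfl)
              nlinarith
          _ = _ := by ring
    · intro j acc hacc
      have hjm : (Fin.castLE m.isLt.le j).val < m.val := j.isLt
      refine Spec.bind (projCoeffT_spec (hB m) (hstar _ hjm) (hb m) (hg _)
        ((opCost_mono (by omega)).trans ho)) fun μ hμ => ?_
      have := residual_succ b (b m) (Fin.castLE m.isLt.le j)
      rw [show j.val + 1 = (Fin.castLE m.isLt.le j).val + 1 from rfl, this]
      exact subMulT_spec (s := 2 * (2 * s + k)) hacc hμ (hstar _ hjm)
        ((hs m j (by omega)).mono (by omega)) (small_projCoeff (hb m) (hg _))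
        ((hg _).mono (by omega)) ((opCost_mono (by omega)).trans ho)

theorem reduceStepT_spec (hb : Bounded L A b) (hL : 0 < L) (hA : 0 < A)
    (hs : entryBound n L A < 2 ^ s) (hnk : n ≤ k) {B star : Fin n → Vec k}
    (hB : ∀ i, VRep (B i) (b i)) (hstar : ∀ i, VRep (star i) (gso b i)) (i : Fin n) {o : ℕ}
    (ho : opCost (4 * (2 * s + k) + 2) ≤ o) :
    Spec (reduceStepT star i B) (fun c : Fin n → Vec k => ∀ l,
      VRep (c l) (reduceStep (gso b) i b l) ∧ VSmall s (reduceStep (gso b) i b l))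
      (9 * (k + 1) ^ 2 * (k + 1 + o)) := by
  have hn : 0 < n := i.pos
  have hg1 : (1 : ℝ) ≤ growth n L A := by exact_mod_cast growth_pos hL hA hn
  have hM : (1 : ℝ) ≤ (n * A : ℕ) := by exact_mod_cast Nat.mul_pos hn hA
  have hle : ∀ m ≤ n, ((n * A : ℕ) : ℝ) * (growth n L A : ℝ) ^ m ≤
      ((n * A : ℕ) : ℝ) * (growth n L A : ℝ) ^ n := fun m hm =>
    mul_le_mul_of_nonneg_left (pow_le_pow_right₀ hg1 hm) (by linarith)
  have hsm : ∀ c : Fin n → EuclideanSpace ℝ (Fin k), Shear b c i → ∀ m ≤ n,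
      ‖c i‖ ≤ (n * A : ℕ) * (growth n L A : ℝ) ^ m → VSmall s (c i) := fun c h m hm hc =>
    hb.vSmall_shear hL hA hs h (hc.trans (hle m hm))
  have hi := i.isLt
  have h := forDownT_spec (m := i) (fun j (C : Fin n → Vec k) c => (∀ l, VRep (C l) (c l)) ∧
      Shear b c i ∧ ‖c i‖ ≤ (n * A : ℕ) * (growth n L A : ℝ) ^ (i.val - j))
    (s := B) (r := b)
    (body := fun j c => do
      let μ ← projCoeffT (c i) (star (Fin.castLE i.isLt.le j))
      let r ← nearestT μ
      let v ← subMulT (c i) ⟨r, .one⟩ (c (Fin.castLE i.isLt.le j))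
      pure (Function.update c i v))
    (g := fun c j => Function.update c i
      (c i - nearest (projCoeff (c i) (gso b (Fin.castLE i.isLt.le j))) •
        c (Fin.castLE i.isLt.le j)))
    (t := 5 * (k + 1) * (k + 1 + o) + (o + (2 * (k + 1) * (k + 1 + o) + 0)))
    ⟨hB, Shear.refl b i, by simpa using hb.norm_le' hA i⟩ ?_
  · refine h.mono (fun C hC l => ⟨hC.1 l, ?_⟩) ?_
    · by_cases hl : l = i
      · subst hl
        exact hsm _ hC.2.1 _ (by omega) hC.2.2
      · have h5 : reduceStep (gso b) i b l = b l := hC.2.1.of_ne l hl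
        rw [h5]; exact hb.vSmall hL hA hs l
    · calc _ ≤ (k + 1) * ((k + 1) * (k + 1 + o) + (5 * (k + 1) * (k + 1 + o) +
            ((k + 1) * (k + 1 + o) + (2 * (k + 1) * (k + 1 + o) + 0)))) := by
            refine Nat.mul_le_mul (by omega) (Nat.add_le_add (by nlinarith)
              (Nat.add_le_add le_rfl (Nat.add_le_add (by nlinarith) le_rfl)))
        _ = _ := by ring
  · rintro j C c ⟨h1, h2, h3⟩
    have hj : Fin.castLE i.isLt.le j < i := by rw [Fin.lt_def]; exact j.isLt
    have hjlt := j.isLt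
    have hci : VSmall s (c i) := hsm c h2 _ (by omega) h3
    have hgj := hb.vSmall_gso hL hA hs (Fin.castLE i.isLt.le j)
    have hcj : VSmall s (c (Fin.castLE i.isLt.le j)) := by
      rw [h2.of_ne _ hj.ne]; exact hb.vSmall hL hA hs _
    refine Spec.bind (projCoeffT_spec (h1 i) (hstar _) hci hgj
      ((opCost_mono (by omega)).trans ho)) fun μ hμ => ?_
    refine Spec.bind (nearestT_spec hμ (small_projCoeff hci hgj)
      ((opCost_mono (by omega)).trans ho)) fun r hr => ?_
    refine Spec.bind (subMulT_spec (s := 2 * (2 * s + k) + 1) (h1 i) hr (h1 _)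
      (hci.mono (by omega)) (small_projCoeff hci hgj).nearest (hcj.mono (by omega))
      ((opCost_mono (by omega)).trans ho)) fun v hv => Spec.pure ⟨fun l => ?_, h2.update hj _, ?_⟩
    · by_cases hl : l = i
      · subst hl
        rw [Function.update_self, Function.update_self, ← Int.cast_smul_eq_zsmul ℝ]
        exact hv
      · rw [Function.update_of_ne hl, Function.update_of_ne hl]
        exact h1 l
    · rw [Function.update_self, show i.val - j.val = i.val - (j.val + 1) + 1 by omega, pow_succ,
        ← mul_assoc]
      exact hb.norm_reduce_le hL hA h2 hj
        (one_le_mul_of_one_le_of_one_le hM (one_le_pow₀ hg1)) h3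

theorem vecSize_le {u : Vec k} {x : EuclideanSpace ℝ (Fin k)} (hu : VRep u x) (hx : VSmall s x) :
    vecSize u ≤ k * (2 * s) := by
  rw [vecSize]
  refine (Finset.sum_le_card_nsmul _ _ (2 * s) fun l _ => ?_).trans (by simp)
  have := (hu l).fits (hx.small l)
  have h1 := this.1
  have h2 := this.2
  rw [Frac.size]; omega

/-- An iteration on bits follows the iteration in real arithmetic. -/
theorem iterationT_spec (δ : ℝ) {e : ℕ} (he : ∀ (s : ℕ) (x : Frac), x.Fits s →
      (thresholdT δ x).cost ≤ opCost (s + e)) (hb : Bounded L A b) (hL : 0 < L) (hA : 0 < A)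
    (hs : entryBound n L A < 2 ^ s) (hnk : n ≤ k) {B : Fin n → Vec k}
    (hB : ∀ i, VRep (B i) (b i)) {m : ℕ} (h : m < n) {o : ℕ}
    (ho : opCost (8 * (2 * s + k) + 2 + e) ≤ o) :
    Spec (iterationT (thresholdT δ) ⟨m, B⟩ h) (fun st => st.idx = (iteration δ ⟨m, b⟩ h).idx ∧
      ∀ i, VRep (st.basis i) ((iteration δ ⟨m, b⟩ h).basis i))
      (40 * (k + 1) ^ 3 * (k + 1 + o)) := by
  set i : Fin n := ⟨m, h⟩ with hi
  set p : Fin n := ⟨m - 1, (Nat.sub_le _ _).trans_lt h⟩ with hp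
  have hgp := hb.vSmall_gso hL hA hs p
  have hgi := hb.vSmall_gso hL hA hs i
  have hos : ∀ {t : ℕ}, t ≤ 8 * (2 * s + k) + 2 + e → opCost t ≤ o := fun ht =>
    (opCost_mono ht).trans ho
  have hso : s ≤ o := by
    have : s ≤ opCost s := by
      have : 2 * s + 3 ≤ (2 * s + 3) ^ 4 := Nat.le_self_pow (by omega) _
      unfold opCost; omega
    exact this.trans (hos (by omega))
  have hcost : 9 * (k + 1) ^ 3 * (k + 1 + o) + (9 * (k + 1) ^ 2 * (k + 1 + o) +
      (5 * (k + 1) * (k + 1 + o) + (o + (2 * (k + 1) * (k + 1 + o) + (2 * (k + 1) * (k + 1 + o) +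
        (o + (o + (o + (4 * k * s + 0))))))))) ≤ 40 * (k + 1) ^ 3 * (k + 1 + o) := by
    have h1 : 1 * (k + 1) ^ 2 ≤ (k + 1) * (k + 1) ^ 2 := Nat.mul_le_mul_right _ (by omega)
    have h2 : 1 * (k + 1) ≤ (k + 1) * (k + 1) := Nat.mul_le_mul_right _ (by omega)
    have h3 : (k + 1) ^ 2 * (k + 1 + o) ≤ (k + 1) ^ 3 * (k + 1 + o) :=
      Nat.mul_le_mul_right _ (by rw [pow_succ' _ 2]; omega)
    have h4 : (k + 1) * (k + 1 + o) ≤ (k + 1) ^ 2 * (k + 1 + o) :=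
      Nat.mul_le_mul_right _ (by rw [sq]; omega)
    have h5 : 1 * (k + 1 + o) ≤ (k + 1) * (k + 1 + o) := Nat.mul_le_mul_right _ (by omega)
    have h6 : k * s ≤ (k + 1) * (k + 1 + o) := Nat.mul_le_mul (by omega) (by omega)
    nlinarith
  -- the cost is the sum of the costs of the steps, in their order; the last one is the swap
  refine Spec.mono (t := 9 * (k + 1) ^ 3 * (k + 1 + o) + (9 * (k + 1) ^ 2 * (k + 1 + o) +
      (5 * (k + 1) * (k + 1 + o) + (o + (2 * (k + 1) * (k + 1 + o) + (2 * (k + 1) * (k + 1 + o) +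
        (o + (o + (o + (4 * k * s + 0)))))))))) ?_ (fun _ h => h) hcost
  refine Spec.bind (gsoT_spec hB hnk (fun i m hm => hb.vSmall_residual hL hA hs i hm)
    (hos (by omega))) fun star hstar => ?_
  refine Spec.bind (reduceStepT_spec hb hL hA hs hnk hB hstar i (hos (by omega))) fun C hC => ?_
  refine Spec.bind (projCoeffT_spec (hC i).1 (hstar p) (hC i).2 hgp (hos (by omega)))
    fun μ hμ => ?_
  have hμs := small_projCoeff (hC i).2 hgp
  refine Spec.bind (fracMulT_spec hμ hμ hμs hμs (hos (by omega))) fun sq hsq => ?_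
  refine Spec.bind (dotT_spec (hstar i) (hstar i) hgi hgi (hos (by omega))) fun x hx => ?_
  refine Spec.bind (dotT_spec (hstar p) (hstar p) hgp hgp (hos (by omega))) fun y hy => ?_
  have hxs := small_inner hgi hgi
  have hys := small_inner hgp hgp
  refine Spec.bind (fracDivT_spec hx hy hxs hys (hos (by omega))) fun ρ hρ => ?_
  refine Spec.bind (fracAddT_spec (s := 4 * (2 * s + k)) hρ hsq ((hxs.div hys).mono (by omega))
    ((hμs.mul hμs).mono (by omega)) (hos (by omega))) fun t ht => ?_
  have hts := ((hxs.div hys).add (hμs.mul hμs))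
  have hpos : 0 < ‖gso b p‖ ^ 2 := by
    have := norm_pos_iff.2 (gso_ne_zero hb.indep p)
    positivity
  have hle : Spec (thresholdT δ t) (fun ok => ok = true ↔
      (δ - projCoeff (reduceStep (gso b) i b i) (gso b p) ^ 2) * ‖gso b p‖ ^ 2 ≤
        ‖gso b i‖ ^ 2) o := by
    refine ⟨?_, (he _ _ (ht.fits hts)).trans (hos (by omega))⟩
    -- dividing by `‖gso b p‖ ^ 2` turns the ordering condition into the tested one
    change (thresholdT δ t).val = true ↔ _
    rw [thresholdT_val, ht.toRat, real_inner_self_eq_norm_sq, real_inner_self_eq_norm_sq,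
      ← sub_le_iff_le_add, le_div_iff₀ hpos, pow_two (projCoeff _ _)]
  refine Spec.bind hle fun ok hok => ?_
  have hit : iteration δ ⟨m, b⟩ h =
      if (δ - projCoeff (reduceStep (gso b) i b i) (gso b p) ^ 2) * ‖gso b p‖ ^ 2 ≤
        ‖gso b i‖ ^ 2 then ⟨m + 1, reduceStep (gso b) i b⟩
      else ⟨max 1 (m - 1), reduceStep (gso b) i b ∘ Equiv.swap p i⟩ := rfl
  by_cases hc : (δ - projCoeff (reduceStep (gso b) i b i) (gso b p) ^ 2) * ‖gso b p‖ ^ 2 ≤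
      ‖gso b i‖ ^ 2
  · rw [if_pos (hok.2 hc), hit, if_pos hc]
    exact (Spec.pure ⟨rfl, fun l => (hC l).1⟩ : Spec _ _ 0).mono (fun _ h => h) (Nat.zero_le _)
  · rw [if_neg (fun h => hc (hok.1 h)), hit, if_neg hc]
    refine Spec.bind (P := fun _ => True) ⟨trivial, ?_⟩
      fun _ _ => Spec.pure ⟨rfl, fun l => (hC _).1⟩
    have h1 := vecSize_le (hC p).1 (hC p).2
    have h2 := vecSize_le (hC i).1 (hC i).2
    rw [cost_tick]
    nlinarith

end Iteration

section Termination

variable {n k : ℕ}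

/-! ### The number of iterations -/

/-- If the potential is at most `δ⁻¹ ^ p`, the loop stops after at most `2 * p + (n - idx)`
iterations: an increase of the index lowers this number by one, and a swap lowers `p` by one and
the index by at most one. -/
theorem exists_run {δ : ℝ} (hδ0 : 0 < δ) (hδ : δ < 1) {L A s e o : ℕ} (hL : 0 < L) (hA : 0 < A)
    (he : ∀ (s : ℕ) (x : Frac), x.Fits s → (thresholdT δ x).cost ≤ opCost (s + e))
    (hs : entryBound n L A < 2 ^ s) (hnk : n ≤ k) (ho : opCost (8 * (2 * s + k) + 2 + e) ≤ o)
    (f : ℕ) (st : State n (EuclideanSpace ℝ (Fin k))) (B : Fin n → Vec k) (p : ℕ)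
    (hst : Invariant δ L A st) (hB : ∀ i, VRep (B i) (st.basis i))
    (hp : δ ^ p * potential L st.basis ≤ 1) (hf : 2 * p + (n - st.idx) ≤ f) :
    ∃ (out : Fin n → EuclideanSpace ℝ (Fin k)) (bits : Fin n → Vec k) (t : ℕ),
      Run δ st out ∧ RunT δ ⟨st.idx, B⟩ bits t ∧ (∀ i, VRep (bits i) (out i)) ∧
      LinearIndependent ℝ out ∧ IsReduced δ out ∧ lattice out = lattice st.basis ∧
      t ≤ (f + 1) * (n + 1 + 40 * (k + 1) ^ 3 * (k + 1 + o)) := by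
  have hsize : Nat.size n ≤ n := Nat.size_le.2 n.lt_two_pow_self
  induction f generalizing st B p with
  | zero =>
    have hidx : n ≤ st.idx := by omega
    exact ⟨st.basis, B, _, Run.halt st hidx, RunT.halt ⟨st.idx, B⟩ hidx, hB, hst.bounded.indep,
      hst.reduced.isReduced hidx, rfl, by rw [zero_add, one_mul]; omega⟩
  | succ f ih =>
    by_cases hidx : n ≤ st.idx
    · refine ⟨st.basis, B, _, Run.halt st hidx, RunT.halt ⟨st.idx, B⟩ hidx, hB,
        hst.bounded.indep, hst.reduced.isReduced hidx, rfl, ?_⟩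
      rw [add_mul (f + 1), one_mul]; omega
    · have hlt : st.idx < n := not_le.1 hidx
      obtain ⟨hinv, hlat, hstep⟩ := iteration_spec hδ hL hst hlt
      obtain ⟨⟨hi, hv⟩, hcost⟩ := iterationT_spec δ he hst.bounded hL hA hs hnk hB hlt ho
      have hpot := one_le_potential hL hinv.bounded.indep hinv.bounded.integral
      have hpot' := one_le_potential hL hst.bounded.indep hst.bounded.integral
      have hnext : ∃ p', δ ^ p' * potential L (iteration δ st hlt).basis ≤ 1 ∧
          2 * p' + (n - (iteration δ st hlt).idx) ≤ f := by
        rcases hstep with ⟨h1, h2⟩ | ⟨h1, h2⟩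
        · exact ⟨p, by rwa [h2], by omega⟩
        · obtain _ | p := p
          · -- a swap would bring the potential below `1`
            rw [pow_zero, one_mul] at hp
            nlinarith
          · refine ⟨p, ?_, by omega⟩
            calc _ ≤ δ ^ p * (δ * potential L st.basis) :=
                  mul_le_mul_of_nonneg_left h2 (by positivity)
              _ = δ ^ (p + 1) * potential L st.basis := by ring
              _ ≤ 1 := hp
      obtain ⟨p', hp', hf'⟩ := hnext
      obtain ⟨out, bits, t, h1, h2, h3, h4, h5, h6, h7⟩ :=
        ih (iteration δ st hlt) (iterationT (thresholdT δ) ⟨st.idx, B⟩ hlt).val.basis p' hinv hv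
          hp' hf'
      refine ⟨out, bits, _, Run.loop st hlt out h1, RunT.loop ⟨st.idx, B⟩ hlt bits t ?_, h3, h4,
        h5, h6.trans hlat, ?_⟩
      · have h8 : (⟨(iteration δ st hlt).idx,
            (iterationT (thresholdT δ) ⟨st.idx, B⟩ hlt).val.basis⟩ : State n (Vec k)) =
            (iterationT (thresholdT δ) ⟨st.idx, B⟩ hlt).val := by
          rw [← show _ = (iteration δ st hlt).idx from hi]
        rwa [h8] at h2
      · rw [add_mul (f + 1), one_mul]; omega

/-! ### The initial basis -/

theorem bounded_realVec {c : ℕ} {B : Fin n → Fin k → ℚ} (hB : LinearIndependent ℝ (realVec B))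
    (hc : ∀ i j, Nat.size (B i j).num.natAbs ≤ c ∧ Nat.size (B i j).den ≤ c) :
    Bounded (2 ^ c).factorial ((k + 1) * 4 ^ c) (realVec B) := by
  have hnorm : ∀ i, ‖realVec B i‖ ^ 2 ≤ (((k + 1) * 4 ^ c : ℕ) : ℝ) := by
    intro i
    rw [EuclideanSpace.norm_sq_eq]
    have h1 : ∀ j, ‖realVec B i j‖ ^ 2 ≤ (4 : ℝ) ^ c := by
      intro j
      have h2 : |B i j| ≤ 2 ^ c := by
        have h3 : (B i j).num.natAbs < 2 ^ c := Nat.size_le.1 (hc i j).1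
        have h4 : |((B i j).num : ℚ)| ≤ 2 ^ c := by
          rw [← Int.cast_abs, Int.abs_eq_natAbs]
          exact_mod_cast h3.le
        refine le_trans ?_ h4
        conv_lhs => rw [← Rat.num_div_den (B i j), abs_div, Nat.abs_cast]
        exact div_le_self (abs_nonneg _) (by exact_mod_cast (B i j).den_pos)
      have h5 : |((B i j : ℚ) : ℝ)| ≤ 2 ^ c := by exact_mod_cast h2
      calc ‖realVec B i j‖ ^ 2 = |((B i j : ℚ) : ℝ)| ^ 2 := rfl
        _ ≤ (2 ^ c) ^ 2 := pow_le_pow_left₀ (abs_nonneg _) h5 2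
        _ = 4 ^ c := by rw [← pow_mul, mul_comm, pow_mul]; norm_num
    refine (Finset.sum_le_card_nsmul _ _ _ fun j _ => h1 j).trans ?_
    rw [Finset.card_univ, Fintype.card_fin, nsmul_eq_mul]
    push_cast
    exact mul_le_mul_of_nonneg_right (by linarith) (by positivity)
  refine ⟨fun i j => ?_, hB, fun i => ?_, fun i => ?_⟩
  · have h1 : (B i j).den ∣ (2 ^ c).factorial :=
      Nat.dvd_factorial (B i j).den_pos (Nat.size_le.1 (hc i j).2).le
    obtain ⟨d, hd⟩ := h1
    refine ⟨d * (B i j).num, ?_⟩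
    have h2 : (((B i j).den : ℕ) : ℝ) ≠ 0 := Nat.cast_ne_zero.2 (B i j).den_nz
    change ((2 ^ c).factorial : ℝ) * ((B i j : ℚ) : ℝ) = _
    rw [hd, Rat.cast_def]
    push_cast
    field_simp
  · exact (pow_le_pow_left₀ (norm_nonneg _) (norm_gso_le _ i) 2).trans (hnorm i)
  · refine (hnorm i).trans (le_mul_of_one_le_left (Nat.cast_nonneg _) ?_)
    exact_mod_cast i.pos

theorem vRep_ofRat (B : Fin n → Fin k → ℚ) (i : Fin n) :
    VRep (fun j => Frac.ofRat (B i j)) (realVec B i) := fun j => ⟨B i j, rfl, rfl⟩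

/-! ### Polynomial bounds -/

/-- A common bound for `L ^ 2 * A` and `n * A`, with `A = (k + 1) * 4 ^ c` the bound for the squared
lengths of the input vectors. -/
theorem initial_bounds {L c e : ℕ} (hLe : L ≤ 2 ^ e) (hce : 2 * c ≤ e) (he : 1 ≤ e)
    (hnk : n ≤ k) : L ^ 2 * ((k + 1) * 4 ^ c) ≤ 2 ^ (4 * e * (k + 1)) ∧
      n * ((k + 1) * 4 ^ c) ≤ 2 ^ (4 * e * (k + 1)) := by
  have hK : k + 1 ≤ 2 ^ (k + 1) := Nat.lt_two_pow_self.le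
  have h4 : 4 ^ c ≤ 2 ^ e := by
    rw [show 4 = 2 ^ 2 from rfl, ← pow_mul]
    exact Nat.pow_le_pow_right (by omega) hce
  have heK : e ≤ e * (k + 1) := Nat.le_mul_of_pos_right _ (by omega)
  have hKe : k + 1 ≤ e * (k + 1) := Nat.le_mul_of_pos_left _ (by omega)
  have h4e : 4 * e * (k + 1) = 4 * (e * (k + 1)) := by ring
  constructor
  · calc L ^ 2 * ((k + 1) * 4 ^ c) ≤ (2 ^ e) ^ 2 * (2 ^ (k + 1) * 2 ^ e) :=
          Nat.mul_le_mul (Nat.pow_le_pow_left hLe 2) (Nat.mul_le_mul hK h4)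
      _ = 2 ^ (e * 2 + (k + 1 + e)) := by rw [← pow_mul, ← pow_add, ← pow_add]
      _ ≤ _ := Nat.pow_le_pow_right (by omega) (by omega)
  · calc n * ((k + 1) * 4 ^ c) ≤ 2 ^ (k + 1) * (2 ^ (k + 1) * 2 ^ e) :=
          Nat.mul_le_mul (by omega) (Nat.mul_le_mul hK h4)
      _ = 2 ^ (k + 1 + (k + 1 + e)) := by rw [← pow_add, ← pow_add]
      _ ≤ _ := Nat.pow_le_pow_right (by omega) (by omega)

theorem entryBound_lt {L A q : ℕ} (hL : 0 < L) (hA : 0 < A) (hQ : L ^ 2 * A ≤ 2 ^ q)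
    (hM : n * A ≤ 2 ^ q) (hq : 1 ≤ q) (hnk : n ≤ k) :
    entryBound n L A < 2 ^ (8 * q * (k + 1) ^ 2 + 1) := by
  set K := k + 1 with hK
  have hK1 : 1 ≤ K := by omega
  have hqK : q ≤ q * K := Nat.le_mul_of_pos_right _ hK1
  have hg : growth n L A ≤ 2 ^ (5 * (q * K)) := by
    calc growth n L A ≤ 2 ^ 2 * (2 ^ q) ^ 2 * (2 ^ q) ^ K := by
          refine Nat.mul_le_mul (Nat.mul_le_mul (by norm_num) (Nat.pow_le_pow_left hM 2)) ?_
          exact (Nat.pow_le_pow_left hQ _).trans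
            (Nat.pow_le_pow_right (by positivity) (by omega))
      _ = 2 ^ (2 + q * 2 + q * K) := by rw [← pow_mul, ← pow_mul, ← pow_add, ← pow_add]
      _ ≤ _ := Nat.pow_le_pow_right (by omega) (by omega)
  have hLQ : L ≤ 2 ^ q := by
    refine le_trans ?_ hQ
    rw [sq, mul_assoc]
    exact Nat.le_mul_of_pos_right _ (by positivity)
  have hKK : q * K ≤ q * K * K := Nat.le_mul_of_pos_right _ hK1
  calc entryBound n L A ≤ 2 ^ q * (2 ^ q) ^ K * (2 ^ q * (2 ^ (5 * (q * K))) ^ K) := by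
        refine Nat.mul_le_mul (Nat.mul_le_mul hLQ ?_) (Nat.mul_le_mul hM ?_)
        · exact (Nat.pow_le_pow_left hQ _).trans
            (Nat.pow_le_pow_right (by positivity) (by omega))
        · exact (Nat.pow_le_pow_left hg _).trans
            (Nat.pow_le_pow_right (by positivity) (by omega))
    _ = 2 ^ (q + q * K + (q + 5 * (q * K) * K)) := by
        rw [← pow_mul, ← pow_mul, ← pow_add, ← pow_add, ← pow_add]
    _ < _ := by
        refine Nat.pow_lt_pow_right (by omega) ?_
        rw [show 8 * q * K ^ 2 = 8 * (q * K * K) by ring,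
          show 5 * (q * K) * K = 5 * (q * K * K) by ring]
        omega

/-- The number of iterations times the cost of one, for the value of `s` that `entryBound_lt`
provides with `q = 4 * e * (k + 1)`. -/
theorem totalCost_le (p e e' : ℕ) (hnk : n ≤ k) :
    (2 * (p * (4 * e * (k + 1) * (k + 1) ^ 2)) + n + 1) * (n + 1 + 40 * (k + 1) ^ 3 *
      (k + 1 + opCost (8 * (2 * (8 * (4 * e * (k + 1)) * (k + 1) ^ 2 + 1) + k) + 2 + e'))) ≤
    (8 * p * e + 1) * (41 + 40 * (30 * (1024 * e + 55 + 2 * e') ^ 4)) * (k + 1) ^ 18 := by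
  set K := k + 1 with hK
  have hK1 : 1 ≤ K := by omega
  have hpow : ∀ b ≠ 0, K ≤ K ^ b := fun b h => Nat.le_self_pow h K
  have h1 : 2 * (p * (4 * e * K * K ^ 2)) + n + 1 ≤ (8 * p * e + 1) * K ^ 3 := by
    have : n + 1 ≤ K ^ 3 := (by omega : n + 1 ≤ K).trans (hpow 3 (by omega))
    calc _ = 8 * p * e * K ^ 3 + (n + 1) := by ring
      _ ≤ 8 * p * e * K ^ 3 + K ^ 3 := Nat.add_le_add_left this _
      _ = _ := by ring
  have h2 : 2 * (8 * (2 * (8 * (4 * e * K) * K ^ 2 + 1) + k) + 2 + e') + 3 ≤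
      (1024 * e + 55 + 2 * e') * K ^ 3 := by
    have h3 : 1 ≤ K ^ 3 := Nat.one_le_pow _ _ hK1
    have h4 : k ≤ K ^ 3 := (by omega : k ≤ K).trans (hpow 3 (by omega))
    have h5 : e' ≤ e' * K ^ 3 := Nat.le_mul_of_pos_right _ h3
    calc _ = 1024 * e * K ^ 3 + (39 + 16 * k + 2 * e') := by ring
      _ ≤ 1024 * e * K ^ 3 + (55 * K ^ 3 + 2 * (e' * K ^ 3)) := by omega
      _ = _ := by ring
  have h3 : opCost (8 * (2 * (8 * (4 * e * K) * K ^ 2 + 1) + k) + 2 + e') ≤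
      30 * (1024 * e + 55 + 2 * e') ^ 4 * K ^ 12 := by
    calc _ ≤ 30 * ((1024 * e + 55 + 2 * e') * K ^ 3) ^ 4 :=
          Nat.mul_le_mul_left _ (Nat.pow_le_pow_left h2 4)
      _ = _ := by ring
  generalize opCost (8 * (2 * (8 * (4 * e * K) * K ^ 2 + 1) + k) + 2 + e') = o at *
  generalize 30 * (1024 * e + 55 + 2 * e') ^ 4 = c at *
  have h4 : n + 1 + 40 * K ^ 3 * (K + o) ≤ (41 + 40 * c) * K ^ 15 := by
    have h5 : K ≤ K ^ 12 := hpow 12 (by omega)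
    have h6 : n + 1 ≤ K ^ 15 := (by omega : n + 1 ≤ K).trans (hpow 15 (by omega))
    calc n + 1 + 40 * K ^ 3 * (K + o) ≤ K ^ 15 + 40 * K ^ 3 * (K ^ 12 + c * K ^ 12) :=
          Nat.add_le_add h6 (Nat.mul_le_mul_left _ (Nat.add_le_add h5 h3))
      _ = _ := by ring
  calc _ ≤ (8 * p * e + 1) * K ^ 3 * ((41 + 40 * c) * K ^ 15) := Nat.mul_le_mul h1 h4
    _ = _ := by ring

end Termination

end LLL

theorem theorem4p9 :
    ∃ m : ℕ, ∀ δ : ℝ, 1 / 4 < δ → δ < 1 → ∀ c : ℕ, ∃ C : ℕ,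
      ∀ (n k : ℕ) (B : Fin n → Fin k → ℚ),
        LinearIndependent ℝ (LLL.realVec B) →
        (∀ i j, Nat.size (B i j).num.natAbs ≤ c ∧ Nat.size (B i j).den ≤ c) →
        ∃ (out : Fin n → Fin k → ℚ) (bits : Fin n → Fin k → LLL.Frac) (t : ℕ),
          LLL.Outputs δ (LLL.realVec B) (LLL.realVec out) ∧
          LinearIndependent ℝ (LLL.realVec out) ∧
          LLL.IsReduced δ (LLL.realVec out) ∧
          LLL.lattice (LLL.realVec out) = LLL.lattice (LLL.realVec B) ∧
          LLL.OutputsT δ B bits t ∧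
          (∀ i j, (bits i j).toRat = out i j) ∧
          t ≤ C * (k + 1) ^ m := by
  refine ⟨18, fun δ hδ4 hδ c => ?_⟩
  have hδ0 : 0 < δ := by linarith
  obtain ⟨e', he'⟩ := LLL.thresholdT_cost δ
  -- every factor `2` of the potential allows for at most `p` swaps
  obtain ⟨p, hp⟩ := exists_pow_lt_of_lt_one (show (0 : ℝ) < 1 / 2 by norm_num) hδ
  have hL : 0 < (2 ^ c).factorial := Nat.factorial_pos _
  -- all denominators of the input are at most `2 ^ c`, hence divide `L`
  set L := (2 ^ c).factorial with hLdef
  set e := L + 2 * c + 1 with he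
  refine ⟨(8 * p * e + 1) * (41 + 40 * (30 * (1024 * e + 55 + 2 * e') ^ 4)), fun n k B hB hc => ?_⟩
  have hnk : n ≤ k := by
    simpa using hB.fintype_card_le_finrank
  have hA : 0 < (k + 1) * 4 ^ c := by positivity
  have hLe : L ≤ 2 ^ e := Nat.lt_two_pow_self.le.trans (Nat.pow_le_pow_right (by omega) (by omega))
  obtain ⟨hQ, hM⟩ := LLL.initial_bounds (c := c) hLe (by omega) (by omega) hnk
  have hq : 1 ≤ 4 * e * (k + 1) := Nat.one_le_iff_ne_zero.2 (by positivity)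
  have hbd := LLL.bounded_realVec hB hc
  have hpot : δ ^ (p * (4 * e * (k + 1) * (k + 1) ^ 2)) * LLL.potential L (LLL.realVec B) ≤ 1 := by
    have h1 : LLL.potential L (LLL.realVec B) ≤ 2 ^ (4 * e * (k + 1) * (k + 1) ^ 2) := by
      refine (hbd.potential_le hL hA).trans ?_
      rw [pow_mul (2 : ℝ)]
      have h2 : ((L ^ 2 * ((k + 1) * 4 ^ c) : ℕ) : ℝ) ≤ 2 ^ (4 * e * (k + 1)) := by
        exact_mod_cast hQ
      refine (pow_le_pow_left₀ (Nat.cast_nonneg _) h2 _).trans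
        (pow_le_pow_right₀ (one_le_pow₀ one_le_two) ?_)
      rw [sq]
      exact Nat.mul_le_mul (by omega) (by omega)
    calc _ ≤ (1 / 2 : ℝ) ^ (4 * e * (k + 1) * (k + 1) ^ 2) *
          2 ^ (4 * e * (k + 1) * (k + 1) ^ 2) := by
          rw [pow_mul]
          exact mul_le_mul (pow_le_pow_left₀ (by positivity) hp.le _) h1
            (zero_le_one.trans (LLL.one_le_potential hL hB hbd.integral)) (by positivity)
      _ = 1 := by rw [← mul_pow]; norm_num
  obtain ⟨out, bits, t, h1, h2, h3, h4, h5, h6, h7⟩ := LLL.exists_run hδ0 hδ hL hA he'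
    (LLL.entryBound_lt hL hA hQ hM hq hnk) hnk le_rfl
    (2 * (p * (4 * e * (k + 1) * (k + 1) ^ 2)) + n) ⟨1, LLL.realVec B⟩
    (fun i j => LLL.Frac.ofRat (B i j)) _ ⟨le_rfl, hbd, LLL.reducedBelow_one δ _⟩
    (LLL.vRep_ofRat B) hpot (Nat.add_le_add_left (Nat.sub_le _ _) _)
  have hout : LLL.realVec (fun i j => (bits i j).toRat) = out := by
    funext i
    ext j
    exact (h3 i j).toRat
  exact ⟨fun i j => (bits i j).toRat, bits, t, hout ▸ h1, hout ▸ h4, hout ▸ h5, hout ▸ h6, h2,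
    fun _ _ => rfl, h7.trans (LLL.totalCost_le p e e' hnk)⟩
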